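/- **Conventions.** Manifolds are smooth, finite-dimensional and without boundary, possibly with components of different dimensions. For a Lie groupoid $G\rightrightarrows G_0$ with structure maps $l,r:G\to G_0$ (smooth submersions; $gh$ is defined when $r(g)=l(h)$), let $A$ be its Lie algebroid, $A_x=\ker(d_{1_x}r)\subset T_{1_x}G$, and let $Q_A=\bigwedge^{\rm top}A\otimes\bigwedge^{\rm top}T^*G_0$. A $(G',G'')$-bibundle is a manifold $B$ with smooth maps $p:B\to G'_0$, $q:B\to G''_0$ and commuting smooth actions of $G'$ from the left along $p$ (with $q$ invariant) and of $G''$ from the right along $q$ (with $p$ invariant). It is invertible if $p$ and $q$ are surjective submersions and the left (right) action is principal over $q$ (over $p$), i.e. free and transitive on the fibres, with smooth division map. An isomorphism of bibundles is an equivariant diffeomorphism compatible with $p$ and $q$. The composition of a $(G',G'')$-bibundle $B$ and a $(G'',G''')$-bibundle $C$, both invertible, is the quotient $(B\times_{G''_0}C)/G''$ by $h\cdot(b,c)=(bh,h^{-1}c)$, with the manifold structure for which the projection is a smooth submersion, and with the induced maps and actions. For a point $b$ of an invertible bibundle put $x=p(b)$, $y=q(b)$. Let $u:A'_x\to T_bB$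 and $v:A''_y\to T_bB$ send the velocities at $t=0$ of curves $g_t$, $h_t$ in the $r$-fibres of $x$ and $y$, starting at the units, to the velocities of $g_tb$ and of $bh_t^{-1}$. The exact sequences $$0\to A''_y\xrightarrow{v}T_bB\xrightarrow{dp}T_xG'_0\to0,\qquad 0\to A'_x\xrightarrow{u}T_bB\xrightarrow{dq}T_yG''_0\to0$$ give an isomorphism $\tau_b:(Q_{A''})_y\to(Q_{A'})_x$, as follows. Take bases $e',e''$ of $A'_x,A''_y$ and $\tau',\tau''$ of $T_xG'_0,T_yG''_0$, with dual bases $\tau'^*,\tau''^*$, and lifts $t',t''$ of $\tau',\tau''$ to $T_bB$ along $dp$, $dq$. Write $\bigwedge e$ for the wedge product, in order, of the members of a family $e$. Then $\tau_b(c''\bigwedge e''\otimes\bigwedge\tau''^*)=c'\bigwedge e'\otimes\bigwedge\tau'^*$ if and only if $$c'\,\textstyle\bigwedge u(e')\wedge\bigwedge t''=(-1)^{\operatorname{rk}A'_x\,\operatorname{rk}A''_y}\,c''\,\bigwedge v(e'')\wedge\bigwedge t'\quad\text{in }\textstyle\bigwedge^{\rm top}T_bB .$$ With $B=G$, $p=l$,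 $q=r$ and left and right multiplication, this defines the action $\tau_g:(Q_A)_{r(g)}\to(Q_A)_{l(g)}$ of $G$ on $Q_A$. A section $s$ of $Q_A$ is invariant if $\tau_g(s(r(g)))=s(l(g))$ for all $g\in G$. Let $\Gamma(Q_A)^G$ be the vector space of smooth invariant sections. **Theorem.** Let $G',G'',G'''$ be Lie groupoids with Lie algebroids $A',A'',A'''$, and let $B$ be an invertible $(G',G'')$-bibundle. 1. There is a unique linear isomorphism $\Phi_B:\Gamma(Q_{A'})^{G'}\to\Gamma(Q_{A''})^{G''}$ such that $\tau_b\big((\Phi_Bs)(q(b))\big)=s(p(b))$ for all $s\in\Gamma(Q_{A'})^{G'}$ and all $b\in B$. 2. If a $(G',G'')$-bibundle $B_1$ is isomorphic to $B$, then $B_1$ is invertible and $\Phi_{B_1}=\Phi_B$. 3. If $C$ is an invertible $(G'',G''')$-bibundle and $D$ is the composition of $B$ and $C$, then $D$ is invertible and $\Phi_D=\Phi_C\circ\Phi_B$. -/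

import Mathlib

open scoped ContDiff Topology TensorProduct

noncomputable section

namespace LieGpd

/-! ### Smooth manifolds whose components may have different dimensions -/

/-- A smooth manifold without boundary, given by a smoothly compatible atlas with one chosen chart
around each point.  The dimension is allowed to vary from one component to another, so it is a
function of the point; compatibility of the charts forces it to be locally constant.  (Mathlib's
manifolds have one model space, hence a single dimension.)  Neither the Hausdorff property nor
second countability is imposed. -/
class MixedManifold (M : Type*) [TopologicalSpace M] where
  dim : M → ℕ
  chart : (x : M) → OpenPartialHomeomorph M (EuclideanSpace ℝ (Fin (dim x)))
  mem_source : ∀ x, x ∈ (chart x).source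
  compat : ∀ x y, ContDiffOn ℝ ∞ (chart y ∘ (chart x).symm) ((chart x).symm.trans (chart y)).source

/-- The dimension of `M` at `x`. -/
abbrev dim {M : Type*} [TopologicalSpace M] [MixedManifold M] (x : M) : ℕ := MixedManifold.dim x

/-- The tangent space at `x`, read in the chosen chart at `x`. -/
abbrev Tan {M : Type*} [TopologicalSpace M] [MixedManifold M] (x : M) : Type :=
  EuclideanSpace ℝ (Fin (dim x))

/-- The chosen chart at `x`. -/
abbrev chart {M : Type*} [TopologicalSpace M] [MixedManifold M] (x : M) :
    OpenPartialHomeomorph M (Tan x) := MixedManifold.chart x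

section Smooth

variable {M N P : Type*} [TopologicalSpace M] [MixedManifold M] [TopologicalSpace N]
  [MixedManifold N] [TopologicalSpace P] [MixedManifold P]

/-- `f` is smooth at `x`: continuous, with smooth coordinate expression. -/
def IsSmoothAt (f : M → N) (x : M) : Prop :=
  ContinuousAt f x ∧ ContDiffAt ℝ ∞ (chart (f x) ∘ f ∘ (chart x).symm) (chart x x)

/-- `f` is a smooth map. -/
def IsSmooth (f : M → N) : Prop := ∀ x, IsSmoothAt f x

/-- A real function is smooth. -/
def IsSmoothFunAt (f : M → ℝ) (x : M) : Prop :=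
  ContDiffAt ℝ ∞ (f ∘ (chart x).symm) (chart x x)

/-- Smoothness, on a subset `S` of `M × N`, of a map of two variables which is meaningful on `S`
only.  The subsets used below are the fibre products of submersions, and there this is smoothness
on the submanifold `S`. -/
def IsSmoothOn₂ (f : M → N → P) (S : Set (M × N)) : Prop :=
  ∀ z ∈ S, ContinuousWithinAt (fun w : M × N => f w.1 w.2) S z ∧
    ContDiffWithinAt ℝ ∞
      (fun u : Tan z.1 × Tan z.2 =>
        chart (f z.1 z.2) (f ((chart z.1).symm u.1) ((chart z.2).symm u.2)))
      {u | ((chart z.1).symm u.1, (chart z.2).symm u.2) ∈ S}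
      (chart z.1 z.1, chart z.2 z.2)

/-- The tangent map of `f` at `x`. -/
def tmap (f : M → N) (x : M) : Tan x →L[ℝ] Tan (f x) :=
  fderiv ℝ (chart (f x) ∘ f ∘ (chart x).symm) (chart x x)

/-- The derivative at `x ∈ S` of a map which is meaningful on `S` only, and which sends `x` to `y`.
It is only used on vectors tangent to a submanifold `S`, where its value does not depend on how
`f` is extended to a neighbourhood. -/
def tmapWithin (f : M → N) (S : Set M) (x : M) (y : N) : Tan x →L[ℝ] Tan y :=
  fderivWithin ℝ (chart y ∘ f ∘ (chart x).symm) ((chart x).symm ⁻¹' S) (chart x x)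

/-- The differential at `z` of the change of coordinates from the chart at `x` to the chart
at `y`. -/
def coordChange (x y z : M) : Tan x →L[ℝ] Tan y :=
  fderiv ℝ (chart y ∘ (chart x).symm) (chart x z)

/-- Smooth submersions. -/
def IsSubmersion (f : M → N) : Prop := IsSmooth f ∧ ∀ x, Function.Surjective (tmap f x)

end Smooth

/-! ### Lie groupoids -/

/-- A Lie groupoid `G ⇉ G₀`, in which `g h` is defined when `r g = l h`.  The total function `mul`
is meaningful for such pairs only. -/
structure LieGroupoid (G G₀ : Type*) [TopologicalSpace G] [MixedManifold G]
    [TopologicalSpace G₀] [MixedManifold G₀] where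
  l : G → G₀
  r : G → G₀
  unit : G₀ → G
  inv : G → G
  mul : G → G → G
  l_unit : ∀ x, l (unit x) = x
  r_unit : ∀ x, r (unit x) = x
  l_inv : ∀ g, l (inv g) = r g
  r_inv : ∀ g, r (inv g) = l g
  l_mul : ∀ g h, r g = l h → l (mul g h) = l g
  r_mul : ∀ g h, r g = l h → r (mul g h) = r h
  mul_assoc : ∀ g h k, r g = l h → r h = l k → mul (mul g h) k = mul g (mul h k)
  unit_mul : ∀ g, mul (unit (l g)) g = g
  mul_unit : ∀ g, mul g (unit (r g)) = g
  inv_mul : ∀ g, mul (inv g) g = unit (r g)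
  mul_inv : ∀ g, mul g (inv g) = unit (l g)
  l_submersion : IsSubmersion l
  r_submersion : IsSubmersion r
  smooth_unit : IsSmooth unit
  smooth_inv : IsSmooth inv
  smooth_mul : IsSmoothOn₂ mul {z | r z.1 = l z.2}

/-- A `(G', G'')`-bibundle: a manifold `B` with smooth maps `p : B → G'₀`, `q : B → G''₀` and
commuting smooth actions, of `G'` from the left along `p` and of `G''` from the right along `q`.
`lact g b` is meaningful when `r g = p b`, and `ract b h` when `q b = l h`. -/
structure Bibundle {G' G'₀ G'' G''₀ : Type*}
    [TopologicalSpace G'] [MixedManifold G'] [TopologicalSpace G'₀] [MixedManifold G'₀]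
    [TopologicalSpace G''] [MixedManifold G''] [TopologicalSpace G''₀] [MixedManifold G''₀]
    (Γ' : LieGroupoid G' G'₀) (Γ'' : LieGroupoid G'' G''₀)
    (B : Type*) [TopologicalSpace B] [MixedManifold B] where
  p : B → G'₀
  q : B → G''₀
  lact : G' → B → B
  ract : B → G'' → B
  smooth_p : IsSmooth p
  smooth_q : IsSmooth q
  smooth_lact : IsSmoothOn₂ lact {z | Γ'.r z.1 = p z.2}
  smooth_ract : IsSmoothOn₂ ract {z | q z.1 = Γ''.l z.2}
  p_lact : ∀ g b, Γ'.r g = p b → p (lact g b) = Γ'.l g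
  q_lact : ∀ g b, Γ'.r g = p b → q (lact g b) = q b
  p_ract : ∀ b h, q b = Γ''.l h → p (ract b h) = p b
  q_ract : ∀ b h, q b = Γ''.l h → q (ract b h) = Γ''.r h
  unit_lact : ∀ b, lact (Γ'.unit (p b)) b = b
  ract_unit : ∀ b, ract b (Γ''.unit (q b)) = b
  mul_lact : ∀ g k b, Γ'.r g = Γ'.l k → Γ'.r k = p b → lact (Γ'.mul g k) b = lact g (lact k b)
  ract_mul : ∀ b h k, q b = Γ''.l h → Γ''.r h = Γ''.l k →
    ract b (Γ''.mul h k) = ract (ract b h) k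
  lact_ract : ∀ g b h, Γ'.r g = p b → q b = Γ''.l h →
    lact g (ract b h) = ract (lact g b) h

/-! ### The line bundle `Q_A` -/

namespace LieGroupoid

variable {G G₀ : Type*} [TopologicalSpace G] [MixedManifold G] [TopologicalSpace G₀]
  [MixedManifold G₀] (Γ : LieGroupoid G G₀)

/-- The fibre at `x` of the Lie algebroid: the vectors at the unit of `x` tangent to the
`r`-fibre. -/
abbrev A (x : G₀) : Submodule ℝ (Tan (Γ.unit x)) := (tmap Γ.r (Γ.unit x)).toLinearMap.ker

/-- The rank of the Lie algebroid at `x`. -/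
abbrev rank (x : G₀) : ℕ := Module.finrank ℝ (Γ.A x)

/-- The fibre at `x` of `Q_A = ⋀^top A ⊗ ⋀^top T*G₀`. -/
def Q (x : G₀) : Type _ :=
  (⋀[ℝ]^(Γ.rank x) (Γ.A x)) ⊗[ℝ] (⋀[ℝ]^(dim x) (Module.Dual ℝ (Tan x)))

instance (x : G₀) : AddCommGroup (Γ.Q x) :=
  inferInstanceAs (AddCommGroup
    ((⋀[ℝ]^(Γ.rank x) (Γ.A x)) ⊗[ℝ] (⋀[ℝ]^(dim x) (Module.Dual ℝ (Tan x)))))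

instance (x : G₀) : Module ℝ (Γ.Q x) :=
  inferInstanceAs (Module ℝ
    ((⋀[ℝ]^(Γ.rank x) (Γ.A x)) ⊗[ℝ] (⋀[ℝ]^(dim x) (Module.Dual ℝ (Tan x)))))

/-- The linear form on the fibre of `Q_A` which sends
`(a₁ ∧ ⋯ ∧ a_k) ⊗ (θ₁ ∧ ⋯ ∧ θ_n)` to `det (αᵢ (a_j)) * det (θᵢ (v_j))`. -/
def evalQ (x : G₀) (α : Fin (Γ.rank x) → Module.Dual ℝ (Γ.A x)) (v : Fin (dim x) → Tan x) :
    Γ.Q x →ₗ[ℝ] ℝ :=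
  TensorProduct.dualDistrib ℝ _ _
    (exteriorPower.pairingDual ℝ (Γ.A x) (Γ.rank x) (exteriorPower.ιMulti ℝ (Γ.rank x) α) ⊗ₜ[ℝ]
      (exteriorPower.pairingDual ℝ (Tan x) (dim x)).flip (exteriorPower.ιMulti ℝ (dim x) v))

/-- The coefficient `c` of an element `c • (e₁ ∧ ⋯ ∧ e_k) ⊗ (τ₁* ∧ ⋯ ∧ τ_n*)` of the fibre of `Q_A`,
where `e` is a basis of the fibre of `A`, and `τ*` is the basis dual to a basis `τ` of the tangent
space of `G₀`. -/
def coeff (x : G₀) (e : Module.Basis (Fin (Γ.rank x)) ℝ (Γ.A x))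
    (τ : Module.Basis (Fin (dim x)) ℝ (Tan x)) : Γ.Q x →ₗ[ℝ] ℝ :=
  Γ.evalQ x e.coord τ

/-- The component functions near `x₀` of a section `s` of `Q_A`, regarded as a section of the
larger bundle `⋀^top (TG|_{G₀}) ⊗ ⋀^top T*G₀`: at `x`, evaluate `s x` on constant covectors
`β i` in the chart of `G` at the unit of `x₀`, and on constant vectors `w j` in the chart of `G₀`
at `x₀`.  (Only the first `rank` covectors and the first `dim` vectors matter.) -/
def component (s : ∀ x, Γ.Q x) (x₀ : G₀)
    (β : ℕ → Module.Dual ℝ (Tan (Γ.unit x₀))) (w : ℕ → Tan x₀) (x : G₀) : ℝ :=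
  Γ.evalQ x
    (fun i => (β i ∘ₗ (coordChange (Γ.unit x) (Γ.unit x₀) (Γ.unit x)).toLinearMap) ∘ₗ
      (Γ.A x).subtype)
    (fun j => coordChange x₀ x x (w j))
    (s x)

/-- A section of `Q_A` is smooth if all its local component functions are smooth. -/
def IsSmoothSection (s : ∀ x, Γ.Q x) : Prop :=
  ∀ x₀ β w, IsSmoothFunAt (Γ.component s x₀ β w) x₀

/-- The infinitesimal form of a map `act`, meaningful on the `r`-fibre of `x`, with
`act (unit x) = b`: it sends the velocity at `0` of a curve `g_t` in this fibre with `g_0 = unit x`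
to the velocity of `act g_t`. -/
def gen {M : Type*} [TopologicalSpace M] [MixedManifold M] (x : G₀) (act : G → M) (b : M) :
    Γ.A x →ₗ[ℝ] Tan b :=
  (tmapWithin act {g | Γ.r g = x} (Γ.unit x) b).toLinearMap ∘ₗ (Γ.A x).subtype

end LieGroupoid

/-- The canonical correspondence between the fibre of `Q_{A'}` at `x` and the fibre of `Q_{A''}`
at `y` which is given by a vector space `T` with two exact sequences
`0 → A''_y → T → T_x G'₀ → 0` (maps `v`, `P`) and `0 → A'_x → T → T_y G''₀ → 0` (maps `u`, `R`).
They express the top exterior power of `T` in two ways.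
If `ξ' = c' • ⋀ e' ⊗ ⋀ τ'*` and `ξ'' = c'' • ⋀ e'' ⊗ ⋀ τ''*`, and `t'`, `t''` are lifts of
`τ'`, `τ''` to `T`, then `c' • ⋀ u(e') ∧ ⋀ t'' = ± c'' • ⋀ v(e'') ∧ ⋀ t'`.
The sign `(-1) ^ (rank A' * rank A'')` is the one for which the correspondences are compatible with
composition and are the identity at the units of a groupoid. -/
def QCorresponds {G' G'₀ G'' G''₀ : Type*}
    [TopologicalSpace G'] [MixedManifold G'] [TopologicalSpace G'₀] [MixedManifold G'₀]
    [TopologicalSpace G''] [MixedManifold G''] [TopologicalSpace G''₀] [MixedManifold G''₀]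
    (Γ' : LieGroupoid G' G'₀) (Γ'' : LieGroupoid G'' G''₀) (x : G'₀) (y : G''₀)
    {T : Type*} [AddCommGroup T] [Module ℝ T]
    (P : T →ₗ[ℝ] Tan x) (R : T →ₗ[ℝ] Tan y) (u : Γ'.A x →ₗ[ℝ] T) (v : Γ''.A y →ₗ[ℝ] T)
    (ξ' : Γ'.Q x) (ξ'' : Γ''.Q y) : Prop :=
  ∀ (e' : Module.Basis (Fin (Γ'.rank x)) ℝ (Γ'.A x))
    (e'' : Module.Basis (Fin (Γ''.rank y)) ℝ (Γ''.A y))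
    (τ' : Module.Basis (Fin (dim x)) ℝ (Tan x)) (τ'' : Module.Basis (Fin (dim y)) ℝ (Tan y))
    (t' : Fin (dim x) → T) (t'' : Fin (dim y) → T),
    (∀ i, P (t' i) = τ' i) → (∀ j, R (t'' j) = τ'' j) →
    Γ'.coeff x e' τ' ξ' •
        (ExteriorAlgebra.ιMulti ℝ _ (fun i => u (e' i)) * ExteriorAlgebra.ιMulti ℝ _ t'') =
      ((-1) ^ (Γ'.rank x * Γ''.rank y) * Γ''.coeff y e'' τ'' ξ'') •
        (ExteriorAlgebra.ιMulti ℝ _ (fun j => v (e'' j)) * ExteriorAlgebra.ιMulti ℝ _ t')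

namespace LieGroupoid

variable {G G₀ : Type*} [TopologicalSpace G] [MixedManifold G] [TopologicalSpace G₀]
  [MixedManifold G₀] (Γ : LieGroupoid G G₀)

/-- A section of `Q_A` is invariant if each arrow `g` carries its value at `r g` to its value
at `l g`.  The action of `g` on `Q_A` is the canonical correspondence coming from the exact
sequences `0 → A_{r g} → T_g G → T_{l g} G₀ → 0` and `0 → A_{l g} → T_g G → T_{r g} G₀ → 0`, given
by `dl`, by `dr`, and by the velocities of the curves `h_t g` and `g h_t⁻¹`. -/
def IsInvariant (s : ∀ x, Γ.Q x) : Prop :=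
  ∀ g, QCorresponds Γ Γ (Γ.l g) (Γ.r g)
    (tmap Γ.l g).toLinearMap (tmap Γ.r g).toLinearMap
    (Γ.gen (Γ.l g) (fun h => Γ.mul h g) g) (Γ.gen (Γ.r g) (fun h => Γ.mul g (Γ.inv h)) g)
    (s (Γ.l g)) (s (Γ.r g))

/-- The vector space of smooth invariant sections of `Q_A`. -/
def invariantSections : Submodule ℝ (∀ x, Γ.Q x) where
  carrier := {s | Γ.IsSmoothSection s ∧ Γ.IsInvariant s}
  zero_mem' := by
    refine ⟨fun x₀ β w => ?_, fun g e' e'' τ' τ'' t' t'' _ _ => ?_⟩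
    · have : Γ.component 0 x₀ β w = fun _ => 0 := by
        funext x
        exact LinearMap.map_zero _
      rw [this]
      exact contDiffAt_const
    · simp only [Pi.zero_apply, map_zero, mul_zero, zero_smul]
  add_mem' := by
    rintro s t ⟨hs, hs'⟩ ⟨ht, ht'⟩
    refine ⟨fun x₀ β w => ?_, fun g e' e'' τ' τ'' t' t'' h' h'' => ?_⟩
    · have : Γ.component (s + t) x₀ β w = Γ.component s x₀ β w + Γ.component t x₀ β w := by
        funext x
        exact LinearMap.map_add _ _ _
      rw [this]
      exact (hs x₀ β w).add (ht x₀ β w)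
    · have h₁ := hs' g e' e'' τ' τ'' t' t'' h' h''
      have h₂ := ht' g e' e'' τ' τ'' t' t'' h' h''
      rw [Pi.add_apply, Pi.add_apply, map_add, map_add, mul_add, add_smul, add_smul, h₁, h₂]
  smul_mem' := by
    rintro c s ⟨hs, hs'⟩
    refine ⟨fun x₀ β w => ?_, fun g e' e'' τ' τ'' t' t'' h' h'' => ?_⟩
    · have : Γ.component (c • s) x₀ β w = fun x => c * Γ.component s x₀ β w x := by
        funext x
        exact LinearMap.map_smul _ _ _
      rw [this]
      exact contDiffAt_const.mul (hs x₀ β w)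
    · have h₁ := hs' g e' e'' τ' τ'' t' t'' h' h''
      rw [Pi.smul_apply, Pi.smul_apply, map_smul, map_smul, smul_eq_mul, smul_eq_mul, mul_smul,
        h₁, smul_smul, mul_left_comm]

end LieGroupoid

/-! ### Invertible bibundles, isomorphisms and composition -/

namespace Bibundle

variable {G' G'₀ G'' G''₀ K K₀ : Type*}
  [TopologicalSpace G'] [MixedManifold G'] [TopologicalSpace G'₀] [MixedManifold G'₀]
  [TopologicalSpace G''] [MixedManifold G''] [TopologicalSpace G''₀] [MixedManifold G''₀]
  [TopologicalSpace K] [MixedManifold K] [TopologicalSpace K₀] [MixedManifold K₀]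
  {Γ' : LieGroupoid G' G'₀} {Γ'' : LieGroupoid G'' G''₀} {Λ : LieGroupoid K K₀}
  {B : Type*} [TopologicalSpace B] [MixedManifold B] (𝓑 : Bibundle Γ' Γ'' B)

/-- Invertible (biprincipal) bibundles: `p` and `q` are surjective submersions, the left action is
principal with respect to `q`, and the right action is principal with respect to `p`.  An action is
principal if it is free and transitive on the fibres, and the division map, which sends two points
of a fibre to the arrow between them, is smooth. -/
structure IsInvertible : Prop where
  p_submersion : IsSubmersion 𝓑.p
  p_surjective : Function.Surjective 𝓑.p
  q_submersion : IsSubmersion 𝓑.q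
  q_surjective : Function.Surjective 𝓑.q
  left_principal : ∃ δ : B → B → G', IsSmoothOn₂ δ {z | 𝓑.q z.1 = 𝓑.q z.2} ∧
    (∀ b c, 𝓑.q b = 𝓑.q c → Γ'.r (δ b c) = 𝓑.p c ∧ 𝓑.lact (δ b c) c = b) ∧
    (∀ g c, Γ'.r g = 𝓑.p c → δ (𝓑.lact g c) c = g)
  right_principal : ∃ δ : B → B → G'', IsSmoothOn₂ δ {z | 𝓑.p z.1 = 𝓑.p z.2} ∧
    (∀ b c, 𝓑.p b = 𝓑.p c → 𝓑.q b = Γ''.l (δ b c) ∧ 𝓑.ract b (δ b c) = c) ∧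
    (∀ b h, 𝓑.q b = Γ''.l h → δ b (𝓑.ract b h) = h)

/-- The elements `ξ'` and `ξ''` of the fibres of `Q_{A'}` at `p b` and of `Q_{A''}` at `q b`
correspond to each other under the canonical isomorphism of these lines which comes from the exact
sequences `0 → A''_{q b} → T_b B → T_{p b} G'₀ → 0` and `0 → A'_{p b} → T_b B → T_{q b} G''₀ → 0`,
given by `dp`, by `dq`, and by the velocities of the curves `g_t b` and `b h_t⁻¹`. -/
def Corresponds (b : B) (ξ' : Γ'.Q (𝓑.p b)) (ξ'' : Γ''.Q (𝓑.q b)) : Prop :=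
  QCorresponds Γ' Γ'' (𝓑.p b) (𝓑.q b) (tmap 𝓑.p b).toLinearMap (tmap 𝓑.q b).toLinearMap
    (Γ'.gen (𝓑.p b) (fun g => 𝓑.lact g b) b)
    (Γ''.gen (𝓑.q b) (fun h => 𝓑.ract b (Γ''.inv h)) b) ξ' ξ''

/-- `Φ` is the isomorphism of smooth invariant sections induced by the bibundle: each point `b`
carries the value of `Φ s` at `q b` to the value of `s` at `p b`. -/
def Induces (Φ : Γ'.invariantSections ≃ₗ[ℝ] Γ''.invariantSections) : Prop :=
  ∀ (s : Γ'.invariantSections) (b : B),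
    𝓑.Corresponds b (s.1 (𝓑.p b)) ((Φ s).1 (𝓑.q b))

/-- Isomorphism of bibundles: an equivariant diffeomorphism over `G'₀` and `G''₀`. -/
def Isomorphic {C : Type*} [TopologicalSpace C] [MixedManifold C] (𝓒 : Bibundle Γ' Γ'' C) : Prop :=
  ∃ f : B ≃ C, IsSmooth f ∧ IsSmooth f.symm ∧
    (∀ b, 𝓒.p (f b) = 𝓑.p b) ∧ (∀ b, 𝓒.q (f b) = 𝓑.q b) ∧
    (∀ g b, Γ'.r g = 𝓑.p b → f (𝓑.lact g b) = 𝓒.lact g (f b)) ∧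
    (∀ b h, 𝓑.q b = Γ''.l h → f (𝓑.ract b h) = 𝓒.ract (f b) h)

/-- `𝓓` is the composition of `𝓑` and `𝓒`, that is, the quotient of the fibre product
`B ×_{G''₀} C` by the action `h · (b, c) = (b h, h⁻¹ c)` of `G''`, with the induced projections and
actions.  It is given by its quotient map `π`, a smooth surjective submersion from `B ×_{G''₀} C`
onto `D` whose fibres are the orbits of `G''`; being a submersion is expressed by the existence of
a smooth local section through each point. -/
def IsComposition {C D : Type*} [TopologicalSpace C] [MixedManifold C]
    [TopologicalSpace D] [MixedManifold D]
    (𝓒 : Bibundle Γ'' Λ C) (𝓓 : Bibundle Γ' Λ D) : Prop :=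
  ∃ π : B → C → D,
    IsSmoothOn₂ π {z | 𝓑.q z.1 = 𝓒.p z.2} ∧
    (∀ d, ∃ b c, 𝓑.q b = 𝓒.p c ∧ π b c = d) ∧
    (∀ b c, 𝓑.q b = 𝓒.p c → ∃ (σ : D → B) (ρ : D → C),
      σ (π b c) = b ∧ ρ (π b c) = c ∧
      ∀ᶠ d in 𝓝 (π b c), IsSmoothAt σ d ∧ IsSmoothAt ρ d ∧
        𝓑.q (σ d) = 𝓒.p (ρ d) ∧ π (σ d) (ρ d) = d) ∧
    (∀ b c b₁ c₁, 𝓑.q b = 𝓒.p c → 𝓑.q b₁ = 𝓒.p c₁ →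
      (π b c = π b₁ c₁ ↔
        ∃ h, 𝓑.q b = Γ''.l h ∧ b₁ = 𝓑.ract b h ∧ c₁ = 𝓒.lact (Γ''.inv h) c)) ∧
    (∀ b c, 𝓑.q b = 𝓒.p c → 𝓓.p (π b c) = 𝓑.p b ∧ 𝓓.q (π b c) = 𝓒.q c) ∧
    (∀ g b c, Γ'.r g = 𝓑.p b → 𝓑.q b = 𝓒.p c → 𝓓.lact g (π b c) = π (𝓑.lact g b) c) ∧
    (∀ b c k, 𝓑.q b = 𝓒.p c → 𝓒.q c = Λ.l k → 𝓓.ract (π b c) k = π b (𝓒.ract c k))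

end Bibundle

end LieGpd

end

open scoped ContDiff Topology TensorProduct

noncomputable section

namespace LieGpd

/-! ### Coefficients of elements of `Q` -/

section TopForms

variable {V : Type*} [AddCommGroup V] [Module ℝ V] {n : ℕ}

/-! The theorem reduces to pointwise linear algebra. At a point b the two exact sequences express
the line ⋀^top T_bB in two ways, and a change of bases multiplies wedges and coefficients by
compatible determinants. The correspondence at b is therefore the graph of an isomorphism of lines,
and one choice of bases decides it (`qCorresponds_of_bases`, `qCorresponds_iff_coeff`). Exactness of
the sequences is the infinitesimal form of principality, obtained by differentiating the division
maps (`isShortExact_lgen`).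

The central fact is `QCorresponds.comp`, with its geometric form `IsBalanced.correspondsAt`: if π :
B ×_{G''₀} C → D is smooth, equivariant and constant on G''-orbits, then the correspondence at b
followed by the one at c is the one at π(b,c). Indeed the fibre product W of T_bB and T_cC over the
tangent space of G''₀ maps onto T_bB, T_cC and T_dD, with kernels A''', A' and A''. Multiplication
by the wedge of a kernel basis lifts each of the three defining equations to the line ⋀^top W, where
they can be compared. The signs produced by reordering the three kernel blocks are those in the
definition of the correspondence.

The two actions on B are themselves balanced maps. For the left action, invariance of s makes the
element at q(b) corresponding to s(p(b)) independent of the choice of b in a fibre of q, which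
defines Φ s. For the right action, the same lemma shows that Φ s is invariant. In smooth local
frames the coefficient of Φ s along q is that of s along p times a quotient of smooth functions on
B; composition with a local section of q makes Φ s smooth. The opposite bibundle supplies the
inverse of Φ.

Functoriality is the central fact applied to the quotient map of a composition. Isomorphism
invariance is a special case: an isomorphism f makes (g, b) ↦ f(gb) a quotient map which exhibits
the second bibundle as the composition of the unit bibundle with the first, and the unit bibundle
induces the identity, because that is what invariance means. -/

theorem det_dual_apply_eq_mul (e : Module.Basis (Fin n) ℝ V) (α : Fin n → Module.Dual ℝ V)
    (a : Fin n → V) :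
    Matrix.det (.of fun i j => α j (a i)) =
      Matrix.det (.of fun i j => e.coord j (a i)) * Matrix.det (.of fun i j => α j (e i)) := by
  rw [← Matrix.det_mul]
  congr 1
  ext i j
  simp only [Matrix.mul_apply, Matrix.of_apply, Module.Basis.coord_apply]
  conv_lhs => rw [← e.sum_repr (a i), map_sum]
  simp only [map_smul, smul_eq_mul]

theorem det_coord_apply (e : Module.Basis (Fin n) ℝ V) (a : Fin n → V) :
    Matrix.det (.of fun i j => e.coord j (a i)) = e.det a := by
  rw [Module.Basis.det_apply, ← Matrix.det_transpose]
  rfl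

/-- An alternating map in as many variables as the dimension is determined by its value on one
basis, since on injective families of basis vectors it changes by the sign of a permutation. -/
theorem ιMulti_eq_det_smul {W : Type*} [AddCommGroup W] [Module ℝ W]
    (f : V [⋀^Fin n]→ₗ[ℝ] W) (e : Module.Basis (Fin n) ℝ V) (a : Fin n → V) :
    f a = e.det a • f e := by
  have : f = e.det.smulRight (f e) := by
    refine Module.Basis.ext_alternating e fun v hv => ?_
    obtain ⟨σ, rfl⟩ : ∃ σ : Equiv.Perm (Fin n), v = σ :=
      ⟨Equiv.ofBijective v (Finite.injective_iff_bijective.1 hv), rfl⟩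
    have h1 := f.map_perm e σ
    have h2 := e.det.map_perm e σ
    simp only [Function.comp_def] at h1 h2
    rw [AlternatingMap.smulRight_apply, h1, h2, e.det_self, smul_assoc, one_smul]
  rw [this, AlternatingMap.smulRight_apply, AlternatingMap.smulRight_apply, e.det_self, one_smul]

end TopForms

namespace LieGroupoid

variable {G G₀ : Type*} [TopologicalSpace G] [MixedManifold G] [TopologicalSpace G₀]
  [MixedManifold G₀] (Γ : LieGroupoid G G₀) (x : G₀)

/-- The decomposable element `⋀ a ⊗ ⋀ θ`. -/
def wedgeQ (a : Fin (Γ.rank x) → Γ.A x) (θ : Fin (dim x) → Module.Dual ℝ (Tan x)) : Γ.Q x :=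
  (exteriorPower.ιMulti ℝ _ a ⊗ₜ[ℝ] exteriorPower.ιMulti ℝ _ θ :
    (⋀[ℝ]^(Γ.rank x) (Γ.A x)) ⊗[ℝ] (⋀[ℝ]^(dim x) (Module.Dual ℝ (Tan x))))

variable {Γ x}

theorem evalQ_wedgeQ (α : Fin (Γ.rank x) → Module.Dual ℝ (Γ.A x)) (v : Fin (dim x) → Tan x)
    (a : Fin (Γ.rank x) → Γ.A x) (θ : Fin (dim x) → Module.Dual ℝ (Tan x)) :
    Γ.evalQ x α v (Γ.wedgeQ x a θ) =
      Matrix.det (.of fun i j => α j (a i)) * Matrix.det (.of fun i j => θ j (v i)) := by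
  unfold evalQ wedgeQ
  erw [TensorProduct.dualDistrib_apply]
  rw [LinearMap.flip_apply, exteriorPower.pairingDual_ιMulti_ιMulti,
    exteriorPower.pairingDual_ιMulti_ιMulti]

theorem Q_hom_ext {W : Type*} [AddCommGroup W] [Module ℝ W] {f g : Γ.Q x →ₗ[ℝ] W}
    (h : ∀ a θ, f (Γ.wedgeQ x a θ) = g (Γ.wedgeQ x a θ)) : f = g := by
  refine TensorProduct.ext (exteriorPower.linearMap_ext (AlternatingMap.ext fun a =>
    exteriorPower.linearMap_ext (AlternatingMap.ext fun θ => h a θ)))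

theorem evalQ_eq (e : Module.Basis (Fin (Γ.rank x)) ℝ (Γ.A x))
    (τ : Module.Basis (Fin (dim x)) ℝ (Tan x))
    (α : Fin (Γ.rank x) → Module.Dual ℝ (Γ.A x)) (v : Fin (dim x) → Tan x) (ξ : Γ.Q x) :
    Γ.evalQ x α v ξ =
      Γ.coeff x e τ ξ * (Matrix.det (.of fun i j => α j (e i)) * τ.det v) := by
  have : Γ.evalQ x α v =
      (Matrix.det (.of fun i j => α j (e i)) * τ.det v) • Γ.coeff x e τ := by
    refine Q_hom_ext fun a θ => ?_
    rw [LinearMap.smul_apply, coeff, evalQ_wedgeQ, evalQ_wedgeQ, det_dual_apply_eq_mul e α a,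
      det_dual_apply_eq_mul τ θ v, det_coord_apply τ v, smul_eq_mul]
    ring
  rw [this, LinearMap.smul_apply, smul_eq_mul, mul_comm]

theorem coeff_wedgeQ_coord (e : Module.Basis (Fin (Γ.rank x)) ℝ (Γ.A x))
    (τ : Module.Basis (Fin (dim x)) ℝ (Tan x)) :
    Γ.coeff x e τ (Γ.wedgeQ x e τ.coord) = 1 := by
  rw [coeff, evalQ_wedgeQ, det_coord_apply, det_coord_apply, e.det_self, τ.det_self, mul_one]

theorem coeff_smul_wedgeQ (e : Module.Basis (Fin (Γ.rank x)) ℝ (Γ.A x))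
    (τ : Module.Basis (Fin (dim x)) ℝ (Tan x)) (ξ : Γ.Q x) :
    Γ.coeff x e τ ξ • Γ.wedgeQ x e τ.coord = ξ := by
  have : (Γ.coeff x e τ).smulRight (Γ.wedgeQ x e τ.coord) = LinearMap.id := by
    refine Q_hom_ext fun a θ => ?_
    rw [LinearMap.smulRight_apply, LinearMap.id_apply, coeff, evalQ_wedgeQ, det_coord_apply]
    have h1 : exteriorPower.ιMulti ℝ _ a = e.det a • exteriorPower.ιMulti ℝ _ e :=
      ιMulti_eq_det_smul _ e a
    have h2 : exteriorPower.ιMulti ℝ _ θ =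
        τ.dualBasis.det θ • exteriorPower.ιMulti ℝ _ τ.dualBasis :=
      ιMulti_eq_det_smul _ τ.dualBasis θ
    have h3 : τ.dualBasis.det θ = Matrix.det (.of fun i j => θ j (τ i)) := by
      rw [Module.Basis.det_apply]
      congr 1
      ext i j
      simp [Module.Basis.toMatrix_apply]
    have h4 : (τ.dualBasis : Fin (dim x) → _) = τ.coord := by simp
    unfold wedgeQ
    rw [h1, h2, h3, h4, TensorProduct.smul_tmul_smul]
    rfl
  exact LinearMap.congr_fun this ξ

theorem coeff_injective (e : Module.Basis (Fin (Γ.rank x)) ℝ (Γ.A x))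
    (τ : Module.Basis (Fin (dim x)) ℝ (Tan x)) : Function.Injective (Γ.coeff x e τ) :=
  fun ξ η h => by rw [← coeff_smul_wedgeQ e τ ξ, ← coeff_smul_wedgeQ e τ η, h]

theorem coeff_surjective (e : Module.Basis (Fin (Γ.rank x)) ℝ (Γ.A x))
    (τ : Module.Basis (Fin (dim x)) ℝ (Tan x)) : Function.Surjective (Γ.coeff x e τ) :=
  fun c => ⟨c • Γ.wedgeQ x e τ.coord, by
    rw [map_smul, coeff_wedgeQ_coord, smul_eq_mul, mul_one]⟩

/-- The effect of a change of bases on the coefficient of an element of `Q`. -/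
theorem coeff_mul_det (e e₁ : Module.Basis (Fin (Γ.rank x)) ℝ (Γ.A x))
    (τ τ₁ : Module.Basis (Fin (dim x)) ℝ (Tan x)) (ξ : Γ.Q x) :
    Γ.coeff x e₁ τ₁ ξ * e.det e₁ = Γ.coeff x e τ ξ * τ.det τ₁ := by
  rw [show Γ.coeff x e₁ τ₁ ξ = _ from evalQ_eq e τ e₁.coord τ₁ ξ, det_coord_apply]
  have h : e₁.det e * e.det e₁ = 1 := by
    rw [Module.Basis.det_apply, Module.Basis.det_apply, ← Matrix.det_mul,
      Module.Basis.toMatrix_mul_toMatrix_flip, Matrix.det_one]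
  linear_combination (Γ.coeff x e τ ξ * τ.det τ₁) * h

end LieGroupoid

end LieGpd
end

open scoped ContDiff Topology TensorProduct

noncomputable section

namespace LieGpd

/-! ### Products of decomposable elements of exterior algebras -/

open ExteriorAlgebra

section Exterior

variable {V W : Type*} [AddCommGroup V] [Module ℝ V] [AddCommGroup W] [Module ℝ W] {k n : ℕ}

theorem ιMulti_mul_ι (E : Fin k → W) (w : W) :
    ιMulti ℝ k E * ι ℝ w = (-1 : ℝ) ^ k • (ι ℝ w * ιMulti ℝ k E) := by
  induction k with
  | zero => simp
  | succ k ih =>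
    have h : ι ℝ (E 0) * ι ℝ w = -(ι ℝ w * ι ℝ (E 0)) :=
      eq_neg_of_add_eq_zero_left (ι_add_mul_swap (R := ℝ) (E 0) w)
    rw [ιMulti_succ_apply, mul_assoc, ih, mul_smul_comm, ← mul_assoc, h, neg_mul, mul_assoc,
      smul_neg, pow_succ, mul_neg_one, neg_smul]

theorem ιMulti_mul_ιMulti_comm (E : Fin k → W) (F : Fin n → W) :
    ιMulti ℝ k E * ιMulti ℝ n F = (-1 : ℝ) ^ (k * n) • (ιMulti ℝ n F * ιMulti ℝ k E) := by
  induction n with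
  | zero => simp
  | succ n ih =>
    rw [ιMulti_succ_apply, ← mul_assoc, ιMulti_mul_ι, smul_mul_assoc, mul_assoc, ih, mul_smul_comm,
      smul_smul, ← pow_add, ← mul_assoc, Nat.mul_succ, add_comm]

/-- This carries the wedge across a factor to reach the next one, as the multiplicative step of
`ιMulti_mul_map` requires. -/
theorem exists_ιMulti_mul_eq (E : Fin k → W) (a : ExteriorAlgebra ℝ W) :
    ∃ a', ιMulti ℝ k E * a = a' * ιMulti ℝ k E := by
  induction a using ExteriorAlgebra.induction with
  | algebraMap r => exact ⟨algebraMap ℝ _ r, (Algebra.commutes r _).symm⟩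
  | ι w => exact ⟨(-1 : ℝ) ^ k • ι ℝ w, by rw [ιMulti_mul_ι, smul_mul_assoc]⟩
  | mul a b ha hb =>
    obtain ⟨a', ha⟩ := ha
    obtain ⟨b', hb⟩ := hb
    exact ⟨a' * b', by rw [← mul_assoc, ha, mul_assoc, hb, mul_assoc]⟩
  | add a b ha hb =>
    obtain ⟨a', ha⟩ := ha
    obtain ⟨b', hb⟩ := hb
    exact ⟨a' + b', by rw [mul_add, ha, hb, add_mul]⟩

theorem ιMulti_mul_ι_of_mem_span {E : Fin k → W} {w : W}
    (hw : w ∈ Submodule.span ℝ (Set.range E)) : ιMulti ℝ k E * ι ℝ w = 0 := by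
  rw [ιMulti_mul_ι]
  suffices h : ι ℝ w * ιMulti ℝ k E = 0 by rw [h, smul_zero]
  induction hw using Submodule.span_induction with
  | mem w hw =>
    obtain ⟨i, rfl⟩ := hw
    rw [ιMulti_apply]
    exact ι_mul_prod_list E i
  | zero => simp
  | add a b _ _ ha hb => rw [map_add, add_mul, ha, hb, add_zero]
  | smul c a _ ha => rw [map_smul, smul_mul_assoc, ha, smul_zero]

/-- The wedge annihilates its own span, so next to it every vector may be replaced by its image
under `g`, which differs from it by an element of that span. -/
theorem ιMulti_mul_map {E : Fin k → W} {g : W →ₗ[ℝ] W}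
    (hg : ∀ w, w - g w ∈ Submodule.span ℝ (Set.range E)) (z : ExteriorAlgebra ℝ W) :
    ιMulti ℝ k E * z = ιMulti ℝ k E * map g z := by
  induction z using ExteriorAlgebra.induction with
  | algebraMap r => rw [AlgHom.commutes]
  | ι w =>
    rw [map_apply_ι, ← sub_eq_zero, ← mul_sub, ← map_sub]
    exact ιMulti_mul_ι_of_mem_span (hg w)
  | mul a b ha hb =>
    obtain ⟨a', ha'⟩ := exists_ιMulti_mul_eq E (map g a)
    rw [map_mul, ← mul_assoc, ha, ← mul_assoc, ha', mul_assoc, mul_assoc, hb]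
  | add a b ha hb => rw [mul_add, ha, hb, map_add, mul_add]

/-- The product with the wedge of a family which spans the kernel of `f` depends on the image
under `f` only. -/
theorem ιMulti_mul_congr {E : Fin k → W} {f : W →ₗ[ℝ] V} (hf : Function.Surjective f)
    (hE : LinearMap.ker f ≤ Submodule.span ℝ (Set.range E)) {z z' : ExteriorAlgebra ℝ W}
    (h : map f z = map f z') : ιMulti ℝ k E * z = ιMulti ℝ k E * z' := by
  -- For a linear section `s` of `f`, the endomorphism `s ∘ f` differs from the identity by kernel
  -- vectors only, and it sees an element only through its image under `f`.
  obtain ⟨s, hs⟩ := f.exists_rightInverse_of_surjective (LinearMap.range_eq_top.2 hf)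
  have hg : ∀ w, w - (s ∘ₗ f) w ∈ Submodule.span ℝ (Set.range E) := fun w => hE <| by
    have := LinearMap.congr_fun hs (f w)
    simp only [LinearMap.comp_apply, LinearMap.id_apply] at this
    simp [this]
  rw [ιMulti_mul_map hg, ιMulti_mul_map hg z', ← map_comp_map]
  simp only [AlgHom.comp_apply, h]

theorem map_ιMulti_mul_ιMulti (g : W →ₗ[ℝ] V) (a : Fin k → W) (b : Fin n → W) :
    map g (ιMulti ℝ k a * ιMulti ℝ n b) =
      ιMulti ℝ k (fun i => g (a i)) * ιMulti ℝ n (fun i => g (b i)) := by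
  rw [map_mul, map_apply_ιMulti, map_apply_ιMulti]
  rfl

/-- The determinant in degree n, together with zero in the other degrees, extends to a linear map on
the exterior algebra with value 1 at this element. -/
theorem ιMulti_basis_ne_zero (β : Module.Basis (Fin n) ℝ W) : ιMulti ℝ n β ≠ 0 := by
  intro h
  have h1 := liftAlternating_apply_ιMulti (R := ℝ)
    (fun i => if h : n = i then h ▸ β.det else 0) (β : Fin n → W)
  rw [h, map_zero, dif_pos rfl, β.det_self] at h1
  exact zero_ne_one h1

theorem linearIndependent_sumElim {E : Fin k → W} {f : W →ₗ[ℝ] V} {x : Fin n → W}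
    (hE : LinearIndependent ℝ E) (hfE : ∀ i, f (E i) = 0) (hx : LinearIndependent ℝ (f ∘ x)) :
    LinearIndependent ℝ (Sum.elim E x) := by
  refine hE.sum_type (.of_comp f hx) ?_
  refine (Submodule.range_ker_disjoint hx).symm.mono_left ?_
  rw [Submodule.span_le]
  rintro _ ⟨i, rfl⟩
  exact hfE i

variable [Module.Finite ℝ W]

theorem exists_basis_append {a : Fin k → W} {b : Fin n → W}
    (h : LinearIndependent ℝ (Sum.elim a b)) (hc : k + n = Module.finrank ℝ W) :
    ∃ β : Module.Basis (Fin (k + n)) ℝ W, ⇑β = Fin.append a b := by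
  have hli : LinearIndependent ℝ (Fin.append a b) := by
    refine (linearIndependent_equiv finSumFinEquiv).1 ?_
    convert h using 1
    funext i
    cases i <;> simp
  exact ⟨Module.Basis.mk hli (hli.span_eq_top_of_card_eq_finrank' (by simp [hc])).ge,
    Module.Basis.coe_mk _ _⟩

/-- The top exterior power is a line. -/
theorem exists_smul_eq_of_top {k' n' : ℕ} (hkn : k + n = Module.finrank ℝ W)
    (hkn' : k' + n' = Module.finrank ℝ W) (a : Fin k → W) (b : Fin n → W) {a' : Fin k' → W}
    {b' : Fin n' → W} (h : ιMulti ℝ k' a' * ιMulti ℝ n' b' ≠ 0) :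
    ∃ c : ℝ, ιMulti ℝ k a * ιMulti ℝ n b = c • (ιMulti ℝ k' a' * ιMulti ℝ n' b') := by
  have key : ∀ {m : ℕ} (_ : m = Module.finrank ℝ W) (x : Fin m → W), ∃ c : ℝ,
      ιMulti ℝ m x = c • ιMulti ℝ _ (Module.finBasis ℝ W) := by
    rintro _ rfl x
    exact ⟨_, ιMulti_eq_det_smul (ιMulti ℝ _) (Module.finBasis ℝ W) x⟩
  rw [ιMulti_mul_ιMulti, ιMulti_mul_ιMulti] at *
  obtain ⟨c, hc⟩ := key hkn (Fin.append a b)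
  obtain ⟨c', hc'⟩ := key hkn' (Fin.append a' b')
  have : c' ≠ 0 := fun h0 => h (by rw [hc', h0, zero_smul])
  exact ⟨c / c', by rw [hc, hc', smul_smul, div_mul_cancel₀ _ this]⟩

end Exterior

/-! ### Short exact sequences and top wedges -/

section ExactSequence

variable {A T S : Type*} [AddCommGroup A] [Module ℝ A] [AddCommGroup T] [Module ℝ T]
  [AddCommGroup S] [Module ℝ S]

/-- A short exact sequence `0 → A → T → S → 0`. -/
structure IsShortExact (u : A →ₗ[ℝ] T) (R : T →ₗ[ℝ] S) : Prop where
  injective : Function.Injective u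
  exact : Function.Exact u R
  surjective : Function.Surjective R

variable {u : A →ₗ[ℝ] T} {R : T →ₗ[ℝ] S} (h : IsShortExact u R) {k n : ℕ}
  (e : Module.Basis (Fin k) ℝ A) (τ : Module.Basis (Fin n) ℝ S)

namespace IsShortExact

include h

theorem ker_le_span : LinearMap.ker R ≤ Submodule.span ℝ (Set.range (u ∘ e)) := by
  rw [Set.range_comp, ← Submodule.map_span, e.span_eq, Submodule.map_top,
    h.exact.linearMap_ker_eq]

theorem card_add_card [Module.Finite ℝ T] (e : Module.Basis (Fin k) ℝ A)
    (τ : Module.Basis (Fin n) ℝ S) : k + n = Module.finrank ℝ T := by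
  rw [← R.finrank_range_add_finrank_ker, h.exact.linearMap_ker_eq, LinearMap.range_eq_top.2
    h.surjective, finrank_top, LinearMap.finrank_range_of_inj h.injective,
    Module.finrank_eq_card_basis e, Module.finrank_eq_card_basis τ, Fintype.card_fin,
    Fintype.card_fin, add_comm]

/-- Next to the wedge of a basis of the kernel, `t₁` counts only through its image under `R`, so it
may be replaced by combinations of the lifts `t`; both factors then become determinants. The
families `a` and `t₁` are arbitrary, so the same formula covers every change of bases and of lifts.
-/
theorem wedge_mul_wedge {t : Fin n → T} (ht : ∀ j, R (t j) = τ j) (a : Fin k → A)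
    (t₁ : Fin n → T) :
    ιMulti ℝ k (fun i => u (a i)) * ιMulti ℝ n t₁ =
      (e.det a * τ.det (fun j => R (t₁ j))) •
        (ιMulti ℝ k (fun i => u (e i)) * ιMulti ℝ n t) := by
  have h1 : ιMulti ℝ k (fun i => u (a i)) = e.det a • ιMulti ℝ k (fun i => u (e i)) :=
    ιMulti_eq_det_smul ((ιMulti ℝ k).compLinearMap u) e a
  have h2 : ιMulti ℝ n (fun j => τ.constr ℝ t (R (t₁ j))) =
      τ.det (fun j => R (t₁ j)) • ιMulti ℝ n t := by
    have := ιMulti_eq_det_smul ((ιMulti ℝ n).compLinearMap (τ.constr ℝ t)) τ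
      (fun j => R (t₁ j))
    simpa [Function.comp_def] using this
  have h3 : ∀ w, R (τ.constr ℝ t w) = w := fun w => by
    have : R ∘ₗ τ.constr ℝ t = LinearMap.id := τ.ext fun j => by simp [ht]
    exact LinearMap.congr_fun this w
  rw [h1, smul_mul_assoc, ιMulti_mul_congr (E := fun i => u (e i)) h.surjective
    (h.ker_le_span e) (z := ιMulti ℝ n t₁)
    (z' := ιMulti ℝ n (fun j => τ.constr ℝ t (R (t₁ j)))), h2, mul_smul_comm, smul_smul]
  rw [map_apply_ιMulti, map_apply_ιMulti]
  congr 1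
  funext j
  exact (h3 _).symm

theorem exists_basis [Module.Finite ℝ T] {t : Fin n → T} (ht : ∀ j, R (t j) = τ j) :
    ∃ β : Module.Basis (Fin (k + n)) ℝ T, ⇑β = Fin.append (fun i => u (e i)) t := by
  refine exists_basis_append (linearIndependent_sumElim (f := R) ?_ ?_ ?_)
    (h.card_add_card e τ)
  · exact e.linearIndependent.map' u (LinearMap.ker_eq_bot.2 h.injective)
  · exact fun i => h.exact.apply_apply_eq_zero _
  · rw [show R ∘ t = τ from funext ht]
    exact τ.linearIndependent

theorem wedge_mul_wedge_ne_zero [Module.Finite ℝ T] {t : Fin n → T} (ht : ∀ j, R (t j) = τ j) :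
    ιMulti ℝ k (fun i => u (e i)) * ιMulti ℝ n t ≠ 0 := by
  obtain ⟨β, hβ⟩ := h.exists_basis e τ ht
  rw [ιMulti_mul_ιMulti, ← hβ]
  exact ιMulti_basis_ne_zero β

end IsShortExact

end ExactSequence

end LieGpd
end

open scoped ContDiff Topology TensorProduct

noncomputable section

namespace LieGpd

open ExteriorAlgebra

/-! ### The correspondence between the lines `Q` -/

section Correspondence

variable {G' G'₀ G'' G''₀ K K₀ : Type*}
  [TopologicalSpace G'] [MixedManifold G'] [TopologicalSpace G'₀] [MixedManifold G'₀]
  [TopologicalSpace G''] [MixedManifold G''] [TopologicalSpace G''₀] [MixedManifold G''₀]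
  [TopologicalSpace K] [MixedManifold K] [TopologicalSpace K₀] [MixedManifold K₀]
  {Γ' : LieGroupoid G' G'₀} {Γ'' : LieGroupoid G'' G''₀} {Λ : LieGroupoid K K₀}
  {x : G'₀} {y : G''₀} {z : K₀}
  {T : Type*} [AddCommGroup T] [Module ℝ T]
  {P : T →ₗ[ℝ] Tan x} {R : T →ₗ[ℝ] Tan y} {u : Γ'.A x →ₗ[ℝ] T} {v : Γ''.A y →ₗ[ℝ] T}

/-- It suffices to check the correspondence for one choice of bases and lifts. -/
theorem qCorresponds_of_bases (hu : IsShortExact u R) (hv : IsShortExact v P)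
    {ξ' : Γ'.Q x} {ξ'' : Γ''.Q y} (e' : Module.Basis (Fin (Γ'.rank x)) ℝ (Γ'.A x))
    (e'' : Module.Basis (Fin (Γ''.rank y)) ℝ (Γ''.A y))
    (τ' : Module.Basis (Fin (dim x)) ℝ (Tan x)) (τ'' : Module.Basis (Fin (dim y)) ℝ (Tan y))
    {t' : Fin (dim x) → T} {t'' : Fin (dim y) → T} (ht' : ∀ i, P (t' i) = τ' i)
    (ht'' : ∀ j, R (t'' j) = τ'' j)
    (h : Γ'.coeff x e' τ' ξ' •
        (ιMulti ℝ _ (fun i => u (e' i)) * ιMulti ℝ _ t'') =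
      ((-1) ^ (Γ'.rank x * Γ''.rank y) * Γ''.coeff y e'' τ'' ξ'') •
        (ιMulti ℝ _ (fun j => v (e'' j)) * ιMulti ℝ _ t')) :
    QCorresponds Γ' Γ'' x y P R u v ξ' ξ'' := by
  intro f' f'' σ' σ'' s' s'' hs' hs''
  rw [hu.wedge_mul_wedge e' τ'' ht'' f' s'', hv.wedge_mul_wedge e'' τ' ht' f'' s']
  simp only [hs', hs'']
  have h1 := LieGroupoid.coeff_mul_det e' f' τ' σ' ξ'
  have h2 := LieGroupoid.coeff_mul_det e'' f'' τ'' σ'' ξ''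
  -- Both sides of the goal are those of `h` up to determinants. Scaling `h` by the two base
  -- determinants turns the claim into the transformation rules of the coefficients.
  have h3 := congrArg (fun w => (τ'.det σ' * τ''.det σ'') • w) h
  simp only [smul_smul] at h3 ⊢
  refine Eq.trans ?_ (h3.trans ?_) <;> congr 1
  · linear_combination τ''.det σ'' * h1
  · linear_combination -((-1) ^ (Γ'.rank x * Γ''.rank y) * τ'.det σ') * h2

/-- The standard basis of the tangent space. -/
def stdBasis {M : Type*} [TopologicalSpace M] [MixedManifold M] (x : M) :
    Module.Basis (Fin (dim x)) ℝ (Tan x) :=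
  (EuclideanSpace.basisFun (Fin (dim x)) ℝ).toBasis

theorem QCorresponds.symm {ξ' : Γ'.Q x} {ξ'' : Γ''.Q y}
    (h : QCorresponds Γ' Γ'' x y P R u v ξ' ξ'') : QCorresponds Γ'' Γ' y x R P v u ξ'' ξ' := by
  intro e'' e' τ'' τ' t'' t' ht'' ht'
  rw [mul_smul, h e' e'' τ' τ'' t' t'' ht' ht'', mul_comm (Γ''.rank y), mul_smul, smul_smul,
    ← mul_pow, neg_one_mul, neg_neg, one_pow, one_smul]

variable [Module.Finite ℝ T]

/-- The ratio of the two elements of the top exterior power which occur in the correspondence. -/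
theorem exists_ratio (hu : IsShortExact u R) (hv : IsShortExact v P)
    (e' : Module.Basis (Fin (Γ'.rank x)) ℝ (Γ'.A x))
    (e'' : Module.Basis (Fin (Γ''.rank y)) ℝ (Γ''.A y))
    (τ' : Module.Basis (Fin (dim x)) ℝ (Tan x)) (τ'' : Module.Basis (Fin (dim y)) ℝ (Tan y))
    {t' : Fin (dim x) → T} {t'' : Fin (dim y) → T} (ht' : ∀ i, P (t' i) = τ' i)
    (ht'' : ∀ j, R (t'' j) = τ'' j) :
    ∃ κ : ℝ, κ ≠ 0 ∧ ιMulti ℝ _ (fun i => u (e' i)) * ιMulti ℝ _ t'' =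
      κ • (ιMulti ℝ _ (fun j => v (e'' j)) * ιMulti ℝ _ t') := by
  obtain ⟨κ, hκ⟩ := exists_smul_eq_of_top (hu.card_add_card e' τ'') (hv.card_add_card e'' τ')
    (fun i => u (e' i)) t'' (hv.wedge_mul_wedge_ne_zero e'' τ' ht')
  refine ⟨κ, fun h0 => hu.wedge_mul_wedge_ne_zero e' τ'' ht'' ?_, hκ⟩
  rw [hκ, h0, zero_smul]

theorem neg_one_pow_mul_self (n : ℕ) : (-1 : ℝ) ^ n * (-1) ^ n = 1 := by
  rw [← mul_pow, neg_one_mul, neg_neg, one_pow]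

/-- In fixed bases the correspondence becomes multiplication of coefficients by a nonzero scalar, so
it is the graph of an isomorphism of lines. The sign of the definition is absorbed in `κ`. -/
theorem qCorresponds_iff_coeff (hu : IsShortExact u R) (hv : IsShortExact v P) :
    ∃ (e' : Module.Basis (Fin (Γ'.rank x)) ℝ (Γ'.A x))
      (e'' : Module.Basis (Fin (Γ''.rank y)) ℝ (Γ''.A y)) (κ : ℝ), κ ≠ 0 ∧ ∀ ξ' ξ'',
      QCorresponds Γ' Γ'' x y P R u v ξ' ξ'' ↔
        Γ'.coeff x e' (stdBasis x) ξ' * κ = Γ''.coeff y e'' (stdBasis y) ξ'' := by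
  obtain ⟨t', ht'⟩ : ∃ t' : Fin (dim x) → T, ∀ i, P (t' i) = stdBasis x i :=
    ⟨_, fun i => (hv.surjective _).choose_spec⟩
  obtain ⟨t'', ht''⟩ : ∃ t'' : Fin (dim y) → T, ∀ i, R (t'' i) = stdBasis y i :=
    ⟨_, fun i => (hu.surjective _).choose_spec⟩
  obtain ⟨κ, h0, hκ⟩ := exists_ratio hu hv (Module.finBasis ℝ _) (Module.finBasis ℝ _)
    (stdBasis x) (stdBasis y) ht' ht''
  have hs := neg_one_pow_mul_self (Γ'.rank x * Γ''.rank y)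
  have hs0 : (-1 : ℝ) ^ (Γ'.rank x * Γ''.rank y) ≠ 0 := pow_ne_zero _ (by norm_num)
  refine ⟨Module.finBasis ℝ _, Module.finBasis ℝ _,
    (-1) ^ (Γ'.rank x * Γ''.rank y) * κ, mul_ne_zero hs0 h0, fun ξ' ξ'' => ⟨fun h => ?_, fun h =>
      qCorresponds_of_bases hu hv (Module.finBasis ℝ _) (Module.finBasis ℝ _) _ _ ht' ht'' ?_⟩⟩
  · have h1 := h (Module.finBasis ℝ _) (Module.finBasis ℝ _) _ _ t' t'' ht' ht''
    rw [hκ, smul_smul] at h1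
    have h2 := smul_left_injective _ (hv.wedge_mul_wedge_ne_zero (Module.finBasis ℝ _) _ ht') h1
    linear_combination (-1) ^ (Γ'.rank x * Γ''.rank y) * h2 +
      Γ''.coeff y (Module.finBasis ℝ _) (stdBasis y) ξ'' * hs
  · rw [hκ, smul_smul]
    congr 1
    linear_combination (-1) ^ (Γ'.rank x * Γ''.rank y) * h -
      Γ'.coeff x (Module.finBasis ℝ _) (stdBasis x) ξ' * κ * hs

theorem existsUnique_qCorresponds_right (hu : IsShortExact u R) (hv : IsShortExact v P)
    (ξ' : Γ'.Q x) : ∃! ξ'', QCorresponds Γ' Γ'' x y P R u v ξ' ξ'' := by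
  obtain ⟨e', e'', κ, -, h⟩ := qCorresponds_iff_coeff (Γ' := Γ') (Γ'' := Γ'') hu hv
  simp only [h]
  obtain ⟨ξ'', hξ⟩ := LieGroupoid.coeff_surjective e'' (stdBasis y)
    (Γ'.coeff x e' (stdBasis x) ξ' * κ)
  exact ⟨ξ'', hξ.symm, fun η hη => LieGroupoid.coeff_injective e'' (stdBasis y)
    (hη.symm.trans hξ.symm)⟩


/-- The hypotheses on `f` are the derivatives of the properties of a balanced map: compatibility
with projections, equivariance on either side, and invariance along orbits. They are required on the
fibre product of T and U only, and make V its quotient by A''. The three defining equations live in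
different top exterior powers and become comparable once lifted to that of the fibre product. -/
theorem QCorresponds.comp {U V : Type*} [AddCommGroup U] [Module ℝ U] [Module.Finite ℝ U]
    [AddCommGroup V] [Module ℝ V] [Module.Finite ℝ V]
    {P₁ : U →ₗ[ℝ] Tan y} {R₁ : U →ₗ[ℝ] Tan z} {u₁ : Γ''.A y →ₗ[ℝ] U} {v₁ : Λ.A z →ₗ[ℝ] U}
    {P₂ : V →ₗ[ℝ] Tan x} {R₂ : V →ₗ[ℝ] Tan z} {u₂ : Γ'.A x →ₗ[ℝ] V} {v₂ : Λ.A z →ₗ[ℝ] V}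
    (hu : IsShortExact u R) (hv : IsShortExact v P) (hu₁ : IsShortExact u₁ R₁)
    (hv₁ : IsShortExact v₁ P₁) (hu₂ : IsShortExact u₂ R₂) (hv₂ : IsShortExact v₂ P₂)
    (f : T × U →ₗ[ℝ] V) (hP : ∀ t w, R t = P₁ w → P₂ (f (t, w)) = P t)
    (hR : ∀ t w, R t = P₁ w → R₂ (f (t, w)) = R₁ w) (hfu : ∀ a, f (u a, 0) = u₂ a)
    (hfv : ∀ a, f (0, v₁ a) = v₂ a) (hvu : ∀ a, R (v a) = P₁ (u₁ a))
    (hf : ∀ a, f (v a, u₁ a) = 0)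
    {ξ' : Γ'.Q x} {ξ'' : Γ''.Q y} {ξ₃ : Λ.Q z}
    (h : QCorresponds Γ' Γ'' x y P R u v ξ' ξ'')
    (h₁ : QCorresponds Γ'' Λ y z P₁ R₁ u₁ v₁ ξ'' ξ₃) :
    QCorresponds Γ' Λ x z P₂ R₂ u₂ v₂ ξ' ξ₃ := by
  -- the fibre product, with its projections to `T`, `U` and `V`
  let W : Submodule ℝ (T × U) :=
    LinearMap.eqLocus (R ∘ₗ LinearMap.fst ℝ T U) (P₁ ∘ₗ LinearMap.snd ℝ T U)
  let fT : W →ₗ[ℝ] T := LinearMap.fst ℝ T U ∘ₗ W.subtype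
  let fU : W →ₗ[ℝ] U := LinearMap.snd ℝ T U ∘ₗ W.subtype
  let fV : W →ₗ[ℝ] V := f ∘ₗ W.subtype
  have hW : ∀ w : W, R (fT w) = P₁ (fU w) := fun w => w.2
  let F : Λ.A z →ₗ[ℝ] W := (LinearMap.prod 0 v₁).codRestrict W fun a => by
    change R 0 = P₁ (v₁ a)
    rw [map_zero, hv₁.exact.apply_apply_eq_zero]
  let E : Γ''.A y →ₗ[ℝ] W := (LinearMap.prod v u₁).codRestrict W hvu
  let H : Γ'.A x →ₗ[ℝ] W := (LinearMap.prod u 0).codRestrict W fun a => by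
    change R (u a) = P₁ 0
    rw [map_zero, hu.exact.apply_apply_eq_zero]
  have hFT : IsShortExact F fT := by
    refine ⟨fun a b hab => hv₁.injective (congrArg fU hab), fun w => ⟨fun hw => ?_, ?_⟩, fun t => ?_⟩
    · have h0 := hW w
      rw [hw, map_zero] at h0
      obtain ⟨a, ha⟩ := (hv₁.exact (fU w)).1 h0.symm
      exact ⟨a, Subtype.ext (Prod.ext hw.symm ha)⟩
    · rintro ⟨a, rfl⟩
      rfl
    · obtain ⟨w, hw⟩ := hv₁.surjective (R t)
      exact ⟨⟨(t, w), hw.symm⟩, rfl⟩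
  have hHU : IsShortExact H fU := by
    refine ⟨fun a b hab => hu.injective (congrArg fT hab), fun w => ⟨fun hw => ?_, ?_⟩, fun s => ?_⟩
    · have h0 := hW w
      rw [hw, map_zero] at h0
      obtain ⟨a, ha⟩ := (hu.exact (fT w)).1 h0
      exact ⟨a, Subtype.ext (Prod.ext ha hw.symm)⟩
    · rintro ⟨a, rfl⟩
      rfl
    · obtain ⟨t, ht⟩ := hu.surjective (P₁ s)
      exact ⟨⟨(t, s), ht⟩, rfl⟩
  have hEV : IsShortExact E fV := by
    refine ⟨fun a b hab => hv.injective (congrArg fT hab), fun w => ⟨fun hw => ?_, ?_⟩, fun s => ?_⟩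
    -- The T-component of a kernel vector is killed by `P`, hence equals `v a`. Subtracting `E a`
    -- leaves some `F b`, whose image `v₂ b` is zero, so `b = 0` by injectivity of `v₂`.
    · have h0 : P (fT w) = 0 := by
        rw [← hP _ _ (hW w), ← map_zero P₂]
        exact congrArg P₂ hw
      obtain ⟨a, ha⟩ := (hv.exact _).1 h0
      have h1 : fT (w - E a) = 0 := by
        rw [map_sub, ← ha]
        exact sub_self _
      obtain ⟨b, hb⟩ := (hFT.exact _).1 h1
      have h2 : v₂ b = 0 := by
        have h3 := congrArg fV hb
        rw [map_sub, hw, show fV (E a) = 0 from hf a, sub_zero] at h3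
        exact (hfv b).symm.trans h3
      have h3 : b = 0 := hv₂.injective (h2.trans (map_zero _).symm)
      rw [h3, map_zero] at hb
      exact ⟨a, (sub_eq_zero.1 hb.symm).symm⟩
    · rintro ⟨a, rfl⟩
      exact hf a
    -- First match the image under `R₂` through the U-component; the remaining difference lies in
    -- the image of `u₂` and is corrected by some `H a`.
    · obtain ⟨w, hw⟩ := hHU.surjective (hu₁.surjective (R₂ s)).choose
      have h1 : R₂ (fV w) = R₂ s :=
        (hR _ _ (hW w)).trans ((congrArg R₁ hw).trans (hu₁.surjective (R₂ s)).choose_spec)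
      obtain ⟨a, ha⟩ := (hu₂.exact (s - fV w)).1 (by rw [map_sub, h1, sub_self])
      refine ⟨w + H a, ?_⟩
      have h2 : fV (H a) = u₂ a := hfu a
      rw [map_add, h2, ha, add_sub_cancel]
  have hFV : ∀ a, fV (F a) = v₂ a := hfv
  have hHV : ∀ a, fV (H a) = u₂ a := hfu
  have hFU : ∀ a, fU (F a) = v₁ a := fun _ => rfl
  have hHT : ∀ a, fT (H a) = u a := fun _ => rfl
  have hET : ∀ a, fT (E a) = v a := fun _ => rfl
  have hEU : ∀ a, fU (E a) = u₁ a := fun _ => rfl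
  -- bases and lifts
  let e' := Module.finBasis ℝ (Γ'.A x)
  let e'' := Module.finBasis ℝ (Γ''.A y)
  let e₃ := Module.finBasis ℝ (Λ.A z)
  obtain ⟨d', hd'⟩ : ∃ d' : Fin (dim x) → W, ∀ i, P (fT (d' i)) = stdBasis x i :=
    ⟨_, fun i => ((hv.surjective.comp hFT.surjective) _).choose_spec⟩
  obtain ⟨d'', hd''⟩ : ∃ d'' : Fin (dim y) → W, ∀ i, R (fT (d'' i)) = stdBasis y i :=
    ⟨_, fun i => ((hu.surjective.comp hFT.surjective) _).choose_spec⟩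
  obtain ⟨d₃, hd₃⟩ : ∃ d₃ : Fin (dim z) → W, ∀ i, R₁ (fU (d₃ i)) = stdBasis z i :=
    ⟨_, fun i => ((hu₁.surjective.comp hHU.surjective) _).choose_spec⟩
  -- Because the lifts are taken in the fibre product, each family serves two of the three spaces:
  -- `d'` in T and V, `d''` in T and U, `d₃` in U and V.
  have hd₁ : ∀ i, P₁ (fU (d'' i)) = stdBasis y i := fun i => (hW _).symm.trans (hd'' i)
  have hd₂ : ∀ i, P₂ (fV (d' i)) = stdBasis x i := fun i => (hP _ _ (hW _)).trans (hd' i)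
  have hd₄ : ∀ i, R₂ (fV (d₃ i)) = stdBasis z i := fun i => (hR _ _ (hW _)).trans (hd₃ i)
  obtain ⟨κ, -, hκ⟩ := exists_ratio hu₂ hv₂ e' e₃ _ _ hd₂ hd₄
  obtain ⟨μ, hμ0, hμ⟩ := exists_ratio hu hv e' e'' _ _ hd' hd''
  refine qCorresponds_of_bases hu₂ hv₂ e' e₃ _ _ hd₂ hd₄ ?_
  rw [hκ, smul_smul]
  congr 1
  -- lift the three equations to the fibre product
  let wE := ιMulti ℝ _ (fun i => E (e'' i))
  let wF := ιMulti ℝ _ (fun i => F (e₃ i))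
  let wH := ιMulti ℝ _ (fun i => H (e' i))
  have q₂ : wE * (wH * ιMulti ℝ _ d₃) = κ • (wE * (wF * ιMulti ℝ _ d')) := by
    rw [← mul_smul_comm]
    refine ιMulti_mul_congr hEV.surjective (hEV.ker_le_span e'') ?_
    rw [map_smul, map_ιMulti_mul_ιMulti, map_ιMulti_mul_ιMulti]
    simpa only [hHV, hFV] using hκ
  have qμ : wF * (wH * ιMulti ℝ _ d'') = μ • (wF * (wE * ιMulti ℝ _ d')) := by
    rw [← mul_smul_comm]
    refine ιMulti_mul_congr hFT.surjective (hFT.ker_le_span e₃) ?_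
    rw [map_smul, map_ιMulti_mul_ιMulti, map_ιMulti_mul_ιMulti]
    exact hμ
  have h := h e' e'' _ _ _ _ hd' hd''
  have h₁ := h₁ e'' e₃ _ _ _ _ hd₁ hd₃
  rw [hμ, smul_smul] at h
  have h := smul_left_injective _ (hv.wedge_mul_wedge_ne_zero e'' _ hd') h
  have q₁ := ιMulti_mul_congr hHU.surjective (hHU.ker_le_span e')
    (z := Γ''.coeff y e'' (stdBasis y) ξ'' • (wE * ιMulti ℝ _ d₃))
    (z' := ((-1) ^ (Γ''.rank y * Λ.rank z) * Λ.coeff z e₃ (stdBasis z) ξ₃) •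
      (wF * ιMulti ℝ _ d'')) (by rw [map_smul, map_smul, map_ιMulti_mul_ιMulti, map_ιMulti_mul_ιMulti]; exact h₁)
  change wH * _ = wH * _ at q₁
  -- reorder
  have s₁ : wE * wH = (-1 : ℝ) ^ (Γ''.rank y * Γ'.rank x) • (wH * wE) :=
    ιMulti_mul_ιMulti_comm _ _
  have s₂ : wE * wF = (-1 : ℝ) ^ (Γ''.rank y * Λ.rank z) • (wF * wE) :=
    ιMulti_mul_ιMulti_comm _ _
  have s₃ : wF * wH = (-1 : ℝ) ^ (Λ.rank z * Γ'.rank x) • (wH * wF) :=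
    ιMulti_mul_ιMulti_comm _ _
  -- All three lifted equations will be expressed as multiples of this one nonzero element, so that
  -- scalars can be compared.
  have hZ : wF * (wE * ιMulti ℝ _ d') ≠ 0 := by
    obtain ⟨β, hβ⟩ := hv.exists_basis e'' (stdBasis x) hd'
    rw [ιMulti_mul_ιMulti]
    refine hFT.wedge_mul_wedge_ne_zero e₃ β fun j => ?_
    rw [hβ]
    refine Fin.addCases (fun i => ?_) (fun i => ?_) j <;> simp [hET]
  rw [← mul_assoc, ← mul_assoc, s₁, s₂, smul_mul_assoc, smul_mul_assoc, smul_smul] at q₂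
  rw [← mul_assoc, s₃, smul_mul_assoc] at qμ
  rw [mul_smul_comm, mul_smul_comm, ← mul_assoc, ← mul_assoc] at q₁
  rw [← mul_assoc] at hZ
  rw [← mul_assoc wF] at qμ
  have n₁ := neg_one_pow_mul_self (Γ''.rank y * Γ'.rank x)
  have n₂ := neg_one_pow_mul_self (Γ''.rank y * Λ.rank z)
  have n₃ := neg_one_pow_mul_self (Λ.rank z * Γ'.rank x)
  rw [mul_comm (Γ'.rank x)] at h ⊢
  generalize (-1 : ℝ) ^ (Γ''.rank y * Γ'.rank x) = σ₁ at *
  generalize (-1 : ℝ) ^ (Γ''.rank y * Λ.rank z) = σ₂ at *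
  generalize (-1 : ℝ) ^ (Λ.rank z * Γ'.rank x) = σ₃ at *
  -- Inserting `q₂` and `qμ` into `q₁` leaves a scalar identity. Together with `h` it gives the
  -- claim multiplied by `μ`, which is nonzero; what remains is that the block signs square to 1.
  have a₁ := congrArg (σ₁ • ·) q₁
  rw [smul_comm, q₂] at a₁
  have a₂ := congrArg (σ₃ • ·) a₁
  rw [smul_comm σ₃ σ₁, smul_comm σ₃ (σ₂ * _), qμ] at a₂
  simp only [smul_smul] at a₂
  have a₃ := smul_left_injective _ hZ a₂
  refine mul_left_cancel₀ hμ0 ?_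
  linear_combination κ * h + σ₁ * σ₂ * σ₃ * a₃ -
    σ₁ * Γ''.coeff y e'' (stdBasis y) ξ'' * κ * (σ₃ * σ₃ * n₂ + n₃) +
    σ₃ * Λ.coeff z e₃ (stdBasis z) ξ₃ * μ * (σ₂ * σ₂ * n₁ + n₂)

end Correspondence
end LieGpd
end

open scoped ContDiff Topology TensorProduct

noncomputable section

namespace LieGpd

open Set Filter

/-! ### Smooth plots and velocities of curves -/

section Plots

variable {M N P : Type*} [TopologicalSpace M] [MixedManifold M] [TopologicalSpace N]
  [MixedManifold N] [TopologicalSpace P] [MixedManifold P]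
  {E F : Type*} [NormedAddCommGroup E] [NormedSpace ℝ E] [NormedAddCommGroup F] [NormedSpace ℝ F]

theorem mem_chart_source (x : M) : x ∈ (chart x).source := MixedManifold.mem_source x

theorem chart_source_mem_nhds {x z : M} (h : z ∈ (chart x).source) : (chart x).source ∈ 𝓝 z :=
  (chart x).open_source.mem_nhds h

theorem contDiffAt_transition {x y z : M} (hx : z ∈ (chart x).source) (hy : z ∈ (chart y).source) :
    ContDiffAt ℝ ∞ (chart y ∘ (chart x).symm) (chart x z) := by
  refine (MixedManifold.compat x y).contDiffAt
    (((chart x).symm.trans (chart y)).open_source.mem_nhds ?_)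
  rw [OpenPartialHomeomorph.trans_source]
  refine ⟨(chart x).map_source hx, ?_⟩
  rw [mem_preimage, (chart x).left_inv hx]
  exact hy

/-- A map `φ` from a normed space to a manifold, with value `x` at `e`, is smooth at `e` within
`S`. -/
def SmoothPlot (φ : E → M) (S : Set E) (e : E) (x : M) : Prop :=
  φ e = x ∧ ContinuousWithinAt φ S e ∧ ContDiffWithinAt ℝ ∞ (fun u => chart x (φ u)) S e

theorem ContDiffWithinAt.comp_eventually {G : Type*} [NormedAddCommGroup G] [NormedSpace ℝ G]
    {g : F → G} {f : E → F} {t : Set F} {s : Set E} {e : E}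
    (hg : ContDiffWithinAt ℝ ∞ g t (f e)) (hf : ContDiffWithinAt ℝ ∞ f s e)
    (hst : ∀ᶠ u in 𝓝[s] e, f u ∈ t) : ContDiffWithinAt ℝ ∞ (fun u => g (f u)) s e :=
  (hg.comp_of_preimage_mem_nhdsWithin (x := e) hf hst)

namespace SmoothPlot

variable {φ : E → M} {S : Set E} {e : E} {x : M}

theorem eventually_mem (h : SmoothPlot φ S e x) {U : Set M} (hU : U ∈ 𝓝 x) :
    ∀ᶠ u in 𝓝[S] e, φ u ∈ U := h.2.1 (by rwa [h.1])

theorem contDiffWithinAt_chart (h : SmoothPlot φ S e x) {x₀ : M} (hx : x ∈ (chart x₀).source) :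
    ContDiffWithinAt ℝ ∞ (fun u => chart x₀ (φ u)) S e := by
  have h1 : ContDiffWithinAt ℝ ∞ (fun u => (chart x₀ ∘ (chart x).symm) (chart x (φ u))) S e := by
    refine ContDiffAt.comp_contDiffWithinAt (g := chart x₀ ∘ (chart x).symm)
      (f := fun u => chart x (φ u)) e ?_ h.2.2
    simp only [h.1]
    exact contDiffAt_transition (mem_chart_source x) hx
  refine h1.congr_of_eventuallyEq ?_ ?_
  · filter_upwards [h.eventually_mem (chart_source_mem_nhds (mem_chart_source x))] with u hu
    simp [(chart x).left_inv hu]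
  · simp [h.1, (chart x).left_inv (mem_chart_source x)]

theorem of_chart {x₀ : M} (hφ : φ e = x) (hc : ContinuousWithinAt φ S e)
    (hx : x ∈ (chart x₀).source) (h : ContDiffWithinAt ℝ ∞ (fun u => chart x₀ (φ u)) S e) :
    SmoothPlot φ S e x := by
  refine ⟨hφ, hc, ?_⟩
  have h1 : ContDiffWithinAt ℝ ∞ (fun u => (chart x ∘ (chart x₀).symm) (chart x₀ (φ u))) S e := by
    refine ContDiffAt.comp_contDiffWithinAt (g := chart x ∘ (chart x₀).symm)
      (f := fun u => chart x₀ (φ u)) e ?_ h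
    simp only [hφ]
    exact contDiffAt_transition hx (mem_chart_source x)
  refine h1.congr_of_eventuallyEq ?_ ?_
  · have : ∀ᶠ u in 𝓝[S] e, φ u ∈ (chart x₀).source := hc (by
      rw [hφ]; exact chart_source_mem_nhds hx)
    filter_upwards [this] with u hu
    simp [(chart x₀).left_inv hu]
  · simp [hφ, (chart x₀).left_inv hx]

theorem congr (h : SmoothPlot φ S e x) {ψ : E → M} (hψ : ψ =ᶠ[𝓝[S] e] φ) (he : ψ e = φ e) :
    SmoothPlot ψ S e x :=
  ⟨he.trans h.1, h.2.1.congr_of_eventuallyEq hψ he,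
    h.2.2.congr_of_eventuallyEq (hψ.fun_comp (chart x)) (by rw [he])⟩

theorem mono (h : SmoothPlot φ S e x) {S' : Set E} (hS : S' ⊆ S) : SmoothPlot φ S' e x :=
  ⟨h.1, h.2.1.mono hS, h.2.2.mono hS⟩

theorem comp (h : SmoothPlot φ S e x) {g : F → E} {S' : Set F} {a : F} (hg : g a = e)
    (hg' : ContDiffWithinAt ℝ ∞ g S' a) (hS : ∀ᶠ u in 𝓝[S'] a, g u ∈ S) :
    SmoothPlot (fun u => φ (g u)) S' a x := by
  subst hg
  refine ⟨h.1, ?_, ContDiffWithinAt.comp_eventually (g := fun u => chart x (φ u)) h.2.2 hg' hS⟩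
  exact Tendsto.comp h.2.1 (tendsto_nhdsWithin_iff.2 ⟨hg'.continuousWithinAt, hS⟩)

theorem comp_univ (h : SmoothPlot φ univ e x) {g : F → E} {S' : Set F} {a : F} (hg : g a = e)
    (hg' : ContDiffWithinAt ℝ ∞ g S' a) : SmoothPlot (fun u => φ (g u)) S' a x :=
  h.comp hg hg' (Eventually.of_forall fun _ => mem_univ _)

theorem chart_symm (x : M) : SmoothPlot (chart x).symm univ (chart x x) x := by
  have hx := (chart x).map_source (mem_chart_source x)
  refine ⟨(chart x).left_inv (mem_chart_source x),
    ((chart x).symm.continuousAt hx).continuousWithinAt, ?_⟩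
  refine contDiffWithinAt_id.congr_of_eventuallyEq ?_ ((chart x).right_inv hx)
  rw [nhdsWithin_univ]
  filter_upwards [(chart x).open_target.mem_nhds hx] with u hu
  exact (chart x).right_inv hu

theorem const (x : M) : SmoothPlot (fun _ : E => x) S e x :=
  ⟨rfl, continuousWithinAt_const, contDiffWithinAt_const⟩

end SmoothPlot

theorem IsSmoothAt.comp_plot {f : M → N} {φ : E → M} {S : Set E} {e : E} {x : M}
    (hf : IsSmoothAt f x) (h : SmoothPlot φ S e x) :
    SmoothPlot (fun u => f (φ u)) S e (f x) := by
  obtain ⟨hφ, hc, hd⟩ := h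
  subst hφ
  refine ⟨rfl, ContinuousAt.comp_continuousWithinAt (g := f) hf.1 hc, ?_⟩
  refine (ContDiffAt.comp_contDiffWithinAt (g := chart (f (φ e)) ∘ f ∘ (chart (φ e)).symm)
    (f := fun u => chart (φ e) (φ u)) e hf.2 hd).congr_of_eventuallyEq ?_ ?_
  · filter_upwards [hc (chart_source_mem_nhds (mem_chart_source (φ e)))] with u hu
    simp [(chart (φ e)).left_inv (show φ u ∈ _ from hu)]
  · simp [(chart (φ e)).left_inv (mem_chart_source (φ e))]

theorem isSmoothAt_iff_plot {f : M → N} {x : M} :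
    IsSmoothAt f x ↔ SmoothPlot (fun u => f ((chart x).symm u)) univ (chart x x) (f x) := by
  refine ⟨fun h => h.comp_plot (SmoothPlot.chart_symm x), fun h => ⟨?_, ?_⟩⟩
  · have h1 : ContinuousAt (fun z => f ((chart x).symm (chart x z))) x := by
      refine ContinuousAt.comp (g := fun u => f ((chart x).symm u)) ?_
        ((chart x).continuousAt (mem_chart_source x))
      exact h.2.1.continuousAt univ_mem
    refine h1.congr ?_
    filter_upwards [chart_source_mem_nhds (mem_chart_source x)] with z hz
    rw [(chart x).left_inv hz]
  · exact h.2.2.contDiffAt univ_mem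

/-- Plots make partially defined maps composable: the only side condition is that the pair of plots
stays in the domain near the point. With `isSmoothOn₂_of_plot`, where the inverse charts are the
test plots, smoothness on fibre products becomes a calculus of substitutions. -/
theorem IsSmoothOn₂.comp_plot {f : M → N → P} {S' : Set (M × N)} (hf : IsSmoothOn₂ f S')
    {φ : E → M} {ψ : E → N} {S : Set E} {e : E} {x : M} {y : N} (hφ : SmoothPlot φ S e x)
    (hψ : SmoothPlot ψ S e y) (hxy : (x, y) ∈ S') (hS : ∀ᶠ u in 𝓝[S] e, (φ u, ψ u) ∈ S') :
    SmoothPlot (fun u => f (φ u) (ψ u)) S e (f x y) := by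
  obtain ⟨rfl, hc, hd⟩ := hφ
  obtain ⟨rfl, hc', hd'⟩ := hψ
  obtain ⟨h1, h2⟩ := hf _ hxy
  have e1 : ∀ᶠ u in 𝓝[S] e, φ u ∈ (chart (φ e)).source :=
    hc (chart_source_mem_nhds (mem_chart_source (φ e)))
  have e2 : ∀ᶠ u in 𝓝[S] e, ψ u ∈ (chart (ψ e)).source :=
    hc' (chart_source_mem_nhds (mem_chart_source (ψ e)))
  refine ⟨rfl, ?_, ?_⟩
  · exact Tendsto.comp h1 (tendsto_nhdsWithin_iff.2 ⟨(hc.prodMk hc'), hS⟩)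
  · refine (ContDiffWithinAt.comp_eventually
      (f := fun u => (chart (φ e) (φ u), chart (ψ e) (ψ u))) h2 (hd.prodMk hd') ?_
      ).congr_of_eventuallyEq ?_ ?_
    · filter_upwards [hS, e1, e2] with u hu h1 h2
      simpa [(chart (φ e)).left_inv h1, (chart (ψ e)).left_inv h2] using hu
    · filter_upwards [e1, e2] with u h1 h2
      simp [(chart (φ e)).left_inv h1, (chart (ψ e)).left_inv h2]
    · simp [(chart (φ e)).left_inv (mem_chart_source _),
        (chart (ψ e)).left_inv (mem_chart_source _)]

theorem isSmoothOn₂_of_plot {f : M → N → P} {S : Set (M × N)}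
    (h : ∀ x y, (x, y) ∈ S → SmoothPlot
      (fun u : Tan x × Tan y => f ((chart x).symm u.1) ((chart y).symm u.2))
      {u | ((chart x).symm u.1, (chart y).symm u.2) ∈ S} (chart x x, chart y y) (f x y)) :
    IsSmoothOn₂ f S := by
  rintro ⟨x, y⟩ hxy
  obtain ⟨-, hc, hd⟩ := h x y hxy
  refine ⟨?_, hd⟩
  have e1 : ∀ᶠ w : M × N in 𝓝[S] (x, y), w.1 ∈ (chart x).source :=
    nhdsWithin_le_nhds (continuousAt_fst.eventually (chart_source_mem_nhds (mem_chart_source x)))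
  have e2 : ∀ᶠ w : M × N in 𝓝[S] (x, y), w.2 ∈ (chart y).source :=
    nhdsWithin_le_nhds (continuousAt_snd.eventually (chart_source_mem_nhds (mem_chart_source y)))
  have hcx : ContinuousAt (fun w : M × N => (chart x w.1, chart y w.2)) (x, y) :=
    ContinuousAt.prodMk
      (ContinuousAt.comp (g := chart x) ((chart x).continuousAt (mem_chart_source x))
        continuousAt_fst)
      (ContinuousAt.comp (g := chart y) ((chart y).continuousAt (mem_chart_source y))
        continuousAt_snd)
  have key : ContinuousWithinAt (fun w : M × N =>
      f ((chart x).symm (chart x w.1)) ((chart y).symm (chart y w.2))) S (x, y) := by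
    refine Tendsto.comp hc (tendsto_nhdsWithin_iff.2 ⟨hcx.continuousWithinAt, ?_⟩)
    filter_upwards [e1, e2, self_mem_nhdsWithin] with w h1 h2 h3
    simpa [(chart x).left_inv h1, (chart y).left_inv h2] using h3
  refine key.congr_of_eventuallyEq ?_ ?_
  · filter_upwards [e1, e2] with w h1 h2
    simp [(chart x).left_inv h1, (chart y).left_inv h2]
  · simp [(chart x).left_inv (mem_chart_source x), (chart y).left_inv (mem_chart_source y)]

/-! ### Velocities -/

/-- The tangent map of `f` at `x`, with values in the tangent space at a point `y` equal to
`f x`. -/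
def tmapTo (f : M → N) (x : M) (y : N) : Tan x →L[ℝ] Tan y :=
  fderiv ℝ (chart y ∘ f ∘ (chart x).symm) (chart x x)

/-- The curve `γ` passes through `x` at time `0` with velocity `w`. -/
def HasVel (γ : ℝ → M) (x : M) (w : Tan x) : Prop :=
  γ 0 = x ∧ ContinuousAt γ 0 ∧ HasDerivAt (fun t => chart x (γ t)) w 0

namespace HasVel

variable {γ : ℝ → M} {x : M} {w : Tan x}

theorem unique (h : HasVel γ x w) {w' : Tan x} (h' : HasVel γ x w') : w = w' :=
  h.2.2.unique h'.2.2

theorem congr (h : HasVel γ x w) {η : ℝ → M} (hη : η =ᶠ[𝓝 0] γ) : HasVel η x w :=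
  ⟨hη.eq_of_nhds.trans h.1, h.2.1.congr hη.symm,
    h.2.2.congr_of_eventuallyEq (hη.fun_comp (chart x))⟩

theorem const (x : M) : HasVel (fun _ => x) x 0 :=
  ⟨rfl, continuousAt_const, hasDerivAt_const _ _⟩

theorem eventually_mem (h : HasVel γ x w) {U : Set M} (hU : U ∈ 𝓝 x) : ∀ᶠ t in 𝓝 0, γ t ∈ U :=
  h.2.1 (by rwa [h.1])

/-- A curve staying in `S` sees any within-derivative in the same way. Hence the value of
`tmapWithin` on its velocity is forced, even though the derivative within `S` need not be unique. -/
theorem mapWithin {f : M → N} {S : Set M} {y : N} (h : HasVel γ x w) (hy : f x = y)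
    (hc : ContinuousWithinAt f S x)
    (hd : DifferentiableWithinAt ℝ (chart y ∘ f ∘ (chart x).symm) ((chart x).symm ⁻¹' S)
      (chart x x)) (hS : ∀ᶠ t in 𝓝 0, γ t ∈ S) :
    HasVel (fun t => f (γ t)) y (tmapWithin f S x y w) := by
  obtain ⟨h0, hγ, hγ'⟩ := h
  have e1 : ∀ᶠ t in 𝓝 0, γ t ∈ (chart x).source :=
    hγ (by rw [h0]; exact chart_source_mem_nhds (mem_chart_source x))
  refine ⟨(congrArg f h0).trans hy, ?_, ?_⟩
  · rw [← h0] at hc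
    exact Tendsto.comp hc (tendsto_nhdsWithin_iff.2 ⟨hγ, hS⟩)
  · have h1 := hd.hasFDerivWithinAt
    have h2 : HasDerivWithinAt (fun t => (chart y ∘ f ∘ (chart x).symm) (chart x (γ t)))
        (tmapWithin f S x y w) {t | (chart x).symm (chart x (γ t)) ∈ S} 0 := by
      refine HasFDerivWithinAt.comp_hasDerivWithinAt (l := chart y ∘ f ∘ (chart x).symm)
        (t := (chart x).symm ⁻¹' S) 0 ?_ hγ'.hasDerivWithinAt fun t ht => ht
      rwa [h0]
    refine (h2.hasDerivAt ?_).congr_of_eventuallyEq ?_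
    · filter_upwards [e1, hS] with t h1 h2
      simpa [(chart x).left_inv h1] using h2
    · filter_upwards [e1] with t h1
      simp [(chart x).left_inv h1]

theorem map {f : M → N} {y : N} (h : HasVel γ x w) (hf : IsSmoothAt f x) (hy : f x = y) :
    HasVel (fun t => f (γ t)) y (tmapTo f x y w) := by
  subst hy
  have := h.mapWithin (S := univ) rfl hf.1.continuousWithinAt
    (hf.2.differentiableAt (by simp)).differentiableWithinAt (by simp)
  rwa [tmapWithin, preimage_univ, fderivWithin_univ] at this

theorem coord (h : HasVel γ x w) {x₀ : M} (hx : x ∈ (chart x₀).source) :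
    HasDerivAt (fun t => chart x₀ (γ t)) (coordChange x x₀ x w) 0 := by
  obtain ⟨h0, hγ, hγ'⟩ := h
  have h1 : HasDerivAt (fun t => (chart x₀ ∘ (chart x).symm) (chart x (γ t)))
      (coordChange x x₀ x w) 0 := by
    refine HasFDerivAt.comp_hasDerivAt (l := chart x₀ ∘ (chart x).symm) 0 ?_ hγ'
    rw [h0]
    exact ((contDiffAt_transition (mem_chart_source x) hx).differentiableAt
      (by simp)).hasFDerivAt
  refine h1.congr_of_eventuallyEq ?_
  filter_upwards [hγ (by rw [h0]; exact chart_source_mem_nhds (mem_chart_source x))] with t ht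
  simp [(chart x).left_inv (show γ t ∈ _ from ht)]

end HasVel

theorem exists_hasVel (x : M) (w : Tan x) : ∃ γ : ℝ → M, HasVel γ x w := by
  have hx := (chart x).map_source (mem_chart_source x)
  have hc : ContinuousAt (fun t : ℝ => chart x x + t • w) 0 := by fun_prop
  refine ⟨fun t => (chart x).symm (chart x x + t • w), ?_, ?_, ?_⟩
  · simp [(chart x).left_inv (mem_chart_source x)]
  · refine ContinuousAt.comp (g := (chart x).symm) ?_ hc
    simpa using (chart x).symm.continuousAt hx
  · have h1 : HasDerivAt (fun t : ℝ => chart x x + t • w) w 0 := by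
      simpa using ((hasDerivAt_id (0 : ℝ)).smul_const w).const_add (chart x x)
    refine h1.congr_of_eventuallyEq ?_
    filter_upwards [hc (by simpa using (chart x).open_target.mem_nhds hx)] with t ht
    exact (chart x).right_inv ht

/-- The derivative of a map of two variables which is meaningful on `S` only. -/
def tmap₂ (f : M → N → P) (S : Set (M × N)) (x : M) (y : N) (z : P) :
    Tan x × Tan y →L[ℝ] Tan z :=
  fderivWithin ℝ (fun u : Tan x × Tan y => chart z (f ((chart x).symm u.1) ((chart y).symm u.2)))
    {u | ((chart x).symm u.1, (chart y).symm u.2) ∈ S} (chart x x, chart y y)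

/-- On velocities of curves of pairs inside `S` the linear map `tmap₂` has its geometric meaning;
its other values are never interpreted. Identities between differentials can thus be proved by
differentiating identities along curves. -/
theorem HasVel.map₂ {f : M → N → P} {S : Set (M × N)} (hf : IsSmoothOn₂ f S) {γ : ℝ → M}
    {η : ℝ → N} {x : M} {y : N} {z : P} {w : Tan x} {w' : Tan y} (h : HasVel γ x w)
    (h' : HasVel η y w') (hz : f x y = z) (hS : ∀ᶠ t in 𝓝 0, (γ t, η t) ∈ S) :
    HasVel (fun t => f (γ t) (η t)) z (tmap₂ f S x y z (w, w')) := by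
  subst hz
  obtain ⟨rfl, hγ, hγ'⟩ := h
  obtain ⟨rfl, hη, hη'⟩ := h'
  obtain ⟨h1, h2⟩ := hf _ hS.self_of_nhds
  have e1 : ∀ᶠ t in 𝓝 0, γ t ∈ (chart (γ 0)).source :=
    hγ (chart_source_mem_nhds (mem_chart_source _))
  have e2 : ∀ᶠ t in 𝓝 0, η t ∈ (chart (η 0)).source :=
    hη (chart_source_mem_nhds (mem_chart_source _))
  refine ⟨rfl, Tendsto.comp h1 (tendsto_nhdsWithin_iff.2 ⟨hγ.prodMk_nhds hη, hS⟩), ?_⟩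
  have h3 := (h2.differentiableWithinAt (by simp)).hasFDerivWithinAt
  have h4 := HasFDerivWithinAt.comp_hasDerivWithinAt (f := fun t => (chart (γ 0) (γ t),
    chart (η 0) (η t))) (s := {t | ((chart (γ 0)).symm (chart (γ 0) (γ t)),
      (chart (η 0)).symm (chart (η 0) (η t))) ∈ S}) 0 h3
    (hγ'.prodMk hη').hasDerivWithinAt fun t ht => ht
  refine (h4.hasDerivAt ?_).congr_of_eventuallyEq ?_
  · filter_upwards [e1, e2, hS] with t h1 h2 h3
    simpa [(chart (γ 0)).left_inv h1, (chart (η 0)).left_inv h2] using h3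
  · filter_upwards [e1, e2] with t h1 h2
    simp [(chart (γ 0)).left_inv h1, (chart (η 0)).left_inv h2]

end Plots
end LieGpd
end

open scoped ContDiff Topology TensorProduct

noncomputable section

namespace LieGpd

open Set Filter

/-! ### Local form of submersions -/

section Submersions

variable {M N P : Type*} [TopologicalSpace M] [MixedManifold M] [TopologicalSpace N]
  [MixedManifold N] [TopologicalSpace P] [MixedManifold P]

/-- A point near `x` can be moved smoothly to a given fibre of a submersion `f`. -/
theorem exists_lift {f : M → N} {x : M} {y : N} (hf : IsSmoothAt f x) (hy : f x = y)
    (hs : Function.Surjective (tmapTo f x y)) :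
    ∃ Λ : Tan x × Tan y → M, SmoothPlot Λ univ (chart x x, chart y y) x ∧
      (∀ᶠ p in 𝓝 (chart x x, chart y y), f (Λ p) = (chart y).symm p.2) ∧
      ∀ᶠ u in 𝓝 (chart x x), Λ (u, chart y (f ((chart x).symm u))) = (chart x).symm u := by
  subst hy
  set y := f x
  set a := chart x x with ha
  have hxa : (chart x).symm a = x := (chart x).left_inv (mem_chart_source x)
  let F : Tan x → Tan y := chart y ∘ f ∘ (chart x).symm
  have hF : ContDiffAt ℝ ∞ F a := hf.2
  have hFa : F a = chart y y := by simp [F, hxa, y]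
  let L : Tan x →L[ℝ] Tan y := fderiv ℝ F a
  obtain ⟨R, hR⟩ : ∃ R : Tan y →L[ℝ] Tan x, L.comp R = .id ℝ _ :=
    ContinuousLinearMap.exists_rightInverse_of_surjective L (LinearMap.range_eq_top.2 hs)
  have hLR : ∀ w, L (R w) = w := fun w => DFunLike.congr_fun hR w
  -- `ψ` is tangent to the identity at `a` and turns `F` into its linearization: `L (ψ z - a) = F z
  -- - F a`. Its local inverse `χ` therefore straightens the fibres of `F`.
  let ψ : Tan x → Tan x := fun z => z - R (L (z - a)) + R (F z - F a)
  have hψa : ψ a = a := by simp [ψ]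
  have hψ : ContDiffAt ℝ ∞ ψ a := by
    refine ContDiffAt.add (ContDiffAt.sub contDiffAt_id ?_) ?_
    · exact (R.contDiff.comp (L.contDiff.comp (contDiff_id.sub contDiff_const))).contDiffAt
    · exact R.contDiff.contDiffAt.comp a (hF.sub contDiffAt_const)
  have hψ' : HasFDerivAt ψ ((ContinuousLinearEquiv.refl ℝ (Tan x) :
      Tan x ≃L[ℝ] Tan x) : Tan x →L[ℝ] Tan x) a := by
    have h1 : HasFDerivAt F L a := (hF.differentiableAt (by simp)).hasFDerivAt
    have h2 := ((hasFDerivAt_id a).sub (R.hasFDerivAt.comp a (L.hasFDerivAt.comp a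
      ((hasFDerivAt_id a).sub_const a)))).add (R.hasFDerivAt.comp a (h1.sub_const (F a)))
    refine h2.congr_fderiv ?_
    ext w
    simp
  have hψF : ∀ z, L (ψ z - a) = F z - F a := fun z => by
    simp only [ψ, map_add, map_sub, hLR]
    abel
  have hn : (∞ : WithTop ℕ∞) ≠ 0 := by simp
  let χ := hψ.localInverse hψ' hn
  have hstr := hψ.hasStrictFDerivAt' hψ' hn
  have hχ : ContDiffAt ℝ ∞ χ a := by
    have := hψ.to_localInverse hψ' hn
    rwa [hψa] at this
  have hχψ : ∀ᶠ z in 𝓝 a, χ (ψ z) = z := hstr.eventually_left_inverse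
  have hψχ : ∀ᶠ z in 𝓝 a, ψ (χ z) = z := by
    have := hstr.eventually_right_inverse
    rwa [hψa] at this
  have hχa : χ a = a := by
    have := hχψ.self_of_nhds
    rwa [hψa] at this
  -- In straightened coordinates, a shift along the right inverse `R` by the defect `p.2 - F p.1`
  -- reaches the prescribed fibre. There is no shift if the point already lies in it, which is the
  -- last assertion.
  let θ : Tan x × Tan y → Tan x := fun p => ψ p.1 + R (p.2 - F p.1)
  have hθa : θ (a, chart y y) = a := by simp [θ, hψa, hFa]
  have hθ : ContDiffAt ℝ ∞ θ (a, chart y y) := by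
    refine ContDiffAt.add (ContDiffAt.fst' hψ) (R.contDiff.contDiffAt.comp _ ?_)
    exact contDiffAt_snd.sub (ContDiffAt.fst' hF)
  have hΛ : SmoothPlot (fun p => (chart x).symm (χ (θ p))) univ (a, chart y y) x := by
    refine (SmoothPlot.chart_symm x).comp_univ (g := fun p => χ (θ p)) ?_ ?_
    · rw [hθa, hχa]
    · have : ContDiffAt ℝ ∞ χ (θ (a, chart y y)) := by rwa [hθa]
      exact (this.comp _ hθ).contDiffWithinAt
  refine ⟨fun p => (chart x).symm (χ (θ p)), hΛ, ?_, ?_⟩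
  · have h1 := hθ.continuousAt.eventually (p := fun z => ψ (χ z) = z) (by rwa [hθa])
    have h2 := (hf.comp_plot hΛ).eventually_mem (chart_source_mem_nhds (mem_chart_source y))
    rw [nhdsWithin_univ] at h2
    filter_upwards [h1, h2] with p h1 h2
    rw [← (chart y).left_inv h2]
    congr 1
    change F (χ (θ p)) = p.2
    have h3 := hψF (χ (θ p))
    rw [h1] at h3
    have h4 := hψF p.1
    have h5 : L (θ p - a) = L (ψ p.1 - a) + (p.2 - F p.1) := by
      rw [show θ p - a = ψ p.1 - a + R (p.2 - F p.1) by simp only [θ]; abel, map_add, hLR]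
    rw [h4, h3] at h5
    rw [← sub_left_inj (a := F a), h5]
    abel
  · filter_upwards [hχψ] with u hu
    change (chart x).symm (χ (ψ u + R (F u - F u))) = _
    rw [sub_self, map_zero, add_zero, hu]

/-- Take the straight line with direction `w` in the chart and push it into the fibres over `η`.
Since the push fixes points already in the right fibre, its differential sends `(w, df w)` to `w`,
so the velocity is unchanged. -/
theorem exists_lift_curve {f : M → N} {x : M} {y : N} (hf : IsSmoothAt f x) (hy : f x = y)
    (hs : Function.Surjective (tmapTo f x y)) {η : ℝ → N} {w : Tan x}
    (hη : HasVel η y (tmapTo f x y w)) :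
    ∃ γ : ℝ → M, HasVel γ x w ∧ ∀ᶠ t in 𝓝 0, f (γ t) = η t := by
  obtain ⟨Λ, h1, h2, h3⟩ := exists_lift hf hy hs
  have hc : HasDerivAt (fun t : ℝ => chart x x + t • w) w 0 := by
    simpa using ((hasDerivAt_id (0 : ℝ)).smul_const w).const_add (chart x x)
  have hcη := hc.prodMk hη.2.2
  have hg0 : (chart x x + (0 : ℝ) • w, chart y (η 0)) = (chart x x, chart y y) := by
    simp [hη.1]
  have hgc : Tendsto (fun t : ℝ => (chart x x + t • w, chart y (η t))) (𝓝 0)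
      (𝓝 (chart x x, chart y y)) := by
    rw [← hg0]
    exact hcη.continuousAt
  refine ⟨fun t => Λ (chart x x + t • w, chart y (η t)), ⟨?_, ?_, ?_⟩, ?_⟩
  · exact (congrArg Λ hg0).trans h1.1
  · refine ContinuousAt.comp (g := Λ) ?_ hcη.continuousAt
    rw [hg0]
    exact h1.2.1.continuousAt univ_mem
  · have hd : HasFDerivAt (fun p => chart x (Λ p)) (fderiv ℝ (fun p => chart x (Λ p))
        (chart x x, chart y y)) (chart x x, chart y y) :=
      ((h1.2.2.contDiffAt univ_mem).differentiableAt (by simp)).hasFDerivAt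
    have h4 : HasDerivAt (fun t : ℝ => chart x (Λ (chart x x + t • w, chart y (η t))))
        (fderiv ℝ (fun p => chart x (Λ p)) (chart x x, chart y y) (w, tmapTo f x y w)) 0 := by
      refine HasFDerivAt.comp_hasDerivAt (l := fun p => chart x (Λ p)) 0 ?_ hcη
      rw [hg0]
      exact hd
    have hF : HasFDerivAt (fun u => chart y (f ((chart x).symm u))) (tmapTo f x y)
        (chart x x) := by
      subst hy
      exact (hf.2.differentiableAt (by simp)).hasFDerivAt
    have h5 : HasFDerivAt (fun u => chart x (Λ (u, chart y (f ((chart x).symm u)))))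
        ((fderiv ℝ (fun p => chart x (Λ p)) (chart x x, chart y y)).comp
          ((ContinuousLinearMap.id ℝ _).prod (tmapTo f x y))) (chart x x) := by
      refine HasFDerivAt.comp (g := fun p => chart x (Λ p)) _ ?_ ((hasFDerivAt_id _).prodMk hF)
      simpa [(chart x).left_inv (mem_chart_source x), hy] using hd
    have h6 : (fun u => chart x (Λ (u, chart y (f ((chart x).symm u))))) =ᶠ[𝓝 (chart x x)]
        id := by
      filter_upwards [h3, (chart x).open_target.mem_nhds
        ((chart x).map_source (mem_chart_source x))] with u h7 h8
      rw [h7, (chart x).right_inv h8, id]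
    have h7 := (h5.congr_of_eventuallyEq h6.symm).unique (hasFDerivAt_id _)
    have h8 := DFunLike.congr_fun h7 w
    simp only [ContinuousLinearMap.comp_apply, ContinuousLinearMap.prod_apply,
      ContinuousLinearMap.id_apply] at h8
    rwa [h8] at h4
  · filter_upwards [hgc.eventually h2,
      hη.eventually_mem (chart_source_mem_nhds (mem_chart_source y))] with t h4 h5
    rw [h4, (chart y).left_inv h5]

/-- Submersions have smooth local sections. -/
theorem exists_local_section {f : M → N} {x : M} {y : N} (hf : IsSmoothAt f x) (hy : f x = y)
    (hs : Function.Surjective (tmapTo f x y)) :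
    ∃ σ : Tan y → M, SmoothPlot σ univ (chart y y) x ∧
      ∀ᶠ u in 𝓝 (chart y y), f (σ u) = (chart y).symm u := by
  obtain ⟨Λ, h1, h2, -⟩ := exists_lift hf hy hs
  have hc : ContDiffAt ℝ ∞ (fun u : Tan y => (chart x x, u)) (chart y y) :=
    contDiffAt_const.prodMk contDiffAt_id
  exact ⟨fun u => Λ (chart x x, u), h1.comp_univ rfl hc.contDiffWithinAt,
    hc.continuousAt.eventually h2⟩

end Submersions
end LieGpd
end

open scoped ContDiff Topology TensorProduct

noncomputable section

namespace LieGpd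

open Set Filter

/-! ### Tangent maps with a prescribed target, and maps on fibres -/

section Tangent

variable {M N : Type*} [TopologicalSpace M] [MixedManifold M] [TopologicalSpace N]
  [MixedManifold N]

theorem tmapTo_eq_zero_iff {f : M → N} {x : M} {y : N} (hy : f x = y) {w : Tan x} :
    tmapTo f x y w = 0 ↔ tmap f x w = 0 := by
  subst hy
  rfl

theorem IsSubmersion.surjective_tmapTo {f : M → N} (hf : IsSubmersion f) {x : M} {y : N}
    (hy : f x = y) : Function.Surjective (tmapTo f x y) := by
  subst hy
  exact hf.2 x

theorem continuousWithinAt_of_plot {f : M → N} {S : Set M} {x : M} {y : N}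
    (h : SmoothPlot (fun u => f ((chart x).symm u)) ((chart x).symm ⁻¹' S) (chart x x) y) :
    ContinuousWithinAt f S x := by
  have e1 : ∀ᶠ z in 𝓝[S] x, z ∈ (chart x).source :=
    nhdsWithin_le_nhds (chart_source_mem_nhds (mem_chart_source x))
  have key : ContinuousWithinAt (fun z => f ((chart x).symm (chart x z))) S x := by
    refine Tendsto.comp (g := fun u => f ((chart x).symm u)) h.2.1 (tendsto_nhdsWithin_iff.2
      ⟨((chart x).continuousAt (mem_chart_source x)).continuousWithinAt, ?_⟩)
    filter_upwards [e1, self_mem_nhdsWithin] with z h1 h2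
    rwa [mem_preimage, (chart x).left_inv h1]
  refine key.congr_of_eventuallyEq ?_ ?_
  · filter_upwards [e1] with z h1
    rw [(chart x).left_inv h1]
  · rw [(chart x).left_inv (mem_chart_source x)]

theorem HasVel.mapWithin_of_plot {f : M → N} {S : Set M} {x : M} {y : N}
    (h : SmoothPlot (fun u => f ((chart x).symm u)) ((chart x).symm ⁻¹' S) (chart x x) y)
    {γ : ℝ → M} {w : Tan x} (hγ : HasVel γ x w) (hS : ∀ᶠ t in 𝓝 0, γ t ∈ S) :
    HasVel (fun t => f (γ t)) y (tmapWithin f S x y w) := by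
  refine hγ.mapWithin ?_ (continuousWithinAt_of_plot h) (h.2.2.differentiableWithinAt (by simp)) hS
  exact (congrArg f ((chart x).left_inv (mem_chart_source x))).symm.trans h.1

end Tangent

/-! ### Groupoids -/

namespace LieGroupoid

variable {G G₀ : Type*} [TopologicalSpace G] [MixedManifold G] [TopologicalSpace G₀]
  [MixedManifold G₀] (Γ : LieGroupoid G G₀)

theorem eq_inv_of_mul_eq_unit {g h : G} (hgh : Γ.r g = Γ.l h)
    (h1 : Γ.mul g h = Γ.unit (Γ.l g)) : h = Γ.inv g := by
  rw [← Γ.unit_mul h, ← hgh, ← Γ.inv_mul g, Γ.mul_assoc _ _ _ (Γ.r_inv g) hgh, h1,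
    ← Γ.r_inv g, Γ.mul_unit]

theorem inv_inv (g : G) : Γ.inv (Γ.inv g) = g := by
  refine (Γ.eq_inv_of_mul_eq_unit (Γ.r_inv g) ?_).symm
  rw [Γ.inv_mul, Γ.l_inv]

theorem inv_unit (x : G₀) : Γ.inv (Γ.unit x) = Γ.unit x := by
  refine (Γ.eq_inv_of_mul_eq_unit (by rw [Γ.l_unit, Γ.r_unit]) ?_).symm
  have := Γ.unit_mul (Γ.unit x)
  rw [Γ.l_unit] at this
  rwa [Γ.l_unit]

theorem inv_mul_rev {g h : G} (hgh : Γ.r g = Γ.l h) :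
    Γ.inv (Γ.mul g h) = Γ.mul (Γ.inv h) (Γ.inv g) := by
  have h1 : Γ.r (Γ.inv h) = Γ.l (Γ.inv g) := by rw [Γ.r_inv, Γ.l_inv, hgh]
  refine (Γ.eq_inv_of_mul_eq_unit ?_ ?_).symm
  · rw [Γ.r_mul _ _ hgh, Γ.l_mul _ _ h1, Γ.l_inv]
  · rw [Γ.mul_assoc _ _ _ hgh (by rw [Γ.l_mul _ _ h1, Γ.l_inv]),
      ← Γ.mul_assoc _ _ _ (Γ.l_inv h).symm h1, Γ.mul_inv, ← hgh, ← Γ.l_inv g, Γ.unit_mul,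
      Γ.mul_inv, Γ.l_mul _ _ hgh]

theorem inv_mul_cancel_left {g h : G} (hgh : Γ.r g = Γ.l h) :
    Γ.mul (Γ.inv g) (Γ.mul g h) = h := by
  rw [← Γ.mul_assoc _ _ _ (Γ.r_inv g) hgh, Γ.inv_mul, hgh, Γ.unit_mul]

theorem mul_inv_cancel_right {g h : G} (hgh : Γ.r g = Γ.l h) :
    Γ.mul (Γ.mul g h) (Γ.inv h) = g := by
  rw [Γ.mul_assoc _ _ _ hgh (Γ.l_inv h).symm, Γ.mul_inv, ← hgh, Γ.mul_unit]

theorem inv_mul_cancel_right {g h : G} (hgh : Γ.r g = Γ.r h) :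
    Γ.mul (Γ.mul g (Γ.inv h)) h = g := by
  rw [Γ.mul_assoc _ _ _ (by rw [Γ.l_inv, hgh]) (Γ.r_inv h), Γ.inv_mul, ← hgh, Γ.mul_unit]

theorem mul_inv_cancel_left {g h : G} (hgh : Γ.l g = Γ.l h) :
    Γ.mul g (Γ.mul (Γ.inv g) h) = h := by
  rw [← Γ.mul_assoc _ _ _ (Γ.l_inv g).symm (by rw [Γ.r_inv, hgh]), Γ.mul_inv, hgh, Γ.unit_mul]

/-- Every element of the Lie algebroid is the velocity of a curve in an `r`-fibre. -/
theorem exists_hasVel_A {x : G₀} (a : Γ.A x) :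
    ∃ γ : ℝ → G, HasVel γ (Γ.unit x) a ∧ ∀ᶠ t in 𝓝 0, Γ.r (γ t) = x := by
  have h0 : tmapTo Γ.r (Γ.unit x) x (a : Tan (Γ.unit x)) = 0 :=
    (tmapTo_eq_zero_iff (Γ.r_unit x)).2 a.2
  refine exists_lift_curve (Γ.r_submersion.1 _) (Γ.r_unit x)
    (Γ.r_submersion.surjective_tmapTo (Γ.r_unit x)) (η := fun _ => x) ?_
  rw [h0]
  exact HasVel.const x

theorem mem_A_of_hasVel {x : G₀} {γ : ℝ → G} {a : Tan (Γ.unit x)} (h : HasVel γ (Γ.unit x) a)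
    (hγ : ∀ᶠ t in 𝓝 0, Γ.r (γ t) = x) : a ∈ Γ.A x := by
  refine (tmapTo_eq_zero_iff (Γ.r_unit x)).1 ?_
  exact ((h.map (Γ.r_submersion.1 _) (Γ.r_unit x)).congr
    (η := fun _ => x) (hγ.mono fun t ht => ht.symm)).unique (HasVel.const x)

/-- A Lie groupoid as a bibundle over itself. -/
def toBibundle : Bibundle Γ Γ G where
  p := Γ.l
  q := Γ.r
  lact := Γ.mul
  ract := Γ.mul
  smooth_p := Γ.l_submersion.1
  smooth_q := Γ.r_submersion.1
  smooth_lact := Γ.smooth_mul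
  smooth_ract := Γ.smooth_mul
  p_lact := Γ.l_mul
  q_lact := Γ.r_mul
  p_ract := Γ.l_mul
  q_ract := Γ.r_mul
  unit_lact := Γ.unit_mul
  ract_unit := Γ.mul_unit
  mul_lact := Γ.mul_assoc
  ract_mul b h k h1 h2 := (Γ.mul_assoc b h k h1 h2).symm
  lact_ract g b h h1 h2 := (Γ.mul_assoc g b h h1 h2).symm

/-- The division maps are `b c⁻¹` and `b⁻¹ c`. With this, the correspondence defining invariance is
the one of an invertible bibundle, so results on bibundles apply to it. -/
theorem isInvertible_toBibundle : Γ.toBibundle.IsInvertible where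
  p_submersion := Γ.l_submersion
  p_surjective x := ⟨Γ.unit x, Γ.l_unit x⟩
  q_submersion := Γ.r_submersion
  q_surjective x := ⟨Γ.unit x, Γ.r_unit x⟩
  left_principal := by
    refine ⟨fun b c => Γ.mul b (Γ.inv c), ?_, fun b c h => ⟨?_, ?_⟩, fun g c h => ?_⟩
    · refine isSmoothOn₂_of_plot fun x y hxy => ?_
      refine Γ.smooth_mul.comp_plot (φ := fun u : Tan x × Tan y => (chart x).symm u.1)
        (ψ := fun u : Tan x × Tan y => Γ.inv ((chart y).symm u.2))
        ((SmoothPlot.chart_symm x).comp_univ rfl contDiffWithinAt_fst)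
        (((Γ.smooth_inv y).comp_plot (SmoothPlot.chart_symm y)).comp_univ rfl
          contDiffWithinAt_snd) (Eq.trans hxy (Γ.l_inv y).symm) ?_
      filter_upwards [self_mem_nhdsWithin] with u hu
      exact Eq.trans hu (Γ.l_inv _).symm
    · rw [Γ.r_mul _ _ (Eq.trans h (Γ.l_inv c).symm)]
      exact Γ.r_inv c
    · exact Γ.inv_mul_cancel_right h
    · exact Γ.mul_inv_cancel_right h
  right_principal := by
    refine ⟨fun b c => Γ.mul (Γ.inv b) c, ?_, fun b c h => ⟨?_, ?_⟩, fun b h h' => ?_⟩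
    · refine isSmoothOn₂_of_plot fun x y hxy => ?_
      refine Γ.smooth_mul.comp_plot (φ := fun u : Tan x × Tan y => Γ.inv ((chart x).symm u.1))
        (ψ := fun u : Tan x × Tan y => (chart y).symm u.2)
        (((Γ.smooth_inv x).comp_plot (SmoothPlot.chart_symm x)).comp_univ rfl
          contDiffWithinAt_fst)
        ((SmoothPlot.chart_symm y).comp_univ rfl contDiffWithinAt_snd)
        (Eq.trans (Γ.r_inv x) hxy) ?_
      filter_upwards [self_mem_nhdsWithin] with u hu
      exact Eq.trans (Γ.r_inv _) hu
    · rw [Γ.l_mul _ _ (Eq.trans (Γ.r_inv b) h)]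
      exact (Γ.l_inv b).symm
    · exact Γ.mul_inv_cancel_left h
    · exact Γ.inv_mul_cancel_left h'

end LieGroupoid

/-! ### Bibundles -/

namespace Bibundle

variable {G' G'₀ G'' G''₀ : Type*}
  [TopologicalSpace G'] [MixedManifold G'] [TopologicalSpace G'₀] [MixedManifold G'₀]
  [TopologicalSpace G''] [MixedManifold G''] [TopologicalSpace G''₀] [MixedManifold G''₀]
  {Γ' : LieGroupoid G' G'₀} {Γ'' : LieGroupoid G'' G''₀}
  {B : Type*} [TopologicalSpace B] [MixedManifold B] (𝓑 : Bibundle Γ' Γ'' B)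

theorem inv_lact_lact {g : G'} {b : B} (h : Γ'.r g = 𝓑.p b) :
    𝓑.lact (Γ'.inv g) (𝓑.lact g b) = b := by
  rw [← 𝓑.mul_lact _ _ _ (Γ'.r_inv g) h, Γ'.inv_mul, h, 𝓑.unit_lact]

theorem ract_ract_inv {b : B} {h : G''} (hb : 𝓑.q b = Γ''.l h) :
    𝓑.ract (𝓑.ract b h) (Γ''.inv h) = b := by
  rw [← 𝓑.ract_mul _ _ _ hb (Γ''.l_inv h).symm, Γ''.mul_inv, ← hb, 𝓑.ract_unit]

theorem ract_inv_ract {b : B} {h : G''} (hb : 𝓑.q b = Γ''.r h) :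
    𝓑.ract (𝓑.ract b (Γ''.inv h)) h = b := by
  have := 𝓑.ract_ract_inv (b := b) (h := Γ''.inv h) (by rw [hb, Γ''.l_inv])
  rwa [Γ''.inv_inv] at this

/-- The opposite bibundle. -/
def op : Bibundle Γ'' Γ' B where
  p := 𝓑.q
  q := 𝓑.p
  lact h b := 𝓑.ract b (Γ''.inv h)
  ract b g := 𝓑.lact (Γ'.inv g) b
  smooth_p := 𝓑.smooth_q
  smooth_q := 𝓑.smooth_p
  smooth_lact := by
    refine isSmoothOn₂_of_plot fun x y hxy => ?_
    refine 𝓑.smooth_ract.comp_plot (φ := fun u : Tan x × Tan y => (chart y).symm u.2)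
      (ψ := fun u : Tan x × Tan y => Γ''.inv ((chart x).symm u.1))
      ((SmoothPlot.chart_symm y).comp_univ rfl contDiffWithinAt_snd)
      (((Γ''.smooth_inv x).comp_plot (SmoothPlot.chart_symm x)).comp_univ rfl
        contDiffWithinAt_fst) (Eq.trans (Eq.symm hxy) (Γ''.l_inv x).symm) ?_
    filter_upwards [self_mem_nhdsWithin] with u hu
    exact Eq.trans (Eq.symm hu) (Γ''.l_inv _).symm
  smooth_ract := by
    refine isSmoothOn₂_of_plot fun x y hxy => ?_
    refine 𝓑.smooth_lact.comp_plot (φ := fun u : Tan x × Tan y => Γ'.inv ((chart y).symm u.2))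
      (ψ := fun u : Tan x × Tan y => (chart x).symm u.1)
      (((Γ'.smooth_inv y).comp_plot (SmoothPlot.chart_symm y)).comp_univ rfl
        contDiffWithinAt_snd) ((SmoothPlot.chart_symm x).comp_univ rfl contDiffWithinAt_fst)
      (Eq.trans (Γ'.r_inv y) (Eq.symm hxy)) ?_
    filter_upwards [self_mem_nhdsWithin] with u hu
    exact Eq.trans (Γ'.r_inv _) (Eq.symm hu)
  p_lact g b h := by rw [𝓑.q_ract _ _ (by rw [Γ''.l_inv, h]), Γ''.r_inv]
  q_lact g b h := 𝓑.p_ract _ _ (by rw [Γ''.l_inv, h])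
  p_ract b h hb := 𝓑.q_lact _ _ (by rw [Γ'.r_inv, hb])
  q_ract b h hb := by rw [𝓑.p_lact _ _ (by rw [Γ'.r_inv, hb]), Γ'.l_inv]
  unit_lact b := by rw [Γ''.inv_unit, 𝓑.ract_unit]
  ract_unit b := by rw [Γ'.inv_unit, 𝓑.unit_lact]
  mul_lact g k b h1 h2 := by
    rw [Γ''.inv_mul_rev h1, 𝓑.ract_mul _ _ _ (by rw [Γ''.l_inv, h2])
      (by rw [Γ''.r_inv, Γ''.l_inv, h1])]
  ract_mul b h k h1 h2 := by
    rw [Γ'.inv_mul_rev h2, 𝓑.mul_lact _ _ _ (by rw [Γ'.r_inv, Γ'.l_inv, h2])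
      (by rw [Γ'.r_inv, h1])]
  lact_ract g b h h1 h2 :=
    (𝓑.lact_ract _ _ _ (by rw [Γ'.r_inv, h2]) (by rw [Γ''.l_inv, h1])).symm

variable {𝓑}

/-- The same division maps serve, with the two sides exchanged: since the opposite actions go
through inverses, `b δ = c` reads as the opposite left action of `δ` on `c` giving `b`. -/
theorem IsInvertible.op (h : 𝓑.IsInvertible) : 𝓑.op.IsInvertible where
  p_submersion := h.q_submersion
  p_surjective := h.q_surjective
  q_submersion := h.p_submersion
  q_surjective := h.p_surjective
  left_principal := by
    obtain ⟨δ, h1, h2, h3⟩ := h.right_principal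
    refine ⟨δ, h1, fun b c hbc => ?_, fun g c hg => ?_⟩
    · obtain ⟨h4, h5⟩ := h2 b c hbc
      have h6 := 𝓑.q_ract _ _ h4
      rw [h5] at h6
      refine ⟨h6.symm, ?_⟩
      have h7 := 𝓑.ract_ract_inv h4
      rwa [h5] at h7
    · have hg' : 𝓑.q c = Γ''.l (Γ''.inv g) := Eq.trans (Eq.symm hg) (Γ''.l_inv g).symm
      have h4 := h3 (𝓑.ract c (Γ''.inv g)) g (by rw [𝓑.q_ract _ _ hg', Γ''.r_inv])
      rwa [𝓑.ract_inv_ract hg.symm] at h4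
  right_principal := by
    obtain ⟨δ, h1, h2, h3⟩ := h.left_principal
    refine ⟨δ, h1, fun b c hbc => ?_, fun b g hg => ?_⟩
    · obtain ⟨h4, h5⟩ := h2 b c hbc
      have h6 := 𝓑.p_lact _ _ h4
      rw [h5] at h6
      refine ⟨h6, ?_⟩
      have h7 := 𝓑.inv_lact_lact h4
      rwa [h5] at h7
    · have hg' : Γ'.r (Γ'.inv g) = 𝓑.p b := Eq.trans (Γ'.r_inv g) (Eq.symm hg)
      have h4 := h3 g (𝓑.lact (Γ'.inv g) b) (by rw [𝓑.p_lact _ _ hg', Γ'.l_inv])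
      have h5 := 𝓑.inv_lact_lact hg'
      rw [Γ'.inv_inv] at h5
      rwa [h5] at h4

variable (𝓑)

/-- The infinitesimal left action, with values in the tangent space at `b`. -/
abbrev lgen (b : B) (x : G'₀) : Γ'.A x →ₗ[ℝ] Tan b := Γ'.gen x (fun g => 𝓑.lact g b) b

/-- The infinitesimal right action, with values in the tangent space at `b`. -/
abbrev rgen (b : B) (y : G''₀) : Γ''.A y →ₗ[ℝ] Tan b :=
  Γ''.gen y (fun h => 𝓑.ract b (Γ''.inv h)) b

/-- The correspondence at `b` between the fibres at points `x = p b` and `y = q b`. -/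
def CorrespondsAt (b : B) (x : G'₀) (y : G''₀) (ξ' : Γ'.Q x) (ξ'' : Γ''.Q y) : Prop :=
  QCorresponds Γ' Γ'' x y (tmapTo 𝓑.p b x).toLinearMap (tmapTo 𝓑.q b y).toLinearMap
    (𝓑.lgen b x) (𝓑.rgen b y) ξ' ξ''

theorem lgen_op (b : B) (y : G''₀) : 𝓑.op.lgen b y = 𝓑.rgen b y := rfl

theorem rgen_op (b : B) (x : G'₀) : 𝓑.op.rgen b x = 𝓑.lgen b x := by
  have : (fun h => 𝓑.op.ract b (Γ'.inv h)) = fun g => 𝓑.lact g b := by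
    funext g
    change 𝓑.lact (Γ'.inv (Γ'.inv g)) b = _
    rw [Γ'.inv_inv]
  unfold rgen lgen
  rw [this]

variable {𝓑}

theorem CorrespondsAt.op {b : B} {x : G'₀} {y : G''₀} {ξ' : Γ'.Q x} {ξ'' : Γ''.Q y}
    (h : 𝓑.CorrespondsAt b x y ξ' ξ'') : 𝓑.op.CorrespondsAt b y x ξ'' ξ' := by
  unfold CorrespondsAt
  rw [rgen_op, lgen_op]
  exact QCorresponds.symm h

theorem CorrespondsAt.of_op {b : B} {x : G'₀} {y : G''₀} {ξ' : Γ'.Q x} {ξ'' : Γ''.Q y}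
    (h : 𝓑.op.CorrespondsAt b y x ξ'' ξ') : 𝓑.CorrespondsAt b x y ξ' ξ'' := by
  unfold CorrespondsAt at h
  rw [rgen_op, lgen_op] at h
  exact QCorresponds.symm h

/-- This identifies `lgen`, defined by a derivative within the `r`-fibre, with the velocity of `g_t
b` for every curve `g_t` in that fibre. -/
theorem hasVel_lgen {b : B} {x : G'₀} (hx : 𝓑.p b = x) {γ : ℝ → G'} {a : Γ'.A x}
    (hγ : HasVel γ (Γ'.unit x) a) (hr : ∀ᶠ t in 𝓝 0, Γ'.r (γ t) = x) :
    HasVel (fun t => 𝓑.lact (γ t) b) b (𝓑.lgen b x a) := by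
  have h1 := 𝓑.smooth_lact.comp_plot (φ := (chart (Γ'.unit x)).symm)
    (S := (chart (Γ'.unit x)).symm ⁻¹' {g | Γ'.r g = x}) (e := chart (Γ'.unit x) (Γ'.unit x))
    ((SmoothPlot.chart_symm (Γ'.unit x)).mono (subset_univ _)) (SmoothPlot.const b)
    (Eq.trans (Γ'.r_unit x) hx.symm) (by
      filter_upwards [self_mem_nhdsWithin] with u hu
      exact Eq.trans hu hx.symm)
  have h2 : 𝓑.lact (Γ'.unit x) b = b := by rw [← hx, 𝓑.unit_lact]
  rw [h2] at h1
  exact hγ.mapWithin_of_plot (f := fun g => 𝓑.lact g b) h1 hr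

theorem hasVel_rgen {b : B} {y : G''₀} (hy : 𝓑.q b = y) {γ : ℝ → G''} {a : Γ''.A y}
    (hγ : HasVel γ (Γ''.unit y) a) (hr : ∀ᶠ t in 𝓝 0, Γ''.r (γ t) = y) :
    HasVel (fun t => 𝓑.ract b (Γ''.inv (γ t))) b (𝓑.rgen b y a) :=
  𝓑.op.hasVel_lgen hy hγ hr

/-- The smooth division map inverts the infinitesimal action: freeness gives injectivity, and
transitivity gives exactness in the middle. -/
theorem IsInvertible.isShortExact_lgen (h : 𝓑.IsInvertible) {b : B} {x : G'₀} {y : G''₀}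
    (hx : 𝓑.p b = x) (hy : 𝓑.q b = y) :
    IsShortExact (𝓑.lgen b x) (tmapTo 𝓑.q b y).toLinearMap := by
  obtain ⟨δ, hδ, h1, h2⟩ := h.left_principal
  have hunit : δ b b = Γ'.unit x := by
    have := h2 (Γ'.unit (𝓑.p b)) b (Γ'.r_unit _)
    rwa [𝓑.unit_lact, hx] at this
  refine ⟨?_, fun w => ⟨fun hw => ?_, ?_⟩, h.q_submersion.surjective_tmapTo hy⟩
  · rw [← LinearMap.ker_eq_bot, LinearMap.ker_eq_bot']
    intro a ha
    obtain ⟨γ, hγ, hr⟩ := Γ'.exists_hasVel_A a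
    have h3 := 𝓑.hasVel_lgen hx hγ hr
    rw [ha] at h3
    -- Differentiate `δ(g_t b, b) = g_t`: if `g_t b` has velocity zero, so has `g_t`.
    have h4 := h3.map₂ hδ (HasVel.const b) hunit (by
      filter_upwards [hr] with t ht
      exact 𝓑.q_lact _ _ (ht.trans hx.symm))
    have h5 : HasVel γ (Γ'.unit x) _ := h4.congr (by
      filter_upwards [hr] with t ht
      exact (h2 _ _ (ht.trans hx.symm)).symm)
    have h6 := hγ.unique h5
    rw [show ((0 : Tan b), (0 : Tan b)) = 0 from rfl, map_zero] at h6
    exact Subtype.ext h6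
  -- A vector killed by `dq` is the velocity of a curve `β` inside a `q`-fibre. Then `δ(β_t, b)`
  -- runs in an `r`-fibre, and its velocity is the required preimage.
  · have hη : HasVel (fun _ => y) y (tmapTo 𝓑.q b y w) := by
      rw [show tmapTo 𝓑.q b y w = 0 from hw]
      exact HasVel.const y
    obtain ⟨β, hβ, hqβ⟩ := exists_lift_curve (𝓑.smooth_q b) hy
      (h.q_submersion.surjective_tmapTo hy) hη
    have hS : ∀ᶠ t in 𝓝 0, 𝓑.q (β t) = 𝓑.q b := hqβ.mono fun t ht => ht.trans hy.symm
    have h3 := hβ.map₂ hδ (HasVel.const b) hunit hS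
    have hr : ∀ᶠ t in 𝓝 0, Γ'.r (δ (β t) b) = x := hS.mono fun t ht => (h1 _ _ ht).1.trans hx
    refine ⟨⟨_, Γ'.mem_A_of_hasVel h3 hr⟩, ?_⟩
    have h4 := 𝓑.hasVel_lgen hx (a := ⟨_, Γ'.mem_A_of_hasVel h3 hr⟩) h3 hr
    exact (h4.congr (η := β) (hS.mono fun t ht => (h1 _ _ ht).2.symm)).unique hβ
  · rintro ⟨a, rfl⟩
    obtain ⟨γ, hγ, hr⟩ := Γ'.exists_hasVel_A a
    have h3 := (𝓑.hasVel_lgen hx hγ hr).map (𝓑.smooth_q b) hy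
    refine (h3.congr (η := fun _ => y) ?_).unique (HasVel.const y)
    filter_upwards [hr] with t ht
    rw [𝓑.q_lact _ _ (ht.trans hx.symm), hy]

theorem IsInvertible.isShortExact_rgen (h : 𝓑.IsInvertible) {b : B} {x : G'₀} {y : G''₀}
    (hx : 𝓑.p b = x) (hy : 𝓑.q b = y) :
    IsShortExact (𝓑.rgen b y) (tmapTo 𝓑.p b x).toLinearMap :=
  h.op.isShortExact_lgen hy hx

theorem IsInvertible.existsUnique_right (h : 𝓑.IsInvertible) {b : B} {x : G'₀} {y : G''₀}
    (hx : 𝓑.p b = x) (hy : 𝓑.q b = y) (ξ' : Γ'.Q x) :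
    ∃! ξ'', 𝓑.CorrespondsAt b x y ξ' ξ'' :=
  existsUnique_qCorresponds_right (h.isShortExact_lgen hx hy) (h.isShortExact_rgen hx hy) ξ'

end Bibundle
end LieGpd
end

open scoped ContDiff Topology TensorProduct

noncomputable section

namespace LieGpd

open Set Filter

namespace Bibundle

variable {G' G'₀ G'' G''₀ K K₀ : Type*}
  [TopologicalSpace G'] [MixedManifold G'] [TopologicalSpace G'₀] [MixedManifold G'₀]
  [TopologicalSpace G''] [MixedManifold G''] [TopologicalSpace G''₀] [MixedManifold G''₀]
  [TopologicalSpace K] [MixedManifold K] [TopologicalSpace K₀] [MixedManifold K₀]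
  {Γ' : LieGroupoid G' G'₀} {Γ'' : LieGroupoid G'' G''₀} {Λ : LieGroupoid K K₀}
  {B C D : Type*} [TopologicalSpace B] [MixedManifold B] [TopologicalSpace C] [MixedManifold C]
  [TopologicalSpace D] [MixedManifold D]
  {𝓑 : Bibundle Γ' Γ'' B} {𝓒 : Bibundle Γ'' Λ C} {𝓓 : Bibundle Γ' Λ D}

/-! ### Balanced maps -/

/-- An equivariant smooth map `B ×_{G''₀} C → D` which is constant on the orbits of `G''`. -/
structure IsBalanced (𝓑 : Bibundle Γ' Γ'' B) (𝓒 : Bibundle Γ'' Λ C) (𝓓 : Bibundle Γ' Λ D)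
    (π : B → C → D) : Prop where
  smooth : IsSmoothOn₂ π {z | 𝓑.q z.1 = 𝓒.p z.2}
  p_map : ∀ b c, 𝓑.q b = 𝓒.p c → 𝓓.p (π b c) = 𝓑.p b
  q_map : ∀ b c, 𝓑.q b = 𝓒.p c → 𝓓.q (π b c) = 𝓒.q c
  lact_map : ∀ g b c, Γ'.r g = 𝓑.p b → 𝓑.q b = 𝓒.p c →
    𝓓.lact g (π b c) = π (𝓑.lact g b) c
  ract_map : ∀ b c k, 𝓑.q b = 𝓒.p c → 𝓒.q c = Λ.l k →
    𝓓.ract (π b c) k = π b (𝓒.ract c k)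
  balanced : ∀ b c h, 𝓑.q b = 𝓒.p c → 𝓑.q b = Γ''.l h →
    π (𝓑.ract b h) (𝓒.lact (Γ''.inv h) c) = π b c

/-- A balanced map composes the correspondences. -/
theorem IsBalanced.correspondsAt {π : B → C → D} (hπ : IsBalanced 𝓑 𝓒 𝓓 π)
    (h𝓑 : 𝓑.IsInvertible) (h𝓒 : 𝓒.IsInvertible) (h𝓓 : 𝓓.IsInvertible)
    {b : B} {c : C} {d : D} {x : G'₀} {y : G''₀} {z : K₀} (hx : 𝓑.p b = x) (hy : 𝓑.q b = y)
    (hy' : 𝓒.p c = y) (hz : 𝓒.q c = z) (hd : π b c = d) {ξ' : Γ'.Q x} {ξ'' : Γ''.Q y}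
    {ξ₃ : Λ.Q z} (h : 𝓑.CorrespondsAt b x y ξ' ξ'') (h' : 𝓒.CorrespondsAt c y z ξ'' ξ₃) :
    𝓓.CorrespondsAt d x z ξ' ξ₃ := by
  have hbc : 𝓑.q b = 𝓒.p c := hy.trans hy'.symm
  have hdx : 𝓓.p d = x := by rw [← hd, hπ.p_map b c hbc, hx]
  have hdz : 𝓓.q d = z := by rw [← hd, hπ.q_map b c hbc, hz]
  -- Only the values of `f` on pairs tangent to the fibre product matter. Each hypothesis of
  -- `QCorresponds.comp` is then a property of `π` differentiated along a suitable pair of curves.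
  let f := tmap₂ π {z | 𝓑.q z.1 = 𝓒.p z.2} b c d
  -- compatible pairs of tangent vectors are velocities of curves in the fibre product
  have curve : ∀ (t : Tan b) (w : Tan c), tmapTo 𝓑.q b y t = tmapTo 𝓒.p c y w →
      ∃ β γ, HasVel β b t ∧ HasVel γ c w ∧ (∀ᶠ s in 𝓝 0, 𝓑.q (β s) = 𝓒.p (γ s)) ∧
        HasVel (fun s => π (β s) (γ s)) d (f (t, w)) := by
    intro t w htw
    obtain ⟨β, hβ⟩ := exists_hasVel b t
    have h1 := hβ.map (𝓑.smooth_q b) hy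
    rw [htw] at h1
    obtain ⟨γ, hγ, h2⟩ := exists_lift_curve (𝓒.smooth_p c) hy'
      (h𝓒.p_submersion.surjective_tmapTo hy') h1
    exact ⟨β, γ, hβ, hγ, h2.mono fun s hs => hs.symm,
      hβ.map₂ hπ.smooth hγ hd (h2.mono fun s hs => hs.symm)⟩
  refine QCorresponds.comp (h𝓑.isShortExact_lgen hx hy) (h𝓑.isShortExact_rgen hx hy)
    (h𝓒.isShortExact_lgen hy' hz) (h𝓒.isShortExact_rgen hy' hz)
    (h𝓓.isShortExact_lgen hdx hdz) (h𝓓.isShortExact_rgen hdx hdz) f.toLinearMap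
    (fun t w htw => ?_) (fun t w htw => ?_) (fun a => ?_) (fun a => ?_) (fun a => ?_)
    (fun a => ?_) h h'
  · obtain ⟨β, γ, hβ, -, hS, hv⟩ := curve t w htw
    refine (hv.map (𝓓.smooth_p d) hdx).unique ((hβ.map (𝓑.smooth_p b) hx).congr ?_)
    exact hS.mono fun s hs => hπ.p_map _ _ hs
  · obtain ⟨β, γ, -, hγ, hS, hv⟩ := curve t w htw
    refine (hv.map (𝓓.smooth_q d) hdz).unique ((hγ.map (𝓒.smooth_q c) hz).congr ?_)
    exact hS.mono fun s hs => hπ.q_map _ _ hs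
  · obtain ⟨γ, hγ, hr⟩ := Γ'.exists_hasVel_A a
    have h1 := (𝓑.hasVel_lgen hx hγ hr).map₂ hπ.smooth (HasVel.const c) hd (by
      filter_upwards [hr] with t ht
      exact Eq.trans (𝓑.q_lact _ _ (ht.trans hx.symm)) hbc)
    refine h1.unique ((𝓓.hasVel_lgen hdx hγ hr).congr ?_)
    filter_upwards [hr] with t ht
    rw [← hd, hπ.lact_map _ _ _ (ht.trans hx.symm) hbc]
  · obtain ⟨γ, hγ, hr⟩ := Λ.exists_hasVel_A a
    have hr' : ∀ᶠ t in 𝓝 0, 𝓒.q c = Λ.l (Λ.inv (γ t)) :=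
      hr.mono fun t ht => by rw [Λ.l_inv, ht, hz]
    have h1 := (HasVel.const b).map₂ hπ.smooth (𝓒.hasVel_rgen hz hγ hr) hd (by
      filter_upwards [hr'] with t ht
      exact Eq.trans hbc (𝓒.p_ract _ _ ht).symm)
    refine h1.unique ((𝓓.hasVel_rgen hdz hγ hr).congr ?_)
    filter_upwards [hr'] with t ht
    rw [← hd, hπ.ract_map _ _ _ hbc ht]
  · obtain ⟨γ, hγ, hr⟩ := Γ''.exists_hasVel_A a
    refine ((𝓑.hasVel_rgen hy hγ hr).map (𝓑.smooth_q b) hy).unique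
      (((𝓒.hasVel_lgen hy' hγ hr).map (𝓒.smooth_p c) hy').congr ?_)
    filter_upwards [hr] with t ht
    rw [𝓑.q_ract _ _ (by rw [Γ''.l_inv, ht, hy]), 𝓒.p_lact _ _ (ht.trans hy'.symm), Γ''.r_inv]
  · obtain ⟨γ, hγ, hr⟩ := Γ''.exists_hasVel_A a
    have hr' : ∀ᶠ t in 𝓝 0, 𝓑.q b = Γ''.l (Γ''.inv (γ t)) :=
      hr.mono fun t ht => by rw [Γ''.l_inv, ht, hy]
    have h1 := (𝓑.hasVel_rgen hy hγ hr).map₂ hπ.smooth (𝓒.hasVel_lgen hy' hγ hr) hd (by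
      filter_upwards [hr, hr'] with t ht ht'
      exact Eq.trans (𝓑.q_ract _ _ ht') ((Γ''.r_inv _).trans
        (𝓒.p_lact _ _ (ht.trans hy'.symm)).symm))
    refine h1.unique ((HasVel.const d).congr ?_)
    filter_upwards [hr'] with t ht
    have h2 := hπ.balanced _ _ _ hbc ht
    rw [Γ''.inv_inv] at h2
    rw [h2, hd]

/-- The left action presents `𝓑` as G' composed with `𝓑`. It serves to compare the correspondences
at points b and gb of one fibre of q; `isBalanced_ract` does the same along fibres of p. -/
theorem isBalanced_lact (𝓑 : Bibundle Γ' Γ'' B) :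
    IsBalanced Γ'.toBibundle 𝓑 𝓑 𝓑.lact where
  smooth := 𝓑.smooth_lact
  p_map := 𝓑.p_lact
  q_map := 𝓑.q_lact
  lact_map g k b hg hk := (𝓑.mul_lact g k b hg hk).symm
  ract_map g b h hg hb := (𝓑.lact_ract g b h hg hb).symm
  balanced g b k hg hk := by
    have hk' : Γ'.r (Γ'.inv k) = 𝓑.p b := (Γ'.r_inv k).trans (Eq.trans (Eq.symm hk) hg)
    change 𝓑.lact (Γ'.mul g k) _ = _
    rw [← 𝓑.mul_lact _ _ _ ((Γ'.r_mul _ _ hk).trans (Γ'.l_inv k).symm) hk',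
      Γ'.mul_inv_cancel_right hk]

theorem isBalanced_ract (𝓑 : Bibundle Γ' Γ'' B) :
    IsBalanced 𝓑 Γ''.toBibundle 𝓑 𝓑.ract where
  smooth := 𝓑.smooth_ract
  p_map := 𝓑.p_ract
  q_map := 𝓑.q_ract
  lact_map := 𝓑.lact_ract
  ract_map b h k hb hk := (𝓑.ract_mul b h k hb hk).symm
  balanced b h k hb hk := by
    change 𝓑.ract (𝓑.ract b k) (Γ''.mul (Γ''.inv k) h) = _
    have hkh : Γ''.l k = Γ''.l h := hk.symm.trans hb
    rw [← 𝓑.ract_mul _ _ _ hk (by rw [Γ''.l_mul _ _ ((Γ''.r_inv k).trans hkh), Γ''.l_inv]),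
      Γ''.mul_inv_cancel_left hkh]

end Bibundle
end LieGpd
end

open scoped ContDiff Topology TensorProduct

noncomputable section

namespace LieGpd

open Set Filter

/-! ### Changes of coordinates of tangent vectors -/

section CoordChange

variable {M N : Type*} [TopologicalSpace M] [MixedManifold M] [TopologicalSpace N]
  [MixedManifold N]

theorem hasFDerivAt_transition {x y z : M} (hx : z ∈ (chart x).source)
    (hy : z ∈ (chart y).source) :
    HasFDerivAt (chart y ∘ (chart x).symm) (coordChange x y z) (chart x z) :=
  ((contDiffAt_transition hx hy).differentiableAt (by simp)).hasFDerivAt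

theorem coordChange_coordChange {x y w z : M} (hx : z ∈ (chart x).source)
    (hy : z ∈ (chart y).source) (hw : z ∈ (chart w).source) (v : Tan x) :
    coordChange y w z (coordChange x y z v) = coordChange x w z v := by
  have h1 : HasFDerivAt ((chart w ∘ (chart y).symm) ∘ (chart y ∘ (chart x).symm))
      ((coordChange y w z).comp (coordChange x y z)) (chart x z) := by
    refine HasFDerivAt.comp _ ?_ (hasFDerivAt_transition hx hy)
    simpa [(chart x).left_inv hx] using hasFDerivAt_transition hy hw
  have h2 : (chart w ∘ (chart y).symm) ∘ (chart y ∘ (chart x).symm) =ᶠ[𝓝 (chart x z)]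
      chart w ∘ (chart x).symm := by
    have hc := (chart x).symm.continuousAt ((chart x).map_source hx)
    rw [ContinuousAt, (chart x).left_inv hx] at hc
    filter_upwards [hc (chart_source_mem_nhds hy)] with u hu
    simp [(chart y).left_inv (show (chart x).symm u ∈ _ from hu)]
  exact DFunLike.congr_fun
    ((h1.congr_of_eventuallyEq h2.symm).unique (hasFDerivAt_transition hx hw)) v

theorem coordChange_self {x z : M} (hx : z ∈ (chart x).source) (v : Tan x) :
    coordChange x x z v = v := by
  have h2 : chart x ∘ (chart x).symm =ᶠ[𝓝 (chart x z)] id := by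
    filter_upwards [(chart x).open_target.mem_nhds ((chart x).map_source hx)] with u hu
    exact (chart x).right_inv hu
  exact DFunLike.congr_fun
    ((hasFDerivAt_transition hx hx).unique ((hasFDerivAt_id _).congr_of_eventuallyEq h2)) v

theorem coordChange_cancel {x y z : M} (hx : z ∈ (chart x).source) (hy : z ∈ (chart y).source)
    (v : Tan x) : coordChange y x z (coordChange x y z v) = v := by
  rw [coordChange_coordChange hx hy hx, coordChange_self hx]

/-- The change of coordinates as a linear equivalence. -/
def coordEquiv {x y z : M} (hx : z ∈ (chart x).source) (hy : z ∈ (chart y).source) :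
    Tan x ≃ₗ[ℝ] Tan y where
  __ := (coordChange x y z).toLinearMap
  invFun := coordChange y x z
  left_inv := coordChange_cancel hx hy
  right_inv := coordChange_cancel hy hx

theorem coordEquiv_apply {x y z : M} (hx : z ∈ (chart x).source) (hy : z ∈ (chart y).source)
    (v : Tan x) : coordEquiv hx hy v = coordChange x y z v := rfl

theorem dim_eq_of_mem {x z : M} (hz : z ∈ (chart x).source) : dim z = dim x := by
  have := (coordEquiv (mem_chart_source z) hz).finrank_eq
  rwa [finrank_euclideanSpace_fin, finrank_euclideanSpace_fin] at this

theorem IsSmoothAt.contDiffAt_charts {f : M → N} {z x : M} {y : N} (hf : IsSmoothAt f z)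
    (hx : z ∈ (chart x).source) (hy : f z ∈ (chart y).source) :
    ContDiffAt ℝ ∞ (fun u => chart y (f ((chart x).symm u))) (chart x z) := by
  have h1 : SmoothPlot (chart x).symm univ (chart x z) z := by
    have hu := (chart x).map_source hx
    refine SmoothPlot.of_chart ((chart x).left_inv hx)
      ((chart x).symm.continuousAt hu).continuousWithinAt hx ?_
    refine contDiffWithinAt_id.congr_of_eventuallyEq ?_ ((chart x).right_inv hu)
    rw [nhdsWithin_univ]
    filter_upwards [(chart x).open_target.mem_nhds hu] with u hu
    exact (chart x).right_inv hu
  exact ((hf.comp_plot h1).contDiffWithinAt_chart hy).contDiffAt univ_mem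

/-- The derivative of a map read in charts. -/
theorem IsSmoothAt.fderiv_charts {f : M → N} {z x : M} {y : N} (hf : IsSmoothAt f z)
    (hx : z ∈ (chart x).source) (hy : f z ∈ (chart y).source) (v : Tan z) :
    fderiv ℝ (fun u => chart y (f ((chart x).symm u))) (chart x z) (coordChange z x z v) =
      coordChange (f z) y (f z) (tmap f z v) := by
  obtain ⟨γ, hγ⟩ := exists_hasVel z v
  have h1 := (hγ.map hf rfl).coord hy
  have h2 := hγ.coord hx
  have h3 : HasDerivAt (fun t => chart y (f ((chart x).symm (chart x (γ t)))))
      (fderiv ℝ (fun u => chart y (f ((chart x).symm u))) (chart x z) (coordChange z x z v))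
      0 := by
    refine HasFDerivAt.comp_hasDerivAt (l := fun u => chart y (f ((chart x).symm u))) 0 ?_ h2
    rw [hγ.1]
    exact ((hf.contDiffAt_charts hx hy).differentiableAt (by simp)).hasFDerivAt
  refine (h3.congr_of_eventuallyEq ?_).unique h1
  filter_upwards [hγ.eventually_mem (chart_source_mem_nhds hx)] with t ht
  rw [(chart x).left_inv ht]

/-- A smooth family of surjective linear maps has a smooth family of right inverses. -/
theorem exists_smooth_rightInverse {Z E F : Type*} [NormedAddCommGroup Z] [NormedSpace ℝ Z]
    [NormedAddCommGroup E] [NormedSpace ℝ E]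
    [NormedAddCommGroup F] [NormedSpace ℝ F] [FiniteDimensional ℝ F] [CompleteSpace F]
    {D : Z → E →L[ℝ] F} {z₀ : Z} (hD : ContDiffAt ℝ ∞ D z₀) (hs : Function.Surjective (D z₀)) :
    ∃ N : Z → F →L[ℝ] E, ContDiffAt ℝ ∞ N z₀ ∧ ∀ᶠ z in 𝓝 z₀, ∀ w, D z (N z w) = w := by
  obtain ⟨R, hR⟩ := ContinuousLinearMap.exists_rightInverse_of_surjective (D z₀)
    (LinearMap.range_eq_top.2 hs)
  have h0 : (D z₀).comp R = ((1 : (F →L[ℝ] F)ˣ) : F →L[ℝ] F) := hR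
  have hDR : ContDiffAt ℝ ∞ (fun z => (D z).comp R) z₀ := hD.clm_comp contDiffAt_const
  -- With `R` a right inverse at `z₀`, the map `D z ∘ R` is the identity at `z₀`, hence invertible
  -- nearby, and inversion is smooth at a unit.
  refine ⟨fun z => R.comp (Ring.inverse ((D z).comp R)), contDiffAt_const.clm_comp ?_, ?_⟩
  · have : ContDiffAt ℝ ∞ Ring.inverse ((D z₀).comp R) := by
      rw [h0]
      exact contDiffAt_ringInverse ℝ 1
    exact this.comp z₀ hDR
  · have h1 : ∀ᶠ z in 𝓝 z₀, IsUnit ((D z).comp R) := by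
      refine hDR.continuousAt.eventually (p := fun T => IsUnit T) ?_
      simp only [h0]
      exact Units.nhds 1
    filter_upwards [h1] with z hz w
    exact DFunLike.congr_fun (Ring.mul_inverse_cancel _ hz) w

/-- Smooth lifts of tangent vectors along a submersion, and smooth projections to the kernel of
its differential, read in charts. -/
theorem exists_smooth_lift {f : M → N} (hf : IsSubmersion f) {x : M} {y : N} (hy : f x = y) :
    ∃ (L : Tan x → Tan y →L[ℝ] Tan x) (H : Tan x → Tan x →L[ℝ] Tan x),
      ContDiffAt ℝ ∞ L (chart x x) ∧ ContDiffAt ℝ ∞ H (chart x x) ∧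
      (∀ w, tmap f x w = 0 → H (chart x x) w = w) ∧
      ∀ᶠ z in 𝓝 x,
        (∀ w, tmap f z (coordChange x z z (L (chart x z) w)) = coordChange y (f z) (f z) w) ∧
        ∀ w, tmap f z (coordChange x z z (H (chart x z) w)) = 0 := by
  subst hy
  let D : Tan x → Tan x →L[ℝ] Tan (f x) :=
    fderiv ℝ (fun u => chart (f x) (f ((chart x).symm u)))
  have hD : ContDiffAt ℝ ∞ D (chart x x) :=
    ((hf.1 x).contDiffAt_charts (mem_chart_source x) (mem_chart_source (f x))).fderiv_right
      (by simp)
  obtain ⟨L, hL, hDL⟩ := exists_smooth_rightInverse hD (hf.2 x)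
  -- `id - L D` takes values in the kernel of `D` because `D L = id`, and fixes that kernel.
  refine ⟨L, fun u => .id ℝ _ - (L u).comp (D u), hL,
    contDiffAt_const.sub (hL.clm_comp hD), fun w hw => ?_, ?_⟩
  · have : D (chart x x) w = 0 := hw
    simp [this]
  · have h1 := ((chart x).continuousAt (mem_chart_source x)).eventually hDL
    filter_upwards [h1, chart_source_mem_nhds (mem_chart_source x),
      (hf.1 x).1 (chart_source_mem_nhds (mem_chart_source (f x)))] with z h1 hz hfz
    have key : ∀ w : Tan x, tmap f z (coordChange x z z w) =
        coordChange (f x) (f z) (f z) (D (chart x z) w) := fun w => by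
      have h2 := (hf.1 z).fderiv_charts hz hfz (coordChange x z z w)
      rw [coordChange_cancel hz (mem_chart_source z)] at h2
      rw [show D (chart x z) w = _ from h2, coordChange_cancel (mem_chart_source _) hfz]
    refine ⟨fun w => by rw [key, h1], fun w => ?_⟩
    rw [key]
    simp [h1]

end CoordChange
end LieGpd
end

open scoped ContDiff Topology TensorProduct

noncomputable section

namespace LieGpd

open Set Filter

/-! ### Smooth dependence of the infinitesimal action on the point -/

namespace Bibundle

variable {G' G'₀ G'' G''₀ : Type*}
  [TopologicalSpace G'] [MixedManifold G'] [TopologicalSpace G'₀] [MixedManifold G'₀]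
  [TopologicalSpace G''] [MixedManifold G''] [TopologicalSpace G''₀] [MixedManifold G''₀]
  {Γ' : LieGroupoid G' G'₀} {Γ'' : LieGroupoid G'' G''₀}
  {B : Type*} [TopologicalSpace B] [MixedManifold B] (𝓑 : Bibundle Γ' Γ'' B)

/-- The infinitesimal left action, read in charts, depends smoothly on the point. -/
theorem exists_smooth_lgen (b₀ : B) :
    ∃ U : Tan b₀ → Tan (Γ'.unit (𝓑.p b₀)) →L[ℝ] Tan b₀, ContDiffAt ℝ ∞ U (chart b₀ b₀) ∧
      ∀ᶠ b in 𝓝 b₀, ∀ a : Γ'.A (𝓑.p b), coordChange b b₀ b (𝓑.lgen b (𝓑.p b) a) =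
        U (chart b₀ b) (coordChange (Γ'.unit (𝓑.p b)) (Γ'.unit (𝓑.p b₀)) (Γ'.unit (𝓑.p b)) a) := by
  set x₀ := 𝓑.p b₀ with hx₀
  set u₀ := Γ'.unit x₀ with hu₀
  obtain ⟨Λ, hΛ, hΛr, hΛs⟩ := exists_lift (Γ'.r_submersion.1 u₀) (Γ'.r_unit x₀)
    (Γ'.r_submersion.surjective_tmapTo (Γ'.r_unit x₀))
  have hB := SmoothPlot.chart_symm b₀
  have hp := (𝓑.smooth_p b₀).comp_plot hB
  have hb₀ : (chart b₀).symm (chart b₀ b₀) = b₀ := (chart b₀).left_inv (mem_chart_source b₀)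
  -- the action, extended smoothly to a neighbourhood in the product
  let m : Tan u₀ × Tan b₀ → Tan u₀ × Tan x₀ :=
    fun z => (z.1, chart x₀ (𝓑.p ((chart b₀).symm z.2)))
  have hm0 : m (chart u₀ u₀, chart b₀ b₀) = (chart u₀ u₀, chart x₀ x₀) := by
    simp only [m, hb₀]
    rfl
  have hm : ContDiffAt ℝ ∞ m (chart u₀ u₀, chart b₀ b₀) :=
    contDiffAt_fst.prodMk (ContDiffAt.snd' (f := fun u => chart x₀ (𝓑.p ((chart b₀).symm u)))
      (hp.2.2.contDiffAt univ_mem))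
  have hΛm : SmoothPlot (fun z => Λ (m z)) univ (chart u₀ u₀, chart b₀ b₀) u₀ :=
    hΛ.comp_univ hm0 hm.contDiffWithinAt
  have hB2 : SmoothPlot (fun z : Tan u₀ × Tan b₀ => (chart b₀).symm z.2) univ
      (chart u₀ u₀, chart b₀ b₀) b₀ := hB.comp_univ rfl contDiffWithinAt_snd
  have hmem : ∀ᶠ z in 𝓝 (chart u₀ u₀, chart b₀ b₀),
      Γ'.r (Λ (m z)) = 𝓑.p ((chart b₀).symm z.2) := by
    have h1 := hm.continuousAt.eventually (by rw [hm0]; exact hΛr)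
    have h2 := ((𝓑.smooth_p b₀).comp_plot hB2).eventually_mem
      (chart_source_mem_nhds (mem_chart_source x₀))
    rw [nhdsWithin_univ] at h2
    filter_upwards [h1, h2] with z h1 h2
    rw [h1]
    exact (chart x₀).left_inv h2
  have hact := 𝓑.smooth_lact.comp_plot hΛm hB2 (Γ'.r_unit x₀) (by rwa [nhdsWithin_univ])
  rw [show 𝓑.lact u₀ b₀ = b₀ from 𝓑.unit_lact b₀] at hact
  let F : Tan u₀ × Tan b₀ → Tan b₀ :=
    fun z => chart b₀ (𝓑.lact (Λ (m z)) ((chart b₀).symm z.2))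
  have hF : ContDiffAt ℝ ∞ F (chart u₀ u₀, chart b₀ b₀) := hact.2.2.contDiffAt univ_mem
  -- the unit at `p b`
  let ε : Tan b₀ → Tan u₀ := fun u => chart u₀ (Γ'.unit (𝓑.p ((chart b₀).symm u)))
  have hε0 : ε (chart b₀ b₀) = chart u₀ u₀ := by
    simp only [ε, hb₀]
    rfl
  have hε : ContDiffAt ℝ ∞ ε (chart b₀ b₀) :=
    ((Γ'.smooth_unit x₀).comp_plot hp).2.2.contDiffAt univ_mem
  have hεid : ContDiffAt ℝ ∞ (fun u => (ε u, u)) (chart b₀ b₀) := hε.prodMk contDiffAt_id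
  have hεid0 : (ε (chart b₀ b₀), chart b₀ b₀) = (chart u₀ u₀, chart b₀ b₀) := by rw [hε0]
  have hcb : ContinuousAt (fun b => chart b₀ b) b₀ := (chart b₀).continuousAt (mem_chart_source b₀)
  -- `U` is the partial derivative of the extended action in the arrow variable, taken at the unit
  -- over `p b`.
  refine ⟨fun u => (fderiv ℝ F (ε u, u)).comp (.inl ℝ _ _), ?_, ?_⟩
  · refine ContDiffAt.clm_comp ?_ contDiffAt_const
    refine ContDiffAt.comp (g := fderiv ℝ F) (f := fun u => (ε u, u)) _ ?_ hεid
    rw [hεid0]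
    exact hF.fderiv_right (by simp)
  · have h1 : ∀ᶠ b in 𝓝 b₀, DifferentiableAt ℝ F (ε (chart b₀ b), chart b₀ b) := by
      have h2 : ∀ᶠ z in 𝓝 (chart u₀ u₀, chart b₀ b₀), DifferentiableAt ℝ F z := by
        filter_upwards [(hF.of_le (m := 1) (by simp)).eventually (by simp)] with z hz
        exact hz.differentiableAt (by simp)
      rw [← hεid0] at h2
      exact hcb.eventually (hεid.continuousAt.eventually h2)
    -- Near the unit over each nearby `p b`, the retraction `Λ` fixes arrows already in the right
    -- `r`-fibre. So the extension agrees with the action along the curves which define `lgen`.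
    have h3 : ∀ᶠ b in 𝓝 b₀, ∀ᶠ u in 𝓝 (ε (chart b₀ b)),
        Λ (u, chart x₀ (Γ'.r ((chart u₀).symm u))) = (chart u₀).symm u := by
      have := eventually_eventually_nhds.2 hΛs
      rw [← hε0] at this
      exact hcb.eventually (hε.continuousAt.eventually this)
    have h4 : ∀ᶠ b in 𝓝 b₀, Γ'.unit (𝓑.p b) ∈ (chart u₀).source :=
      ((Γ'.smooth_unit x₀).1.comp (f := 𝓑.p) (𝓑.smooth_p b₀).1)
        (chart_source_mem_nhds (mem_chart_source u₀))
    filter_upwards [h1, h3, h4, chart_source_mem_nhds (mem_chart_source b₀)]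
      with b h1 h3 h4 hb a
    have hbb : (chart b₀).symm (chart b₀ b) = b := (chart b₀).left_inv hb
    have hεb : ε (chart b₀ b) = chart u₀ (Γ'.unit (𝓑.p b)) := by simp only [ε, hbb]
    obtain ⟨γ, hγ, hr⟩ := Γ'.exists_hasVel_A a
    have h5 := (𝓑.hasVel_lgen rfl hγ hr).coord hb
    have h6 := hγ.coord h4
    have h7 : HasDerivAt (fun t => F (chart u₀ (γ t), chart b₀ b))
        (fderiv ℝ F (ε (chart b₀ b), chart b₀ b)
          (coordChange (Γ'.unit (𝓑.p b)) u₀ (Γ'.unit (𝓑.p b)) a, 0)) 0 := by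
      refine HasFDerivAt.comp_hasDerivAt (l := F) 0 ?_ (h6.prodMk (hasDerivAt_const _ _))
      rw [hγ.1, ← hεb]
      exact h1.hasFDerivAt
    refine h5.unique (h7.congr_of_eventuallyEq ?_)
    have h8 : ∀ᶠ t in 𝓝 0, Λ (chart u₀ (γ t), chart x₀ (Γ'.r ((chart u₀).symm
        (chart u₀ (γ t))))) = (chart u₀).symm (chart u₀ (γ t)) := by
      refine h6.continuousAt.eventually (p := fun u =>
        Λ (u, chart x₀ (Γ'.r ((chart u₀).symm u))) = (chart u₀).symm u) ?_
      simp only [hγ.1]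
      rwa [← hεb]
    filter_upwards [hr, h8, hγ.eventually_mem (chart_source_mem_nhds h4)] with t h9 h10 h11
    rw [(chart u₀).left_inv h11, h9] at h10
    simp only [F, m, hbb, h10]

end Bibundle
end LieGpd
end

open scoped ContDiff Topology TensorProduct

noncomputable section

namespace LieGpd

open Set Filter ExteriorAlgebra

/-! ### Smooth wedges, local frames and components of sections -/

section Smoothness

variable {Z E : Type*} [NormedAddCommGroup Z] [NormedSpace ℝ Z]

theorem contDiffAt_det {n : ℕ} {A : Z → Matrix (Fin n) (Fin n) ℝ} {z : Z}
    (h : ∀ i j, ContDiffAt ℝ ∞ (fun u => A u i j) z) : ContDiffAt ℝ ∞ (fun u => (A u).det) z := by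
  simp only [Matrix.det_apply']
  refine ContDiffAt.sum fun σ _ => ?_
  refine ContDiffAt.mul contDiffAt_const ?_
  exact contDiffAt_prod fun i _ => h _ _

variable [NormedAddCommGroup E] [NormedSpace ℝ E] [FiniteDimensional ℝ E]

/-- Smoothness is tested through a linear form, so the exterior algebra needs no norm. Expanding the
first factor in a fixed basis replaces the form by its composite with left multiplication by a basis
vector, hence the induction generalizes over `φ`. -/
theorem contDiffAt_ι_prod {z : Z} (l : List (Z → E)) (hl : ∀ f ∈ l, ContDiffAt ℝ ∞ f z)
    (φ : ExteriorAlgebra ℝ E →ₗ[ℝ] ℝ) :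
    ContDiffAt ℝ ∞ (fun u => φ (l.map fun f => ι ℝ (f u)).prod) z := by
  induction l generalizing φ with
  | nil => exact contDiffAt_const (c := φ 1)
  | cons f l ih =>
    let b := Module.finBasis ℝ E
    have h1 : ∀ u, φ (((f :: l).map fun f => ι ℝ (f u)).prod) =
        ∑ i, b.repr (f u) i *
          (φ ∘ₗ LinearMap.mulLeft ℝ (ι ℝ (b i))) (l.map fun f => ι ℝ (f u)).prod := fun u => by
      rw [List.map_cons, List.prod_cons]
      conv_lhs => rw [← b.sum_repr (f u)]
      simp only [map_sum, map_smul, Finset.sum_mul, smul_mul_assoc, smul_eq_mul]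
      rfl
    simp only [h1]
    refine ContDiffAt.sum fun i _ => ContDiffAt.mul ?_ (ih (fun g hg => hl g (by simp [hg])) _)
    exact (LinearMap.toContinuousLinearMap (b.coord i)).contDiff.contDiffAt.comp z (hl f (by simp))

theorem contDiffAt_wedge {z : Z} {k n : ℕ} {a : Fin k → Z → E} {b : Fin n → Z → E}
    (ha : ∀ i, ContDiffAt ℝ ∞ (a i) z) (hb : ∀ i, ContDiffAt ℝ ∞ (b i) z)
    (φ : ExteriorAlgebra ℝ E →ₗ[ℝ] ℝ) :
    ContDiffAt ℝ ∞
      (fun u => φ (ιMulti ℝ k (fun i => a i u) * ιMulti ℝ n (fun i => b i u))) z := by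
  have := contDiffAt_ι_prod (z := z) (List.ofFn a ++ List.ofFn b) (by
    intro f hf
    rw [List.mem_append, List.mem_ofFn, List.mem_ofFn] at hf
    rcases hf with ⟨i, rfl⟩ | ⟨i, rfl⟩
    exacts [ha i, hb i]) φ
  simpa only [List.map_append, List.prod_append, List.map_ofFn, ιMulti_apply,
    Function.comp_def] using this

end Smoothness

/-- Ranks and dimensions at neighbouring points agree only propositionally; this lemma and
`det_comp_cast` remove the resulting casts. -/
theorem ιMulti_comp_cast {V : Type*} [AddCommGroup V] [Module ℝ V] {m n : ℕ} (h : m = n)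
    (a : Fin n → V) : ιMulti ℝ m (fun i => a (Fin.cast h i)) = ιMulti ℝ n a := by
  subst h
  rfl

theorem det_comp_cast {m n : ℕ} (h : m = n) (A : Matrix (Fin n) (Fin n) ℝ) :
    Matrix.det (.of fun i j => A (Fin.cast h i) (Fin.cast h j)) = A.det := by
  subst h
  rfl

/-- The basis of the tangent space at `x` which is constant in the chart at `x₀`. -/
def chartBasis {M : Type*} [TopologicalSpace M] [MixedManifold M] {x₀ x : M}
    (hx : x ∈ (chart x₀).source) : Module.Basis (Fin (dim x)) ℝ (Tan x) :=
  ((stdBasis x₀).map (coordEquiv hx (mem_chart_source x))).reindex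
    (finCongr (dim_eq_of_mem hx).symm)

theorem chartBasis_apply {M : Type*} [TopologicalSpace M] [MixedManifold M] {x₀ x : M}
    (hx : x ∈ (chart x₀).source) (j : Fin (dim x)) :
    chartBasis hx j = coordChange x₀ x x (stdBasis x₀ (Fin.cast (dim_eq_of_mem hx) j)) := by
  simp [chartBasis, coordEquiv_apply]

namespace LieGroupoid

variable {G G₀ : Type*} [TopologicalSpace G] [MixedManifold G] [TopologicalSpace G₀]
  [MixedManifold G₀] (Γ : LieGroupoid G G₀)

theorem rank_add_dim (x : G₀) : Γ.rank x + dim x = dim (Γ.unit x) := by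
  have h1 := (tmapTo Γ.r (Γ.unit x) x).toLinearMap.finrank_range_add_finrank_ker
  rw [LinearMap.range_eq_top.2 (Γ.r_submersion.surjective_tmapTo (Γ.r_unit x)), finrank_top,
    finrank_euclideanSpace_fin, finrank_euclideanSpace_fin, add_comm] at h1
  have h2 : Γ.A x = LinearMap.ker (tmapTo Γ.r (Γ.unit x) x).toLinearMap := by
    ext w
    exact (tmapTo_eq_zero_iff (Γ.r_unit x)).symm
  rw [← h1]
  unfold rank
  rw [h2]

/-- A smooth local frame of the Lie algebroid, read in the chart at the unit. -/
theorem exists_frame (x₀ : G₀) :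
    ∃ (e : Fin (Γ.rank x₀) → Tan x₀ → Tan (Γ.unit x₀))
      (β : Fin (Γ.rank x₀) → Module.Dual ℝ (Tan (Γ.unit x₀))),
      (∀ i, ContDiffAt ℝ ∞ (e i) (chart x₀ x₀)) ∧
      ∀ᶠ x in 𝓝 x₀, Matrix.det (.of fun i j => β j (e i (chart x₀ x))) ≠ 0 ∧
        ∃ (hk : Γ.rank x = Γ.rank x₀) (b : Module.Basis (Fin (Γ.rank x)) ℝ (Γ.A x)),
          ∀ i, coordChange (Γ.unit x) (Γ.unit x₀) (Γ.unit x) (b i) =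
            e (Fin.cast hk i) (chart x₀ x) := by
  set u₀ := Γ.unit x₀ with hu₀
  obtain ⟨L, H, -, hH, hH0, hev⟩ := exists_smooth_lift Γ.r_submersion (Γ.r_unit x₀)
  let ε := Module.finBasis ℝ (Γ.A x₀)
  let υ : Tan x₀ → Tan u₀ := fun u => chart u₀ (Γ.unit ((chart x₀).symm u))
  have hx₀ : (chart x₀).symm (chart x₀ x₀) = x₀ := (chart x₀).left_inv (mem_chart_source x₀)
  have hυ0 : υ (chart x₀ x₀) = chart u₀ u₀ := by
    simp only [υ, hx₀]
    rfl
  have hυ : ContDiffAt ℝ ∞ υ (chart x₀ x₀) := (Γ.smooth_unit x₀).2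
  -- A basis of the fibre at `x₀` is kept constant in the chart and projected to the kernel of `dr`
  -- at the nearby units. The covectors `β` extend the dual basis, so the determinant is 1 at `x₀`
  -- and nonzero nearby, which keeps the frame independent.
  let e : Fin (Γ.rank x₀) → Tan x₀ → Tan u₀ := fun i u => H (υ u) (ε i)
  have he : ∀ i, ContDiffAt ℝ ∞ (e i) (chart x₀ x₀) := fun i => by
    refine ContDiffAt.clm_apply (ContDiffAt.comp _ ?_ hυ) contDiffAt_const
    rwa [hυ0]
  have he0 : ∀ i, e i (chart x₀ x₀) = ε i := fun i => by
    simp only [e, hυ0]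
    exact hH0 _ (ε i).2
  obtain ⟨pr, hpr⟩ := (Γ.A x₀).subtype.exists_leftInverse_of_injective (Submodule.ker_subtype _)
  have hpr' : ∀ a : Γ.A x₀, pr a = a := fun a => LinearMap.congr_fun hpr a
  let β : Fin (Γ.rank x₀) → Module.Dual ℝ (Tan u₀) := fun i => ε.coord i ∘ₗ pr
  have hdet : ContDiffAt ℝ ∞
      (fun u => Matrix.det (.of fun i j => β j (e i u))) (chart x₀ x₀) :=
    contDiffAt_det fun i j =>
      (LinearMap.toContinuousLinearMap (β j)).contDiff.contDiffAt.comp _ (he i)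
  have hdet0 : Matrix.det (.of fun i j => β j (e i (chart x₀ x₀))) ≠ 0 := by
    have : (Matrix.of fun i j => β j (e i (chart x₀ x₀))) = 1 := by
      ext i j
      simp [β, he0, hpr', Matrix.one_apply, Finsupp.single_apply]
    rw [this, Matrix.det_one]
    exact one_ne_zero
  refine ⟨e, β, he, ?_⟩
  have hcx : ContinuousAt (fun x => chart x₀ x) x₀ := (chart x₀).continuousAt (mem_chart_source x₀)
  have h1 : ∀ᶠ x in 𝓝 x₀, Matrix.det (.of fun i j => β j (e i (chart x₀ x))) ≠ 0 :=
    hcx.eventually (hdet.continuousAt.eventually_ne hdet0)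
  have h2 : ∀ᶠ x in 𝓝 x₀, Γ.unit x ∈ (chart u₀).source :=
    (Γ.smooth_unit x₀).1 (chart_source_mem_nhds (mem_chart_source u₀))
  filter_upwards [h1, h2, chart_source_mem_nhds (mem_chart_source x₀),
    (Γ.smooth_unit x₀).1.eventually hev] with x h1 h2 hx h3
  have hυx : υ (chart x₀ x) = chart u₀ (Γ.unit x) := by
    simp only [υ, (chart x₀).left_inv hx]
  -- The rank is the difference of the dimensions of G at the unit and of G₀, and both are locally
  -- constant.
  have hk : Γ.rank x = Γ.rank x₀ := by
    have a1 := Γ.rank_add_dim x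
    have a2 := Γ.rank_add_dim x₀
    have a3 : dim x = dim x₀ := dim_eq_of_mem hx
    have a4 : dim (Γ.unit x) = dim (Γ.unit x₀) := dim_eq_of_mem h2
    omega
  let a : Fin (Γ.rank x₀) → Γ.A x := fun i =>
    ⟨coordChange u₀ (Γ.unit x) (Γ.unit x) (e i (chart x₀ x)), by
      have := h3.2 (ε i)
      rw [← hυx] at this
      exact this⟩
  have ha : ∀ i, coordChange (Γ.unit x) u₀ (Γ.unit x) (a i) = e i (chart x₀ x) := fun i =>
    coordChange_cancel h2 (mem_chart_source _) _
  have hli : LinearIndependent ℝ a := by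
    let T : Γ.A x →ₗ[ℝ] Fin (Γ.rank x₀) → ℝ :=
      LinearMap.pi fun j => β j ∘ₗ (coordChange (Γ.unit x) u₀ (Γ.unit x)).toLinearMap ∘ₗ
        (Γ.A x).subtype
    refine LinearIndependent.of_comp T ?_
    have hrow : T ∘ a = fun i => Matrix.of (fun i j => β j (e i (chart x₀ x))) i := by
      funext i j
      exact congrArg (β j) (ha i)
    rw [hrow]
    exact Matrix.linearIndependent_rows_of_det_ne_zero h1
  refine ⟨h1, hk, (Module.Basis.mk hli (hli.span_eq_top_of_card_eq_finrank'
    (by simp [hk])).ge).reindex (finCongr hk.symm), fun i => ?_⟩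
  simpa using ha (Fin.cast hk i)

/-- The component functions of a section in terms of the coefficient in a frame. -/
theorem component_eq {x₀ x : G₀} (hx : x ∈ (chart x₀).source) (hk : Γ.rank x = Γ.rank x₀)
    (b : Module.Basis (Fin (Γ.rank x)) ℝ (Γ.A x)) {e : Fin (Γ.rank x₀) → Tan (Γ.unit x₀)}
    (hb : ∀ i, coordChange (Γ.unit x) (Γ.unit x₀) (Γ.unit x) (b i) = e (Fin.cast hk i))
    (s : ∀ x, Γ.Q x) (β : ℕ → Module.Dual ℝ (Tan (Γ.unit x₀))) (w : ℕ → Tan x₀) :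
    Γ.component s x₀ β w x = Γ.coeff x b (chartBasis hx) (s x) *
      (Matrix.det (.of fun i j : Fin (Γ.rank x₀) => β j (e i)) *
        (stdBasis x₀).det (fun j => w j)) := by
  unfold component
  rw [evalQ_eq b (chartBasis hx)]
  congr 2
  · rw [← det_comp_cast hk]
    congr 1
    ext i j
    simp [← hb]
  · rw [Module.Basis.det_apply, Module.Basis.det_apply, ← det_comp_cast (dim_eq_of_mem hx)]
    congr 1
    ext i j
    have : coordChange x x₀ x (coordChange x₀ x x (w j)) = w j :=
      coordChange_cancel hx (mem_chart_source x) _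
    simp [Module.Basis.toMatrix_apply, chartBasis, coordEquiv, this]

end LieGroupoid
end LieGpd
end

/-! ### Smoothness of the corresponding section -/

open scoped ContDiff Topology TensorProduct

noncomputable section

namespace LieGpd

open Set Filter ExteriorAlgebra

/-- A linear form on the exterior algebra which does not vanish on the top exterior power. -/
theorem exists_top_functional (W : Type*) [AddCommGroup W] [Module ℝ W] [Module.Finite ℝ W] :
    ∃ φ : ExteriorAlgebra ℝ W →ₗ[ℝ] ℝ, ∀ {k n : ℕ} {a : Fin k → W} {b : Fin n → W},
      k + n = Module.finrank ℝ W → ιMulti ℝ k a * ιMulti ℝ n b ≠ 0 →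
        φ (ιMulti ℝ k a * ιMulti ℝ n b) ≠ 0 := by
  have h0 := ιMulti_basis_ne_zero (Module.finBasis ℝ W)
  obtain ⟨φ, hφ⟩ := Module.Projective.exists_dual_ne_zero ℝ h0
  refine ⟨φ, fun {k n a b} hkn h hz => ?_⟩
  have key : ∀ {m : ℕ} (_ : m = Module.finrank ℝ W) (x : Fin m → W), ∃ c : ℝ,
      ιMulti ℝ m x = c • ιMulti ℝ _ (Module.finBasis ℝ W) := by
    rintro _ rfl x
    exact ⟨_, ιMulti_eq_det_smul (ιMulti ℝ _) (Module.finBasis ℝ W) x⟩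
  rw [ιMulti_mul_ιMulti] at h hz
  obtain ⟨c, hc⟩ := key hkn (Fin.append a b)
  rw [hc, map_smul, smul_eq_mul, mul_eq_zero, or_iff_left hφ] at hz
  exact h (by rw [hc, hz, zero_smul])

namespace Bibundle

variable {G' G'₀ G'' G''₀ : Type*}
  [TopologicalSpace G'] [MixedManifold G'] [TopologicalSpace G'₀] [MixedManifold G'₀]
  [TopologicalSpace G''] [MixedManifold G''] [TopologicalSpace G''₀] [MixedManifold G''₀]
  {Γ' : LieGroupoid G' G'₀} {Γ'' : LieGroupoid G'' G''₀}
  {B : Type*} [TopologicalSpace B] [MixedManifold B] {𝓑 : Bibundle Γ' Γ'' B}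

/-- Half of the data which express the correspondence near `b₀`: the elements `⋀ u(e') ∧ ⋀ t''`
of the top exterior power depend smoothly on the point. -/
theorem IsInvertible.exists_smooth_wedge (h : 𝓑.IsInvertible) (b₀ : B)
    (φ : ExteriorAlgebra ℝ (Tan b₀) →ₗ[ℝ] ℝ) {k : ℕ}
    {e : Fin k → Tan (𝓑.p b₀) → Tan (Γ'.unit (𝓑.p b₀))}
    (he : ∀ i, ContDiffAt ℝ ∞ (e i) (chart (𝓑.p b₀) (𝓑.p b₀))) :
    ∃ X : Tan b₀ → ℝ, ContDiffAt ℝ ∞ X (chart b₀ b₀) ∧ ∀ᶠ b in 𝓝 b₀,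
      ∀ (hk : Γ'.rank (𝓑.p b) = k) (hy : 𝓑.q b ∈ (chart (𝓑.q b₀)).source)
        (a : Fin (Γ'.rank (𝓑.p b)) → Γ'.A (𝓑.p b)),
        (∀ i, coordChange (Γ'.unit (𝓑.p b)) (Γ'.unit (𝓑.p b₀)) (Γ'.unit (𝓑.p b)) (a i) =
          e (Fin.cast hk i) (chart (𝓑.p b₀) (𝓑.p b))) →
        ∃ t'' : Fin (dim (𝓑.q b)) → Tan b, (∀ j, tmap 𝓑.q b (t'' j) = chartBasis hy j) ∧
          φ (map (coordChange b b₀ b).toLinearMap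
            (ιMulti ℝ _ (fun i => 𝓑.lgen b (𝓑.p b) (a i)) * ιMulti ℝ _ t'')) =
              X (chart b₀ b) := by
  obtain ⟨U, hU, hUb⟩ := 𝓑.exists_smooth_lgen b₀
  obtain ⟨L, H, hL, -, -, hev⟩ := exists_smooth_lift h.q_submersion (x := b₀) rfl
  let f : Tan b₀ → Tan (𝓑.p b₀) := fun u => chart (𝓑.p b₀) (𝓑.p ((chart b₀).symm u))
  have hf : ContDiffAt ℝ ∞ f (chart b₀ b₀) := (𝓑.smooth_p b₀).2
  have hf0 : f (chart b₀ b₀) = chart (𝓑.p b₀) (𝓑.p b₀) := by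
    simp only [f, (chart b₀).left_inv (mem_chart_source b₀)]
  refine ⟨fun u => φ (ιMulti ℝ _ (fun i => U u (e i (f u))) *
    ιMulti ℝ _ (fun j => L u (stdBasis (𝓑.q b₀) j))), ?_, ?_⟩
  · refine contDiffAt_wedge (fun i => ?_) (fun j => hL.clm_apply contDiffAt_const) φ
    refine hU.clm_apply (ContDiffAt.comp _ ?_ hf)
    rw [hf0]
    exact he i
  · filter_upwards [hUb, hev, chart_source_mem_nhds (mem_chart_source b₀)]
      with b h1 h2 hb hk hy a ha
    have hfb : f (chart b₀ b) = chart (𝓑.p b₀) (𝓑.p b) := by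
      simp only [f, (chart b₀).left_inv hb]
    -- The lifts are the smooth lifts along `q` of vectors constant in the chart at `q b₀`. Read in
    -- the chart at `b₀`, all factors of the wedge are then smooth in the point.
    refine ⟨fun j => coordChange b₀ b b (L (chart b₀ b)
      (stdBasis (𝓑.q b₀) (Fin.cast (dim_eq_of_mem hy) j))), fun j => ?_, ?_⟩
    · rw [h2.1, chartBasis_apply]
    · rw [map_ιMulti_mul_ιMulti]
      congr 2
      · rw [← ιMulti_comp_cast hk]
        congr 1
        funext i
        change coordChange b b₀ b _ = _
        rw [h1, ha, hfb]
      · rw [← ιMulti_comp_cast (dim_eq_of_mem hy)]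
        congr 1
        funext j
        exact coordChange_cancel hb (mem_chart_source b) _

/-- The section which corresponds to a smooth section is smooth. -/
theorem IsInvertible.isSmoothSection (h : 𝓑.IsInvertible) {s : ∀ x, Γ'.Q x} {t : ∀ y, Γ''.Q y}
    (hs : Γ'.IsSmoothSection s) (hst : ∀ b, 𝓑.Corresponds b (s (𝓑.p b)) (t (𝓑.q b))) :
    Γ''.IsSmoothSection t := by
  intro y₀ β w
  obtain ⟨b₀, rfl⟩ := h.q_surjective y₀
  obtain ⟨e', β', he', hev'⟩ := Γ'.exists_frame (𝓑.p b₀)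
  obtain ⟨e'', β'', he'', hev''⟩ := Γ''.exists_frame (𝓑.q b₀)
  obtain ⟨φ, hφ⟩ := exists_top_functional (Tan b₀)
  obtain ⟨X, hX, hXb⟩ := h.exists_smooth_wedge b₀ φ he'
  -- For the opposite bibundle the same lemma treats the other wedge, `⋀ v(e'') ∧ ⋀ t'`.
  obtain ⟨Y, hY, hYb⟩ := h.op.exists_smooth_wedge b₀ φ he''
  have hb₀ : (chart b₀).symm (chart b₀ b₀) = b₀ := (chart b₀).left_inv (mem_chart_source b₀)
  have hpc : ContinuousAt 𝓑.p b₀ := (𝓑.smooth_p b₀).1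
  have hqc : ContinuousAt 𝓑.q b₀ := (𝓑.smooth_q b₀).1
  -- the denominators do not vanish
  have hY0 : Y (chart b₀ b₀) ≠ 0 := by
    obtain ⟨-, hk, a, ha⟩ := hev''.self_of_nhds
    obtain ⟨t', ht', hYt⟩ := hYb.self_of_nhds hk (mem_chart_source (𝓑.p b₀)) a ha
    rw [← hYt, map_ιMulti_mul_ιMulti]
    have hex := h.isShortExact_rgen (b := b₀) rfl rfl
    refine hφ (hex.card_add_card a (chartBasis (mem_chart_source (𝓑.p b₀)))) ?_
    have := hex.wedge_mul_wedge_ne_zero a (chartBasis (mem_chart_source (𝓑.p b₀))) ht'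
    have e1 : ∀ v : Tan b₀, (coordChange b₀ b₀ b₀).toLinearMap v = v :=
      fun v => coordChange_self (mem_chart_source b₀) v
    simp only [e1]
    exact this
  let f' : Tan b₀ → Tan (𝓑.p b₀) := fun u => chart (𝓑.p b₀) (𝓑.p ((chart b₀).symm u))
  let f'' : Tan b₀ → Tan (𝓑.q b₀) := fun u => chart (𝓑.q b₀) (𝓑.q ((chart b₀).symm u))
  have hf' : ContDiffAt ℝ ∞ f' (chart b₀ b₀) := (𝓑.smooth_p b₀).2
  have hf'' : ContDiffAt ℝ ∞ f'' (chart b₀ b₀) := (𝓑.smooth_q b₀).2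
  have hf'0 : f' (chart b₀ b₀) = chart (𝓑.p b₀) (𝓑.p b₀) := by simp only [f', hb₀]
  have hf''0 : f'' (chart b₀ b₀) = chart (𝓑.q b₀) (𝓑.q b₀) := by simp only [f'', hb₀]
  -- Test covectors and vectors dual to the chosen frames, padded by zero to sequences. With them
  -- the component of `s` is its coefficient times the nonvanishing determinant `d'`.
  let βx : ℕ → Module.Dual ℝ (Tan (Γ'.unit (𝓑.p b₀))) := fun i => if hi : i < _ then β' ⟨i, hi⟩ else 0
  let wx : ℕ → Tan (𝓑.p b₀) := fun i => if hi : i < _ then stdBasis (𝓑.p b₀) ⟨i, hi⟩ else 0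
  let d' : Tan (𝓑.p b₀) → ℝ := fun u => Matrix.det (.of fun i j => β' j (e' i u))
  let d'' : Tan (𝓑.q b₀) → ℝ := fun u => Matrix.det (.of fun i j : Fin (Γ''.rank (𝓑.q b₀)) => β j (e'' i u))
  have hd' : ContDiffAt ℝ ∞ d' (chart (𝓑.p b₀) (𝓑.p b₀)) := contDiffAt_det fun i j =>
    (LinearMap.toContinuousLinearMap (β' j)).contDiff.contDiffAt.comp _ (he' i)
  have hd'' : ContDiffAt ℝ ∞ d'' (chart (𝓑.q b₀) (𝓑.q b₀)) := contDiffAt_det fun i j =>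
    (LinearMap.toContinuousLinearMap (β j)).contDiff.contDiffAt.comp _ (he'' i)
  have hd'0 : d' (chart (𝓑.p b₀) (𝓑.p b₀)) ≠ 0 := hev'.self_of_nhds.1
  let σ : ℝ := (-1) ^ (Γ'.rank (𝓑.p b₀) * Γ''.rank (𝓑.q b₀))
  -- The first quotient is the coefficient of `s`. The correspondence multiplies it by `σ X / Y` to
  -- give the coefficient of `t`, and the last factor turns that into the requested component.
  let M : Tan b₀ → ℝ := fun u =>
    Γ'.component s (𝓑.p b₀) βx wx ((chart (𝓑.p b₀)).symm (f' u)) / d' (f' u) * (σ * X u / Y u) *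
      (d'' (f'' u) * (stdBasis (𝓑.q b₀)).det (fun j => w j))
  have hM : ContDiffAt ℝ ∞ M (chart b₀ b₀) := by
    have h1 : ContDiffAt ℝ ∞ (fun u => Γ'.component s (𝓑.p b₀) βx wx ((chart (𝓑.p b₀)).symm (f' u)))
        (chart b₀ b₀) := by
      refine ContDiffAt.comp (g := Γ'.component s (𝓑.p b₀) βx wx ∘ (chart (𝓑.p b₀)).symm) _ ?_ hf'
      rw [hf'0]
      exact hs (𝓑.p b₀) βx wx
    have h2 : ContDiffAt ℝ ∞ (fun u => d' (f' u)) (chart b₀ b₀) := by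
      refine ContDiffAt.comp (g := d') _ ?_ hf'
      rwa [hf'0]
    have h3 : ContDiffAt ℝ ∞ (fun u => d'' (f'' u)) (chart b₀ b₀) := by
      refine ContDiffAt.comp (g := d'') _ ?_ hf''
      rwa [hf''0]
    exact ((h1.div h2 (by rwa [hf'0])).mul ((contDiffAt_const.mul hX).div hY hY0)).mul
      (h3.mul contDiffAt_const)
  have key : ∀ᶠ b in 𝓝 b₀, Γ''.component t (𝓑.q b₀) β w (𝓑.q b) = M (chart b₀ b) := by
    have hYne : ∀ᶠ b in 𝓝 b₀, Y (chart b₀ b) ≠ 0 :=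
      ((chart b₀).continuousAt (mem_chart_source b₀)).eventually
        (hY.continuousAt.eventually_ne hY0)
    filter_upwards [hpc.eventually hev', hqc.eventually hev'', hXb, hYb, hYne,
      hpc (chart_source_mem_nhds (mem_chart_source (𝓑.p b₀))),
      hqc (chart_source_mem_nhds (mem_chart_source (𝓑.q b₀))),
      chart_source_mem_nhds (mem_chart_source b₀)]
      with b hb' hb'' hXb hYb hYne hx hy hb
    obtain ⟨h1, hk', a', ha'⟩ := hb'
    obtain ⟨-, hk'', a'', ha''⟩ := hb''
    obtain ⟨t'', ht'', hXt⟩ := hXb hk' hy a' ha'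
    obtain ⟨t', ht', hYt⟩ := hYb hk'' hx a'' ha''
    have h2 := hst b a' a'' (chartBasis hx) (chartBasis hy) t' t'' ht' ht''
    have h3 := congrArg (fun z => φ (map (coordChange b b₀ b).toLinearMap z)) h2
    simp only [map_smul, smul_eq_mul] at h3
    have h4 : φ (map (coordChange b b₀ b).toLinearMap (ιMulti ℝ _ (fun i =>
        𝓑.rgen b (𝓑.q b) (a'' i)) * ιMulti ℝ _ t')) = Y (chart b₀ b) := hYt
    have hbb : (chart b₀).symm (chart b₀ b) = b := (chart b₀).left_inv hb
    have e1 : f' (chart b₀ b) = chart (𝓑.p b₀) (𝓑.p b) := by simp only [f', hbb]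
    have e2 : f'' (chart b₀ b) = chart (𝓑.q b₀) (𝓑.q b) := by simp only [f'', hbb]
    have e3 : (chart (𝓑.p b₀)).symm (chart (𝓑.p b₀) (𝓑.p b)) = 𝓑.p b := (chart (𝓑.p b₀)).left_inv hx
    have e4 := Γ'.component_eq (e := fun i => e' i (chart (𝓑.p b₀) (𝓑.p b))) hx hk' a' ha' s βx wx
    have e5 : Matrix.det (.of fun i j : Fin (Γ'.rank (𝓑.p b₀)) =>
        βx j (e' i (chart (𝓑.p b₀) (𝓑.p b)))) = d' (chart (𝓑.p b₀) (𝓑.p b)) := by simp [d', βx]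
    have e6 : (stdBasis (𝓑.p b₀)).det (fun j => wx j) = 1 := by
      have : (fun j : Fin (dim (𝓑.p b₀)) => wx j) = stdBasis (𝓑.p b₀) := by
        funext j
        simp [wx]
      rw [this, Module.Basis.det_self]
    simp only [M, e1, e2, e3]
    rw [e4, Γ''.component_eq (e := fun i => e'' i (chart (𝓑.q b₀) (𝓑.q b))) hy hk'' a'' ha'' t β w, e5, e6]
    have e7 : Γ'.coeff (𝓑.p b) a' (chartBasis hx) (s (𝓑.p b)) * X (chart b₀ b) =
        σ * Γ''.coeff (𝓑.q b) a'' (chartBasis hy) (t (𝓑.q b)) * Y (chart b₀ b) := by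
      rw [← hXt, ← h4]
      have : σ = (-1) ^ (Γ'.rank (𝓑.p b) * Γ''.rank (𝓑.q b)) := by simp only [σ, hk', hk'']
      rw [this]
      exact h3
    have e8 : σ * σ = 1 := neg_one_pow_mul_self _
    rw [mul_one, mul_div_cancel_right₀ _ (show d' _ ≠ 0 from h1)]
    change _ * (d'' _ * _) = _ * _ * (d'' _ * _)
    congr 1
    rw [mul_div_assoc', eq_div_iff hYne]
    linear_combination (-σ) * e7 - Γ''.coeff (𝓑.q b) a'' (chartBasis hy) (t (𝓑.q b)) *
      Y (chart b₀ b) * e8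
  -- compose with a local section of `q`
  obtain ⟨ρ, hρ, hρq⟩ := exists_local_section (𝓑.smooth_q b₀) rfl (h.q_submersion.2 b₀)
  have h1 : ContDiffAt ℝ ∞ (fun u => M (chart b₀ (ρ u))) (chart (𝓑.q b₀) (𝓑.q b₀)) := by
    refine ContDiffAt.comp (g := M) (f := fun u => chart b₀ (ρ u)) _ ?_
      (hρ.2.2.contDiffAt univ_mem)
    simp only [hρ.1]
    exact hM
  refine h1.congr_of_eventuallyEq ?_
  have h2 : ∀ᶠ u in 𝓝 (chart (𝓑.q b₀) (𝓑.q b₀)), Γ''.component t (𝓑.q b₀) β w (𝓑.q (ρ u)) = M (chart b₀ (ρ u)) := by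
    have := hρ.eventually_mem key
    rwa [nhdsWithin_univ] at this
  filter_upwards [h2, hρq] with u h2 h3
  rw [← h2, h3]
  rfl

end Bibundle
end LieGpd
end

open scoped ContDiff Topology TensorProduct

noncomputable section

namespace LieGpd

open Set Filter

namespace Bibundle

variable {G' G'₀ G'' G''₀ K K₀ : Type*}
  [TopologicalSpace G'] [MixedManifold G'] [TopologicalSpace G'₀] [MixedManifold G'₀]
  [TopologicalSpace G''] [MixedManifold G''] [TopologicalSpace G''₀] [MixedManifold G''₀]
  [TopologicalSpace K] [MixedManifold K] [TopologicalSpace K₀] [MixedManifold K₀]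
  {Γ' : LieGroupoid G' G'₀} {Γ'' : LieGroupoid G'' G''₀} {Λ : LieGroupoid K K₀}
  {B C D : Type*} [TopologicalSpace B] [MixedManifold B] [TopologicalSpace C] [MixedManifold C]
  [TopologicalSpace D] [MixedManifold D]
  {𝓑 : Bibundle Γ' Γ'' B} {𝓒 : Bibundle Γ'' Λ C} {𝓓 : Bibundle Γ' Λ D}

/-! ### The induced isomorphism -/

theorem correspondsAt_of_forall {s : ∀ x, Γ'.Q x} {t : ∀ y, Γ''.Q y}
    (hst : ∀ b, 𝓑.Corresponds b (s (𝓑.p b)) (t (𝓑.q b))) {b : B} {x : G'₀} {y : G''₀}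
    (hx : 𝓑.p b = x) (hy : 𝓑.q b = y) : 𝓑.CorrespondsAt b x y (s x) (t y) := by
  subst hx hy
  exact hst b

theorem IsInvertible.eq_of_corresponds (h : 𝓑.IsInvertible) {s : ∀ x, Γ'.Q x}
    {t t₁ : ∀ y, Γ''.Q y} (ht : ∀ b, 𝓑.Corresponds b (s (𝓑.p b)) (t (𝓑.q b)))
    (ht₁ : ∀ b, 𝓑.Corresponds b (s (𝓑.p b)) (t₁ (𝓑.q b))) : t = t₁ := by
  funext y
  obtain ⟨b, rfl⟩ := h.q_surjective y
  exact (h.existsUnique_right rfl rfl _).unique (ht b) (ht₁ b)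

theorem op_corresponds {b : B} {ξ' : Γ'.Q (𝓑.p b)} {ξ'' : Γ''.Q (𝓑.q b)}
    (h : 𝓑.Corresponds b ξ' ξ'') : 𝓑.op.Corresponds b ξ'' ξ' :=
  CorrespondsAt.op (𝓑 := 𝓑) h

/-- Every smooth invariant section corresponds to a smooth invariant section. -/
theorem IsInvertible.exists_corresponds (h : 𝓑.IsInvertible) (s : Γ'.invariantSections) :
    ∃ t : Γ''.invariantSections, ∀ b, 𝓑.Corresponds b (s.1 (𝓑.p b)) (t.1 (𝓑.q b)) := by
  choose β hβ using h.q_surjective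
  choose t ht using fun y => (h.existsUnique_right rfl (hβ y) (s.1 (𝓑.p (β y)))).exists
  -- `t` is defined through one chosen point `β y` of each fibre of `q`. Any other point of the
  -- fibre is `g · β y`; invariance of `s` under `g`, composed with the correspondence at `β y`,
  -- gives the one at that point.
  have hst : ∀ b, 𝓑.Corresponds b (s.1 (𝓑.p b)) (t (𝓑.q b)) := fun b => by
    obtain ⟨δ, -, h1, -⟩ := h.left_principal
    obtain ⟨h2, h3⟩ := h1 b (β (𝓑.q b)) (hβ _).symm
    refine (isBalanced_lact 𝓑).correspondsAt Γ'.isInvertible_toBibundle h h ?_ h2 rfl (hβ _) h3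
      (correspondsAt_of_forall (𝓑 := Γ'.toBibundle) s.2.2 ?_ h2) (ht (𝓑.q b)) <;>
    · change Γ'.l _ = _
      rw [← 𝓑.p_lact _ _ h2, h3]
  refine ⟨⟨t, h.isSmoothSection s.2.1 hst, fun k => ?_⟩, hst⟩
  obtain ⟨b, hb⟩ := h.q_surjective (Γ''.l k)
  -- Let `η` be what the arrow `k` assigns to `t (l k)`. Composition along the right action makes it
  -- correspond to `s (p b)` at `b k`, where `t (r k)` does too; uniqueness identifies them.
  obtain ⟨η, hη, -⟩ := Γ''.isInvertible_toBibundle.existsUnique_right (b := k) rfl rfl (t (Γ''.l k))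
  have h1 := (isBalanced_ract 𝓑).correspondsAt h Γ''.isInvertible_toBibundle h rfl hb rfl rfl rfl
    (correspondsAt_of_forall hst rfl hb) hη
  have h2 : η = t (Γ''.r k) := (h.existsUnique_right (𝓑.p_ract _ _ hb) (𝓑.q_ract _ _ hb) _).unique
    h1 (correspondsAt_of_forall hst (𝓑.p_ract _ _ hb) (𝓑.q_ract _ _ hb))
  rw [← h2]
  exact hη

theorem Corresponds.add {b : B} {ξ' η' : Γ'.Q (𝓑.p b)} {ξ'' η'' : Γ''.Q (𝓑.q b)}
    (h : 𝓑.Corresponds b ξ' ξ'') (h' : 𝓑.Corresponds b η' η'') :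
    𝓑.Corresponds b (ξ' + η') (ξ'' + η'') := by
  intro e' e'' τ' τ'' t' t'' ht' ht''
  rw [map_add, map_add, mul_add, add_smul, add_smul, h e' e'' τ' τ'' t' t'' ht' ht'',
    h' e' e'' τ' τ'' t' t'' ht' ht'']

theorem Corresponds.smul {b : B} {ξ' : Γ'.Q (𝓑.p b)} {ξ'' : Γ''.Q (𝓑.q b)}
    (h : 𝓑.Corresponds b ξ' ξ'') (c : ℝ) : 𝓑.Corresponds b (c • ξ') (c • ξ'') := by
  intro e' e'' τ' τ'' t' t'' ht' ht''
  rw [map_smul, map_smul, smul_eq_mul, smul_eq_mul, mul_smul, h e' e'' τ' τ'' t' t'' ht' ht'',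
    smul_smul, mul_left_comm]

theorem IsInvertible.induces_unique (h : 𝓑.IsInvertible)
    {Φ Φ₁ : Γ'.invariantSections ≃ₗ[ℝ] Γ''.invariantSections} (hΦ : 𝓑.Induces Φ)
    (hΦ₁ : 𝓑.Induces Φ₁) : Φ = Φ₁ :=
  LinearEquiv.ext fun s => Subtype.ext (h.eq_of_corresponds (hΦ s) (hΦ₁ s))

/-- Linearity follows from uniqueness of the corresponding section. Injectivity and surjectivity are
uniqueness and existence for the opposite bibundle. -/
theorem IsInvertible.exists_induces (h : 𝓑.IsInvertible) :
    ∃ Φ : Γ'.invariantSections ≃ₗ[ℝ] Γ''.invariantSections, 𝓑.Induces Φ := by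
  choose Φ hΦ using h.exists_corresponds
  let Φ₁ : Γ'.invariantSections →ₗ[ℝ] Γ''.invariantSections :=
    { toFun := Φ
      map_add' := fun s t => Subtype.ext (h.eq_of_corresponds (hΦ (s + t))
        fun b => (hΦ s b).add (hΦ t b))
      map_smul' := fun c s => Subtype.ext (h.eq_of_corresponds (hΦ (c • s))
        fun b => (hΦ s b).smul c) }
  refine ⟨LinearEquiv.ofBijective Φ₁ ⟨fun s s₁ hs => ?_, fun t => ?_⟩, hΦ⟩
  · have hs' : Φ s = Φ s₁ := hs
    refine Subtype.ext (h.op.eq_of_corresponds (s := (Φ s).1) (fun b => op_corresponds (hΦ s b)) ?_)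
    rw [hs']
    exact fun b => op_corresponds (hΦ s₁ b)
  · obtain ⟨s, hs⟩ := h.op.exists_corresponds t
    exact ⟨s, Subtype.ext (h.eq_of_corresponds (hΦ s)
      fun b => CorrespondsAt.of_op (𝓑 := 𝓑) (hs b))⟩

theorem toBibundle_induces_refl (Γ : LieGroupoid G' G'₀) :
    Γ.toBibundle.Induces (LinearEquiv.refl ℝ Γ.invariantSections) := fun s => s.2.2

end Bibundle
end LieGpd
end

open scoped ContDiff Topology TensorProduct

noncomputable section

namespace LieGpd

open Set Filter

namespace Bibundle

variable {G' G'₀ G'' G''₀ K K₀ : Type*}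
  [TopologicalSpace G'] [MixedManifold G'] [TopologicalSpace G'₀] [MixedManifold G'₀]
  [TopologicalSpace G''] [MixedManifold G''] [TopologicalSpace G''₀] [MixedManifold G''₀]
  [TopologicalSpace K] [MixedManifold K] [TopologicalSpace K₀] [MixedManifold K₀]
  {Γ' : LieGroupoid G' G'₀} {Γ'' : LieGroupoid G'' G''₀} {Λ : LieGroupoid K K₀}
  {B C D : Type*} [TopologicalSpace B] [MixedManifold B] [TopologicalSpace C] [MixedManifold C]
  [TopologicalSpace D] [MixedManifold D]
  {𝓑 : Bibundle Γ' Γ'' B} {𝓒 : Bibundle Γ'' Λ C} {𝓓 : Bibundle Γ' Λ D}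

/-! ### Composition -/

/-- A balanced map which presents `D` as the quotient of `B ×_{G''₀} C` by `G''`. -/
structure IsQuotient (𝓑 : Bibundle Γ' Γ'' B) (𝓒 : Bibundle Γ'' Λ C) (𝓓 : Bibundle Γ' Λ D)
    (π : B → C → D) : Prop extends IsBalanced 𝓑 𝓒 𝓓 π where
  surj : ∀ d, ∃ b c, 𝓑.q b = 𝓒.p c ∧ π b c = d
  sections : ∀ b c, 𝓑.q b = 𝓒.p c → ∃ (σ : D → B) (ρ : D → C),
    σ (π b c) = b ∧ ρ (π b c) = c ∧ IsSmoothAt σ (π b c) ∧ IsSmoothAt ρ (π b c) ∧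
      ∀ᶠ d in 𝓝 (π b c), 𝓑.q (σ d) = 𝓒.p (ρ d) ∧ π (σ d) (ρ d) = d
  orbit : ∀ b c b₁ c₁, 𝓑.q b = 𝓒.p c → 𝓑.q b₁ = 𝓒.p c₁ → π b c = π b₁ c₁ →
    ∃ h, 𝓑.q b = Γ''.l h ∧ b₁ = 𝓑.ract b h ∧ c₁ = 𝓒.lact (Γ''.inv h) c

theorem IsComposition.exists_isQuotient (h : 𝓑.IsComposition 𝓒 𝓓) :
    ∃ π : B → C → D, IsQuotient 𝓑 𝓒 𝓓 π := by
  obtain ⟨π, h1, h2, h3, h4, h5, h6, h7⟩ := h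
  refine ⟨π, ⟨h1, fun b c hbc => (h5 b c hbc).1, fun b c hbc => (h5 b c hbc).2, h6, h7,
    fun b c k hbc hk => ?_⟩, h2, fun b c hbc => ?_, fun b c b₁ c₁ hbc hbc₁ => (h4 _ _ _ _ hbc hbc₁).1⟩
  -- Balancedness is the half of the orbit condition saying that `π` is constant on orbits.
  · refine ((h4 b c _ _ hbc ?_).2 ⟨k, hk, rfl, rfl⟩).symm
    rw [𝓑.q_ract _ _ hk, 𝓒.p_lact _ _ (by rw [Γ''.r_inv, ← hk, hbc]), Γ''.l_inv]
  · obtain ⟨σ, ρ, hσ, hρ, hev⟩ := h3 b c hbc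
    exact ⟨σ, ρ, hσ, hρ, hev.self_of_nhds.1, hev.self_of_nhds.2.1, hev.mono fun d hd => hd.2.2⟩

variable {π : B → C → D}

/-- Passing to opposites reverses the order of the composition, so statements about `q` and the
right action follow from those about `p` and the left action. -/
theorem IsQuotient.op (h : IsQuotient 𝓑 𝓒 𝓓 π) :
    IsQuotient 𝓒.op 𝓑.op 𝓓.op (fun c b => π b c) where
  smooth := by
    refine isSmoothOn₂_of_plot fun x y hxy => ?_
    refine h.smooth.comp_plot (φ := fun u : Tan x × Tan y => (chart y).symm u.2)
      (ψ := fun u : Tan x × Tan y => (chart x).symm u.1)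
      ((SmoothPlot.chart_symm y).comp_univ rfl contDiffWithinAt_snd)
      ((SmoothPlot.chart_symm x).comp_univ rfl contDiffWithinAt_fst) (Eq.symm hxy) ?_
    filter_upwards [self_mem_nhdsWithin] with u hu
    exact Eq.symm hu
  p_map c b hbc := h.q_map b c (Eq.symm hbc)
  q_map c b hbc := h.p_map b c (Eq.symm hbc)
  lact_map k c b hk hbc :=
    h.ract_map b c _ (Eq.symm hbc) (Eq.trans (Eq.symm hk) (Λ.l_inv k).symm)
  ract_map c b g hbc hg :=
    h.lact_map _ b c (Eq.trans (Γ'.r_inv g) (Eq.symm hg)) (Eq.symm hbc)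
  balanced c b k hbc hk := by
    have hk' : 𝓑.q b = Γ''.l k := Eq.trans (Eq.symm hbc) hk
    have := h.balanced b c k (Eq.symm hbc) hk'
    change π (𝓑.ract b (Γ''.inv (Γ''.inv k))) (𝓒.lact (Γ''.inv k) c) = _
    rwa [Γ''.inv_inv]
  surj d := by
    obtain ⟨b, c, hbc, hd⟩ := h.surj d
    exact ⟨c, b, hbc.symm, hd⟩
  sections c b hbc := by
    obtain ⟨σ, ρ, h1, h2, h3, h4, h5⟩ := h.sections b c (Eq.symm hbc)
    exact ⟨ρ, σ, h2, h1, h4, h3, h5.mono fun d hd => ⟨hd.1.symm, hd.2⟩⟩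
  orbit c b c₁ b₁ hbc hbc₁ heq := by
    obtain ⟨k, hk, hb, hc⟩ := h.orbit b c b₁ c₁ (Eq.symm hbc) (Eq.symm hbc₁) heq
    refine ⟨k, hbc.trans hk, hc, ?_⟩
    change b₁ = 𝓑.ract b (Γ''.inv (Γ''.inv k))
    rwa [Γ''.inv_inv]

theorem IsInvertible.lact_injective (h : 𝓑.IsInvertible) {g k : G'} {b : B}
    (hg : Γ'.r g = 𝓑.p b) (hk : Γ'.r k = 𝓑.p b) (heq : 𝓑.lact g b = 𝓑.lact k b) : g = k := by
  obtain ⟨δ, -, -, hδ⟩ := h.left_principal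
  rw [← hδ g b hg, heq, hδ k b hk]

section Quotient

variable (hπ : IsQuotient 𝓑 𝓒 𝓓 π) (h𝓑 : 𝓑.IsInvertible) (h𝓒 : 𝓒.IsInvertible)

include hπ h𝓑 h𝓒

/-- A tangent vector of G'₀ lifts to B because `𝓑.p` is a submersion, and then to a pair tangent to
the fibre product because `𝓒.p` is one; the differential of `π` carries the pair to the required
lift. -/
theorem IsQuotient.p_submersion : IsSubmersion 𝓓.p := by
  refine ⟨𝓓.smooth_p, fun d w => ?_⟩
  obtain ⟨b, c, hbc, rfl⟩ := hπ.surj d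
  have hp := hπ.p_map b c hbc
  obtain ⟨v, rfl⟩ := h𝓑.p_submersion.surjective_tmapTo hp.symm w
  obtain ⟨β, hβ⟩ := exists_hasVel b v
  have h0 := hβ.map (𝓑.smooth_q b) rfl
  have hs := h𝓒.p_submersion.surjective_tmapTo hbc.symm
  obtain ⟨v', hv'⟩ := hs (tmapTo 𝓑.q b (𝓑.q b) v)
  rw [← hv'] at h0
  obtain ⟨γ, hγ, h1⟩ := exists_lift_curve (𝓒.smooth_p c) hbc.symm hs h0
  have h2 : ∀ᶠ t in 𝓝 0, 𝓑.q (β t) = 𝓒.p (γ t) := h1.mono fun t ht => ht.symm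
  have h3 := hβ.map₂ hπ.smooth hγ rfl h2
  refine ⟨_, (h3.map (𝓓.smooth_p _) rfl).unique ((hβ.map (𝓑.smooth_p b) hp.symm).congr ?_)⟩
  exact h2.mono fun t ht => hπ.p_map _ _ ht

omit hπ in
theorem IsQuotient.p_surjective (hπ : IsBalanced 𝓑 𝓒 𝓓 π) : Function.Surjective 𝓓.p := fun x => by
  obtain ⟨b, rfl⟩ := h𝓑.p_surjective x
  obtain ⟨c, hc⟩ := h𝓒.p_surjective (𝓑.q b)
  exact ⟨π b c, hπ.p_map b c hc.symm⟩

/-- If `(gb, c)` and `(kb, c)` lie in one orbit, the arrow between them fixes `c` and is a unit by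
freeness on C. Hence `gb = kb`, and freeness on B applies. -/
theorem IsQuotient.lact_injective {g k : G'} {d : D} (hg : Γ'.r g = 𝓓.p d) (hk : Γ'.r k = 𝓓.p d)
    (heq : 𝓓.lact g d = 𝓓.lact k d) : g = k := by
  obtain ⟨b, c, hbc, rfl⟩ := hπ.surj d
  rw [hπ.p_map b c hbc] at hg hk
  rw [hπ.lact_map g b c hg hbc, hπ.lact_map k b c hk hbc] at heq
  obtain ⟨m, hm, h1, h2⟩ := hπ.orbit _ _ _ _ ((𝓑.q_lact g b hg).trans hbc)
    ((𝓑.q_lact k b hk).trans hbc) heq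
  have hm' : 𝓑.q b = Γ''.l m := (𝓑.q_lact g b hg).symm.trans hm
  have h3 : Γ''.inv m = Γ''.unit (𝓒.p c) :=
    h𝓒.lact_injective (by rw [Γ''.r_inv, ← hm', hbc]) (Γ''.r_unit _)
      (by rw [← h2, 𝓒.unit_lact])
  have h4 : m = Γ''.unit (𝓑.q (𝓑.lact g b)) := by
    rw [← Γ''.inv_inv m, h3, Γ''.inv_unit, 𝓑.q_lact g b hg, hbc]
  rw [h4, 𝓑.ract_unit] at h1
  exact h𝓑.lact_injective hg hk h1.symm

/-- To divide `[b, c]` by `[b₁, c₁]`, write `c = κ c₁`. Then `[b, c] = [b κ, c₁]`, and the quotient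
is the arrow from `b₁` to `b κ` in B. -/
theorem IsQuotient.left_principal : ∃ δ : D → D → G', IsSmoothOn₂ δ {z | 𝓓.q z.1 = 𝓓.q z.2} ∧
    (∀ d e, 𝓓.q d = 𝓓.q e → Γ'.r (δ d e) = 𝓓.p e ∧ 𝓓.lact (δ d e) e = d) ∧
    (∀ g e, Γ'.r g = 𝓓.p e → δ (𝓓.lact g e) e = g) := by
  obtain ⟨δ, hδ, hδ₁, -⟩ := h𝓑.left_principal
  obtain ⟨κ, hκ, hκ₁, -⟩ := h𝓒.left_principal
  have hκl : ∀ {c c₁}, 𝓒.q c = 𝓒.q c₁ → Γ''.l (κ c c₁) = 𝓒.p c := fun {c c₁} h => by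
    rw [← 𝓒.p_lact _ _ (hκ₁ c c₁ h).1, (hκ₁ c c₁ h).2]
  -- the division map in terms of representatives
  have div : ∀ b c b₁ c₁, 𝓑.q b = 𝓒.p c → 𝓑.q b₁ = 𝓒.p c₁ → 𝓒.q c = 𝓒.q c₁ →
      𝓑.q (𝓑.ract b (κ c c₁)) = 𝓑.q b₁ ∧
      Γ'.r (δ (𝓑.ract b (κ c c₁)) b₁) = 𝓓.p (π b₁ c₁) ∧
      𝓓.lact (δ (𝓑.ract b (κ c c₁)) b₁) (π b₁ c₁) = π b c := by
    intro b c b₁ c₁ hbc hbc₁ hq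
    obtain ⟨h1, h2⟩ := hκ₁ c c₁ hq
    have h3 : 𝓑.q b = Γ''.l (κ c c₁) := hbc.trans (hκl hq).symm
    have h4 : 𝓑.q (𝓑.ract b (κ c c₁)) = 𝓑.q b₁ := by rw [𝓑.q_ract _ _ h3, h1, hbc₁]
    obtain ⟨h5, h6⟩ := hδ₁ _ _ h4
    refine ⟨h4, by rw [hπ.p_map _ _ hbc₁, h5], ?_⟩
    rw [hπ.lact_map _ _ _ h5 hbc₁, h6]
    have h7 := hπ.balanced b c _ hbc h3
    have h8 := 𝓒.inv_lact_lact h1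
    rw [h2] at h8
    rwa [h8] at h7
  have ex : ∀ d e, ∃ g, 𝓓.q d = 𝓓.q e → Γ'.r g = 𝓓.p e ∧ 𝓓.lact g e = d := fun d e => by
    obtain ⟨b, c, hbc, rfl⟩ := hπ.surj d
    obtain ⟨b₁, c₁, hbc₁, rfl⟩ := hπ.surj e
    refine ⟨_, fun hq => (div b c b₁ c₁ hbc hbc₁ ?_).2⟩
    rwa [hπ.q_map _ _ hbc, hπ.q_map _ _ hbc₁] at hq
  -- `ε` is chosen pointwise, without regularity. By freeness it must agree with the formula of
  -- `div` on smooth local representatives, and this is what makes it smooth.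
  choose ε hε using ex
  refine ⟨ε, isSmoothOn₂_of_plot fun d e hde => ?_, hε, fun g e hg => ?_⟩
  · obtain ⟨b, c, hbc, rfl⟩ := hπ.surj d
    obtain ⟨b₁, c₁, hbc₁, rfl⟩ := hπ.surj e
    obtain ⟨σ, ρ, hσ0, hρ0, hσ, hρ, hev⟩ := hπ.sections b c hbc
    obtain ⟨σ₁, ρ₁, hσ₁0, hρ₁0, hσ₁, hρ₁, hev₁⟩ := hπ.sections b₁ c₁ hbc₁
    set S := {u : Tan (π b c) × Tan (π b₁ c₁) |
      ((chart (π b c)).symm u.1, (chart (π b₁ c₁)).symm u.2) ∈ {z : D × D | 𝓓.q z.1 = 𝓓.q z.2}}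
      with hS
    have hφ : SmoothPlot (fun u : Tan (π b c) × Tan (π b₁ c₁) => (chart (π b c)).symm u.1) S
        (chart (π b c) (π b c), chart (π b₁ c₁) (π b₁ c₁)) (π b c) :=
      (SmoothPlot.chart_symm _).comp_univ rfl contDiffWithinAt_fst
    have hψ : SmoothPlot (fun u : Tan (π b c) × Tan (π b₁ c₁) => (chart (π b₁ c₁)).symm u.2) S
        (chart (π b c) (π b c), chart (π b₁ c₁) (π b₁ c₁)) (π b₁ c₁) :=
      (SmoothPlot.chart_symm _).comp_univ rfl contDiffWithinAt_snd
    have hcc : 𝓒.q c = 𝓒.q c₁ := by rw [← hπ.q_map _ _ hbc, ← hπ.q_map _ _ hbc₁]; exact hde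
    have pσ := hσ.comp_plot hφ
    have pρ := hρ.comp_plot hφ
    have pσ₁ := hσ₁.comp_plot hψ
    have pρ₁ := hρ₁.comp_plot hψ
    rw [hσ0] at pσ
    rw [hρ0] at pρ
    rw [hσ₁0] at pσ₁
    rw [hρ₁0] at pρ₁
    have e1 := hφ.eventually_mem hev
    have e2 := hψ.eventually_mem hev₁
    have e3 : ∀ᶠ u in 𝓝[S] (chart (π b c) (π b c), chart (π b₁ c₁) (π b₁ c₁)),
        𝓒.q (ρ ((chart (π b c)).symm u.1)) = 𝓒.q (ρ₁ ((chart (π b₁ c₁)).symm u.2)) := by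
      filter_upwards [e1, e2, self_mem_nhdsWithin] with u h1 h2 h3
      rw [← hπ.q_map _ _ h1.1, ← hπ.q_map _ _ h2.1, h1.2, h2.2]
      exact h3
    have pκ := hκ.comp_plot pρ pρ₁ hcc e3
    have pr := 𝓑.smooth_ract.comp_plot pσ pκ (hbc.trans (hκl hcc).symm) (by
      filter_upwards [e1, e3] with u h1 h3
      exact h1.1.trans (hκl h3).symm)
    have pδ := hδ.comp_plot pr pσ₁ (div b c b₁ c₁ hbc hbc₁ hcc).1 (by
      filter_upwards [e1, e2, e3] with u h1 h2 h3
      exact (div _ _ _ _ h1.1 h2.1 h3).1)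
    have heq : ε (π b c) (π b₁ c₁) = δ (𝓑.ract b (κ c c₁)) b₁ := by
      obtain ⟨-, h1, h2⟩ := div b c b₁ c₁ hbc hbc₁ hcc
      obtain ⟨h3, h4⟩ := hε _ _ hde
      exact hπ.lact_injective h𝓑 h𝓒 h3 h1 (h4.trans h2.symm)
    rw [heq]
    have hev : ∀ᶠ u in 𝓝[S] (chart (π b c) (π b c), chart (π b₁ c₁) (π b₁ c₁)),
        ε ((chart (π b c)).symm u.1) ((chart (π b₁ c₁)).symm u.2) =
          δ (𝓑.ract (σ ((chart (π b c)).symm u.1)) (κ (ρ ((chart (π b c)).symm u.1))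
            (ρ₁ ((chart (π b₁ c₁)).symm u.2)))) (σ₁ ((chart (π b₁ c₁)).symm u.2)) := by
      filter_upwards [e1, e2, e3, self_mem_nhdsWithin] with u h1 h2 h3 h4
      obtain ⟨-, h5, h6⟩ := div _ _ _ _ h1.1 h2.1 h3
      rw [h1.2, h2.2] at h6
      rw [h2.2] at h5
      obtain ⟨h7, h8⟩ := hε _ _ h4
      exact hπ.lact_injective h𝓑 h𝓒 h7 h5 (h8.trans h6.symm)
    refine pδ.congr hev (hev.self_of_nhdsWithin ?_)
    change 𝓓.q _ = 𝓓.q _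
    simp only [(chart _).left_inv (mem_chart_source _)]
    exact hde
  · have hq := 𝓓.q_lact g e hg
    obtain ⟨h1, h2⟩ := hε _ _ hq
    exact hπ.lact_injective h𝓑 h𝓒 h1 hg h2

/-- The composition of invertible bibundles is invertible. -/
theorem IsQuotient.isInvertible : 𝓓.IsInvertible := by
  obtain ⟨δ, hδ, h1, h2⟩ := hπ.op.left_principal h𝓒.op h𝓑.op
  refine ⟨hπ.p_submersion h𝓑 h𝓒, IsQuotient.p_surjective h𝓑 h𝓒 hπ.toIsBalanced,
    hπ.op.p_submersion h𝓒.op h𝓑.op,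
    IsQuotient.p_surjective h𝓒.op h𝓑.op hπ.op.toIsBalanced, hπ.left_principal h𝓑 h𝓒,
    δ, hδ, fun d e hde => ?_, fun d k hk => ?_⟩
  · obtain ⟨h3, h4⟩ := h1 d e hde
    have h5 := 𝓓.op.p_lact _ _ h3
    rw [h4] at h5
    refine ⟨h5, ?_⟩
    have h6 := 𝓓.ract_inv_ract (Eq.symm h3)
    change 𝓓.ract e (Λ.inv (δ d e)) = d at h4
    rwa [h4] at h6
  · have h3 := h2 k (𝓓.ract d k) (𝓓.q_ract _ _ hk).symm
    change δ (𝓓.ract (𝓓.ract d k) (Λ.inv k)) _ = k at h3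
    rwa [𝓓.ract_ract_inv hk] at h3

theorem IsQuotient.induces_trans {Φ : Γ'.invariantSections ≃ₗ[ℝ] Γ''.invariantSections}
    {Ψ : Γ''.invariantSections ≃ₗ[ℝ] Λ.invariantSections} (hΦ : 𝓑.Induces Φ) (hΨ : 𝓒.Induces Ψ) :
    𝓓.Induces (Φ.trans Ψ) := fun s d => by
  obtain ⟨b, c, hbc, hd⟩ := hπ.surj d
  have hp := hπ.p_map b c hbc
  have hq := hπ.q_map b c hbc
  rw [hd] at hp hq
  exact hπ.correspondsAt h𝓑 h𝓒 (hπ.isInvertible h𝓑 h𝓒) hp.symm rfl hbc.symm hq.symm hd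
    (correspondsAt_of_forall (hΦ s) hp.symm rfl)
    (correspondsAt_of_forall (hΨ (Φ s)) hbc.symm hq.symm)

end Quotient

end Bibundle
end LieGpd
end

open scoped ContDiff Topology TensorProduct

noncomputable section

namespace LieGpd

open Set Filter

namespace Bibundle

variable {G' G'₀ G'' G''₀ : Type*}
  [TopologicalSpace G'] [MixedManifold G'] [TopologicalSpace G'₀] [MixedManifold G'₀]
  [TopologicalSpace G''] [MixedManifold G''] [TopologicalSpace G''₀] [MixedManifold G''₀]
  {Γ' : LieGroupoid G' G'₀} {Γ'' : LieGroupoid G'' G''₀}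
  {B C : Type*} [TopologicalSpace B] [MixedManifold B] [TopologicalSpace C] [MixedManifold C]
  {𝓑 : Bibundle Γ' Γ'' B} {𝓒 : Bibundle Γ' Γ'' C}

/-! ### Isomorphisms -/

theorem lact_inv_lact (𝓑 : Bibundle Γ' Γ'' B) {g : G'} {b : B} (h : Γ'.l g = 𝓑.p b) :
    𝓑.lact g (𝓑.lact (Γ'.inv g) b) = b := by
  have := 𝓑.inv_lact_lact (g := Γ'.inv g) (b := b) (by rw [Γ'.r_inv, h])
  rwa [Γ'.inv_inv] at this

/-- A bibundle isomorphic to `𝓑` is a composition of the unit bibundle with `𝓑`. -/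
theorem Isomorphic.exists_isQuotient (h : 𝓑.Isomorphic 𝓒) :
    ∃ f : B → C, IsQuotient Γ'.toBibundle 𝓑 𝓒 (fun g b => f (𝓑.lact g b)) := by
  obtain ⟨f, hf, hf', hp, hq, hl, hr⟩ := h
  have hp' : ∀ c, 𝓑.p (f.symm c) = 𝓒.p c := fun c => by rw [← hp, f.apply_symm_apply]
  have h1 := isBalanced_lact 𝓑
  refine ⟨f, ⟨⟨isSmoothOn₂_of_plot fun x y hxy => ?_, fun g b hg => ?_, fun g b hg => ?_,
    fun g k b hg hk => ?_, fun g b k hg hk => ?_, fun g b k hg hk => ?_⟩, fun c => ?_,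
    fun g b hg => ?_, fun g b g₁ b₁ hg hg₁ heq => ?_⟩⟩
  · exact (hf _).comp_plot (𝓑.smooth_lact.comp_plot
      ((SmoothPlot.chart_symm x).comp_univ rfl contDiffWithinAt_fst)
      ((SmoothPlot.chart_symm y).comp_univ rfl contDiffWithinAt_snd) hxy self_mem_nhdsWithin)
  · rw [hp]
    exact h1.p_map g b hg
  · rw [hq]
    exact h1.q_map g b hg
  · rw [← h1.lact_map g k b hg hk]
    exact (hl g _ (Eq.trans hg (h1.p_map k b hk).symm)).symm
  · rw [← h1.ract_map g b k hg hk, hr]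
    exact Eq.trans (h1.q_map g b hg) hk
  · rw [h1.balanced g b k hg hk]
  · refine ⟨Γ'.unit (𝓑.p (f.symm c)), f.symm c, Γ'.r_unit _, ?_⟩
    rw [𝓑.unit_lact, f.apply_symm_apply]
  · have hg' : Γ'.r g = 𝓑.p b := hg
    set d := f (𝓑.lact g b) with hd
    have hd' : f.symm d = 𝓑.lact g b := f.symm_apply_apply _
    have hpd : 𝓒.p d = Γ'.l g := by rw [hd, hp, 𝓑.p_lact _ _ hg']
    -- With a local section `σ` of `l` through `g`, a point `c` near `d` is represented by the pair
    -- of `σ(p c)` and `σ(p c)⁻¹ · f⁻¹(c)`, which depends smoothly on `c`.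
    obtain ⟨σ, hσ, hσl⟩ := exists_local_section (Γ'.l_submersion.1 g) rfl
      (Γ'.l_submersion.2 g)
    have hc : ContinuousAt (fun c => chart (Γ'.l g) (𝓒.p c)) d := by
      refine ContinuousAt.comp (g := chart (Γ'.l g)) ?_ (𝓒.smooth_p d).1
      rw [hpd]
      exact (chart _).continuousAt (mem_chart_source _)
    have hev : ∀ᶠ c in 𝓝 d, Γ'.l (σ (chart (Γ'.l g) (𝓒.p c))) = 𝓒.p c := by
      have h2 : ∀ᶠ c in 𝓝 d, 𝓒.p c ∈ (chart (Γ'.l g)).source :=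
        (𝓒.smooth_p d).1 (by rw [hpd]; exact chart_source_mem_nhds (mem_chart_source _))
      have h5 : ∀ᶠ u in 𝓝 (chart (Γ'.l g) (𝓒.p d)), Γ'.l (σ u) = (chart (Γ'.l g)).symm u := by
        rwa [hpd]
      filter_upwards [hc.eventually h5, h2] with c h3 h4
      rw [h3, (chart _).left_inv h4]
    have hσ0 : σ (chart (Γ'.l g) (𝓒.p d)) = g := by rw [hpd, hσ.1]
    have pσ : SmoothPlot (fun u => σ (chart (Γ'.l g) (𝓒.p ((chart d).symm u)))) univ (chart d d)
        g := by
      have h2 := (𝓒.smooth_p d).comp_plot (SmoothPlot.chart_symm d)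
      refine hσ.comp_univ (by rw [(chart d).left_inv (mem_chart_source d), hpd])
        (h2.contDiffWithinAt_chart ?_)
      rw [hpd]
      exact mem_chart_source _
    refine ⟨fun c => σ (chart (Γ'.l g) (𝓒.p c)),
      fun c => 𝓑.lact (Γ'.inv (σ (chart (Γ'.l g) (𝓒.p c)))) (f.symm c), hσ0, ?_, ?_, ?_, ?_⟩
    · simp only [hσ0, hd']
      exact 𝓑.inv_lact_lact hg'
    · rw [isSmoothAt_iff_plot, hσ0]
      exact pσ
    · rw [isSmoothAt_iff_plot, hσ0]
      refine 𝓑.smooth_lact.comp_plot ((Γ'.smooth_inv g).comp_plot pσ)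
        ((hf' d).comp_plot (SmoothPlot.chart_symm d)) ?_ ?_
      · change Γ'.r _ = 𝓑.p _
        rw [Γ'.r_inv, hp', hpd]
      · filter_upwards [(SmoothPlot.chart_symm d).eventually_mem hev] with u hu
        rw [Γ'.r_inv, hp']
        exact hu
    · filter_upwards [hev] with c h2
      have h3 : Γ'.l (σ (chart (Γ'.l g) (𝓒.p c))) = 𝓑.p (f.symm c) := by rw [h2, hp']
      refine ⟨?_, ?_⟩
      · rw [𝓑.p_lact _ _ (by rw [Γ'.r_inv, h3]), Γ'.l_inv]
        rfl
      · rw [𝓑.lact_inv_lact h3, f.apply_symm_apply]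
  · have hg' : Γ'.r g = 𝓑.p b := hg
    have hg₁' : Γ'.r g₁ = 𝓑.p b₁ := hg₁
    have heq' : 𝓑.lact g b = 𝓑.lact g₁ b₁ := f.injective heq
    have h2 : Γ'.l g = Γ'.l g₁ := by rw [← 𝓑.p_lact _ _ hg', heq', 𝓑.p_lact _ _ hg₁']
    -- Since `g b = g₁ b₁`, the arrow `g⁻¹ g₁` carries `(g, b)` to `(g₁, b₁)`.
    refine ⟨Γ'.mul (Γ'.inv g) g₁, ?_, (Γ'.mul_inv_cancel_left h2).symm, ?_⟩
    · rw [Γ'.l_mul _ _ ((Γ'.r_inv g).trans h2), Γ'.l_inv]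
      rfl
    · rw [Γ'.inv_mul_rev ((Γ'.r_inv g).trans h2), Γ'.inv_inv,
        𝓑.mul_lact _ _ _ ((Γ'.r_inv g₁).trans h2.symm) hg', heq', 𝓑.inv_lact_lact hg₁']

end Bibundle
end LieGpd
end

/-! ### The main theorem -/

theorem mainTheorem2
    {G' G'₀ G'' G''₀ K K₀ B B₁ C D : Type*}
    [TopologicalSpace G'] [LieGpd.MixedManifold G']
    [TopologicalSpace G'₀] [LieGpd.MixedManifold G'₀]
    [TopologicalSpace G''] [LieGpd.MixedManifold G'']
    [TopologicalSpace G''₀] [LieGpd.MixedManifold G''₀]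
    [TopologicalSpace K] [LieGpd.MixedManifold K]
    [TopologicalSpace K₀] [LieGpd.MixedManifold K₀]
    [TopologicalSpace B] [LieGpd.MixedManifold B]
    [TopologicalSpace B₁] [LieGpd.MixedManifold B₁]
    [TopologicalSpace C] [LieGpd.MixedManifold C]
    [TopologicalSpace D] [LieGpd.MixedManifold D]
    (Γ' : LieGpd.LieGroupoid G' G'₀) (Γ'' : LieGpd.LieGroupoid G'' G''₀)
    (Λ : LieGpd.LieGroupoid K K₀)
    (𝓑 : LieGpd.Bibundle Γ' Γ'' B) (h𝓑 : 𝓑.IsInvertible) :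
    (∃! Φ : Γ'.invariantSections ≃ₗ[ℝ] Γ''.invariantSections, 𝓑.Induces Φ) ∧
    (∀ 𝓑₁ : LieGpd.Bibundle Γ' Γ'' B₁, 𝓑.Isomorphic 𝓑₁ →
      𝓑₁.IsInvertible ∧
      ∀ Φ Φ₁ : Γ'.invariantSections ≃ₗ[ℝ] Γ''.invariantSections,
        𝓑.Induces Φ → 𝓑₁.Induces Φ₁ → Φ = Φ₁) ∧
    (∀ (𝓒 : LieGpd.Bibundle Γ'' Λ C) (𝓓 : LieGpd.Bibundle Γ' Λ D),
      𝓒.IsInvertible → 𝓑.IsComposition 𝓒 𝓓 →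
      𝓓.IsInvertible ∧
      ∀ (Φ : Γ'.invariantSections ≃ₗ[ℝ] Γ''.invariantSections)
        (Ψ : Γ''.invariantSections ≃ₗ[ℝ] Λ.invariantSections),
        𝓑.Induces Φ → 𝓒.Induces Ψ → 𝓓.Induces (Φ.trans Ψ)) := by
  open LieGpd.Bibundle in
  refine ⟨?_, fun 𝓑₁ hiso => ?_, fun 𝓒 𝓓 h𝓒 hcomp => ?_⟩
  · obtain ⟨Φ, hΦ⟩ := h𝓑.exists_induces
    exact ⟨Φ, hΦ, fun Ψ hΨ => h𝓑.induces_unique hΨ hΦ⟩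
  · obtain ⟨f, hf⟩ := hiso.exists_isQuotient
    have h₁ := hf.isInvertible Γ'.isInvertible_toBibundle h𝓑
    refine ⟨h₁, fun Φ Φ₁ hΦ hΦ₁ => ?_⟩
    -- The unit bibundle contributes the identity, so the composite isomorphism is `Φ` itself, and
    -- uniqueness for `𝓑₁` concludes.
    have h₂ := hf.induces_trans Γ'.isInvertible_toBibundle h𝓑 (toBibundle_induces_refl Γ') hΦ
    rw [LinearEquiv.refl_trans] at h₂
    exact h₁.induces_unique h₂ hΦ₁
  · obtain ⟨π, hπ⟩ := hcomp.exists_isQuotient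
    exact ⟨hπ.isInvertible h𝓑 h𝓒, fun Φ Ψ hΦ hΨ => hπ.induces_trans h𝓑 h𝓒 hΦ hΨ⟩
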